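/- Let $n\ge 1$ be an integer and $\nu_0,\nu_1\in\mathbb{C}$. Identify $\mathbb{R}^2$ with $\mathbb{C}$ (coordinate $z$, conjugate $z^*$), and let $v_k=\exp(\pi i k/n)$, $k=0,\dots,2n-1$, be the root system $I_2(n)$. Let $R_k$ be the orthogonal reflection $z\mapsto -z^*v_k^2$, acting on functions by $(R_kf)(z)=f(-z^*v_k^2)$; the $R_k$ generate the dihedral group $W(I_2(n))$ of order $2n$ with rotations $S_k=R_kR_0$, $k\in\mathbb{Z}/n$. On the space of smooth complex functions on the plane that are of polynomial growth together with all their derivatives, consider the Dunkl operators $$D_z=2\frac{\partial}{\partial z^*}+\nu_0\sum_{k=0}^{n-1}\frac{v_{2k}}{zv_{2k}^*+z^*v_{2k}}(1-R_{2k})+\nu_1\sum_{k=0}^{n-1}\frac{v_{2k+1}}{zv_{2k+1}^*+z^*v_{2k+1}}(1-R_{2k+1}),$$ $$D_{z^*}=2\frac{\partial}{\partial z}+\nu_0\sum_{k=0}^{n-1}\frac{v_{2k}^*}{zv_{2k}^*+z^*v_{2k}}(1-R_{2k})+\nu_1\sum_{k=0}^{n-1}\frac{v_{2k+1}^*}{zv_{2k+1}^*+z^*v_{2k+1}}(1-R_{2k+1}),$$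 and the deformed annihilation and creation operators $a^\alpha=\frac12(z+(-1)^\alpha D_z)$, $b^\alpha=\frac12(z^*+(-1)^\alpha D_{z^*})$, $\alpha=0,1$. Let $H_{W(I_2(n))}(\nu)$ be the associative algebra of operators generated by $a^\alpha,b^\alpha$ ($\alpha=0,1$) and the dihedral group $W(I_2(n))$, regarded as a superalgebra with parity $\pi(a^\alpha)=\pi(b^\alpha)=1$ and $\pi(g)=0$ for $g\in W(I_2(n))$. A supertrace is a linear function $\mathrm{str}:H_{W(I_2(n))}(\nu)\to\mathbb{C}$ with $\mathrm{str}(fg)=(-1)^{\pi(f)\pi(g)}\mathrm{str}(gf)$ for all $f,g$ of definite parity. Then the supertraces on $H_{W(I_2(n))}(\nu)$ form a complex vector space of dimension exactly $\left[\frac{n+1}{2}\right]$ (in particular $3$ for $n=6$, the root system $G_2$), and every supertrace is determined by its values on the rotations $S_j$ with $j\ne n/2$. -/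

import Mathlib

open scoped ContDiff

noncomputable section

namespace Calogero

/-! ### The space of functions on the plane -/

section TemperateGrowth

variable {E F : Type} [NormedAddCommGroup E] [NormedSpace ℝ E]
  [NormedAddCommGroup F] [NormedSpace ℝ F]

theorem temperate_fderiv {f : E → F} (hf : f.HasTemperateGrowth) :
    (fderiv ℝ f).HasTemperateGrowth := by
  refine ⟨hf.1.fderiv_right (by simp), fun n => ?_⟩
  obtain ⟨k, C, h⟩ := hf.2 (n + 1)
  exact ⟨k, C, fun x => by simpa [norm_iteratedFDeriv_fderiv] using h x⟩

theorem temperate_prodMk {G : Type} [NormedAddCommGroup G] [NormedSpace ℝ G]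
    {f : E → F} {g : E → G} (hf : f.HasTemperateGrowth) (hg : g.HasTemperateGrowth) :
    (fun x => (f x, g x)).HasTemperateGrowth := by
  have h1 := (ContinuousLinearMap.inl ℝ F G).hasTemperateGrowth.comp hf
  have h2 := (ContinuousLinearMap.inr ℝ F G).hasTemperateGrowth.comp hg
  convert! h1.add h2 using 1
  ext x <;> simp

theorem temperate_bound {h : ℝ × E → F} (hh : h.HasTemperateGrowth) :
    ∃ (k : ℕ) (C : ℝ), 0 ≤ C ∧ ∀ t ∈ Set.Icc (0 : ℝ) 1, ∀ x, ‖h (t, x)‖ ≤ C * (1 + ‖x‖) ^ k := by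
  obtain ⟨k, C, hC, hb⟩ := hh.norm_iteratedFDeriv_le_uniform 0
  refine ⟨k, C * 2 ^ k, by positivity, fun t ht x => ?_⟩
  have h1 := hb 0 le_rfl (t, x)
  rw [norm_iteratedFDeriv_zero] at h1
  have h2 : ‖(t, x)‖ ≤ 1 + ‖x‖ := by
    rw [Prod.norm_def]
    refine max_le ?_ (by simp)
    have : ‖t‖ ≤ 1 := by rw [Real.norm_eq_abs, abs_le]; constructor <;> linarith [ht.1, ht.2]
    linarith [norm_nonneg x]
  calc _ ≤ C * (1 + ‖(t, x)‖) ^ k := h1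
    _ ≤ C * (2 * (1 + ‖x‖)) ^ k := by
      gcongr
      linarith [norm_nonneg x]
    _ = _ := by rw [mul_pow]; ring

theorem hasFDerivAt_average {h : ℝ × ℂ → F} (hh : h.HasTemperateGrowth) (x : ℂ) :
    HasFDerivAt (fun x => ∫ t in (0 : ℝ)..1, h (t, x))
      (∫ t in (0 : ℝ)..1, (fderiv ℝ h (t, x)).comp (ContinuousLinearMap.inr ℝ ℝ ℂ)) x := by
  obtain ⟨k, C, hC, hb⟩ := temperate_bound (temperate_fderiv hh)
  have hcd : Differentiable ℝ h := hh.1.differentiable (by simp)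
  have hcont : Continuous h := hh.1.continuous
  have hcont' : Continuous (fderiv ℝ h) := (temperate_fderiv hh).1.continuous
  refine intervalIntegral.hasFDerivAt_integral_of_dominated_of_fderiv_le
    (s := Metric.ball x 1)
    (F := fun x t => h (t, x))
    (F' := fun x t => (fderiv ℝ h (t, x)).comp (ContinuousLinearMap.inr ℝ ℝ ℂ))
    (bound := fun _ => C * (1 + (‖x‖ + 1)) ^ k * ‖ContinuousLinearMap.inr ℝ ℝ ℂ‖)
    (Metric.ball_mem_nhds x one_pos) ?_ ?_ ?_ ?_ ?_ ?_
  · exact Filter.Eventually.of_forall fun y =>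
      (by fun_prop : Continuous fun t : ℝ => h (t, y)).aestronglyMeasurable
  · exact (by fun_prop : Continuous fun t : ℝ => h (t, x)).intervalIntegrable _ _
  · have hsc : SecondCountableTopologyEither ℝ (ℂ →L[ℝ] F) :=
      secondCountableTopologyEither_of_left ℝ _
    refine Continuous.aestronglyMeasurable ?_
    have : Continuous fun t : ℝ => fderiv ℝ h (t, x) := hcont'.comp (by fun_prop)
    exact this.clm_comp continuous_const
  · refine MeasureTheory.ae_of_all _ fun t ht y hy => ?_
    rw [Set.uIoc_of_le zero_le_one] at ht
    refine (ContinuousLinearMap.opNorm_comp_le _ _).trans ?_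
    have hy' : ‖y‖ ≤ ‖x‖ + 1 := by
      have := norm_le_norm_add_norm_sub' y x
      rw [Metric.mem_ball, dist_eq_norm] at hy
      linarith
    have := hb t ⟨ht.1.le, ht.2⟩ y
    gcongr
    refine this.trans ?_
    gcongr
  · exact intervalIntegrable_const
  · refine MeasureTheory.ae_of_all _ fun t ht y hy => ?_
    exact (hcd (t, y)).hasFDerivAt.comp y (hasFDerivAt_prodMk_right t y)

theorem temperate_average_aux (n : ℕ) : ∀ {F : Type} [NormedAddCommGroup F] [NormedSpace ℝ F]
    {h : ℝ × ℂ → F}, h.HasTemperateGrowth →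
    ContDiff ℝ n (fun x => ∫ t in (0 : ℝ)..1, h (t, x)) ∧
    ∃ (k : ℕ) (C : ℝ), ∀ x,
      ‖iteratedFDeriv ℝ n (fun x => ∫ t in (0 : ℝ)..1, h (t, x)) x‖ ≤ C * (1 + ‖x‖) ^ k := by
  induction n with
  | zero =>
    intro F _ _ h hh
    refine ⟨?_, ?_⟩
    · have : Differentiable ℝ (fun x => ∫ t in (0 : ℝ)..1, h (t, x)) :=
        fun x => (hasFDerivAt_average hh x).differentiableAt
      exact contDiff_zero.2 this.continuous
    · obtain ⟨k, C, hC, hb⟩ := temperate_bound hh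
      refine ⟨k, C, fun x => ?_⟩
      rw [norm_iteratedFDeriv_zero]
      have := intervalIntegral.norm_integral_le_of_norm_le_const (a := (0 : ℝ)) (b := 1)
        (f := fun t => h (t, x)) (C := C * (1 + ‖x‖) ^ k) (fun t ht => by
          rw [Set.uIoc_of_le zero_le_one] at ht
          exact hb t ⟨ht.1.le, ht.2⟩ x)
      simpa using this
  | succ n ih =>
    intro F _ _ h hh
    have hd : fderiv ℝ (fun x => ∫ t in (0 : ℝ)..1, h (t, x)) = fun x => ∫ t in (0 : ℝ)..1,
        (fderiv ℝ h (t, x)).comp (ContinuousLinearMap.inr ℝ ℝ ℂ) :=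
      funext fun x => (hasFDerivAt_average hh x).fderiv
    have hh' : (fun p => (fderiv ℝ h p).comp
        (ContinuousLinearMap.inr ℝ ℝ ℂ)).HasTemperateGrowth :=
      ((ContinuousLinearMap.compL ℝ ℂ (ℝ × ℂ) F).flip
        (ContinuousLinearMap.inr ℝ ℝ ℂ)).hasTemperateGrowth.comp (temperate_fderiv hh)
    obtain ⟨h1, k, C, h2⟩ := ih hh'
    refine ⟨?_, k, C, fun x => ?_⟩
    · push_cast
      refine contDiff_succ_iff_fderiv.2
        ⟨fun x => (hasFDerivAt_average hh x).differentiableAt, by simp, ?_⟩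
      rw [hd]
      exact h1
    · rw [← norm_iteratedFDeriv_fderiv, hd]
      exact h2 x

theorem temperate_average {h : ℝ × ℂ → F} (hh : h.HasTemperateGrowth) :
    (fun x => ∫ t in (0 : ℝ)..1, h (t, x)).HasTemperateGrowth :=
  ⟨contDiff_infty.2 fun n => (temperate_average_aux n hh).1,
    fun n => (temperate_average_aux n hh).2⟩

end TemperateGrowth

/-- The complex functions on the plane `ℂ = ℝ²` which are smooth (in the real sense) and of polynomial
growth together with all their derivatives, as a subspace of all functions. -/
def temperateFunctions : Submodule ℂ (ℂ → ℂ) where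
  carrier := {f | f.HasTemperateGrowth}
  add_mem' := fun hf hg => Function.HasTemperateGrowth.add hf hg
  zero_mem' := Function.HasTemperateGrowth.zero
  smul_mem' := fun c f hf => by
    change (fun z => c * f z).HasTemperateGrowth
    exact (Function.HasTemperateGrowth.const c).fun_mul hf

/-- The space of smooth functions of polynomial growth, on which the operators act. -/
def FunSpace : Type := temperateFunctions

instance : AddCommGroup FunSpace := inferInstanceAs (AddCommGroup temperateFunctions)

instance : Module ℂ FunSpace := inferInstanceAs (Module ℂ temperateFunctions)

instance : CoeFun FunSpace (fun _ => ℂ → ℂ) := ⟨fun f => f.1⟩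

@[ext]
theorem FunSpace.ext {f g : FunSpace} (h : ∀ z, f z = g z) : f = g := Subtype.ext (funext h)

theorem FunSpace.temperate (f : FunSpace) : Function.HasTemperateGrowth f := f.2

theorem FunSpace.coe_add (f g : FunSpace) : ⇑(f + g) = ⇑f + ⇑g := rfl

theorem FunSpace.coe_smul (c : ℂ) (f : FunSpace) : ⇑(c • f) = c • ⇑f := rfl

theorem FunSpace.differentiable (f : FunSpace) : Differentiable ℝ f :=
  f.temperate.1.differentiable (by simp)

/-! ### The root system `I₂(n)` and the operators -/

/-- The roots `v_k = exp (π i k / n)` of `I₂(n)`; `k` runs over `0, …, 2n - 1`. -/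
def root (n k : ℕ) : ℂ := Complex.exp (Real.pi * Complex.I * k / n)

/-- `z v_k^* + z^* v_k`, twice the Euclidean inner product of `z` and `v_k`. -/
def pairing (n k : ℕ) (z : ℂ) : ℂ :=
  z * starRingEnd ℂ (root n k) + starRingEnd ℂ z * root n k

/-- The orthogonal reflection of the plane in the line orthogonal to `v_k`. -/
def reflect (n k : ℕ) (z : ℂ) : ℂ := -(starRingEnd ℂ z * root n k ^ 2)

theorem root_mul_conj (n k : ℕ) : root n k * starRingEnd ℂ (root n k) = 1 := by
  rw [root, ← Complex.exp_conj, ← Complex.exp_add]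
  simp only [map_div₀, map_mul, Complex.conj_ofReal, Complex.conj_I, Complex.conj_natCast]
  rw [← Complex.exp_zero]
  congr 1
  ring

theorem reflect_eq (n k : ℕ) (z : ℂ) : reflect n k z = z - pairing n k z * root n k := by
  have h := root_mul_conj n k
  rw [reflect, pairing]
  linear_combination z * h

theorem temperate_conj : (fun z : ℂ => starRingEnd ℂ z).HasTemperateGrowth :=
  Complex.conjCLE.toContinuousLinearMap.hasTemperateGrowth

theorem temperate_pairing (n k : ℕ) : (pairing n k).HasTemperateGrowth :=
  (Function.HasTemperateGrowth.id'.fun_mul (.const _)).fun_add (temperate_conj.fun_mul (.const _))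

theorem temperate_reflect (n k : ℕ) : (reflect n k).HasTemperateGrowth :=
  (temperate_conj.fun_mul (.const _)).fun_neg

/-- Multiplication by the coordinate `z`. -/
def mulZ : Module.End ℂ FunSpace where
  toFun f := ⟨fun z => z * f z, Function.HasTemperateGrowth.id'.fun_mul f.temperate⟩
  map_add' f g := by ext z; exact mul_add _ _ _
  map_smul' c f := by ext z; exact mul_left_comm _ _ _

/-- Multiplication by the conjugate coordinate `z^*`. -/
def mulZbar : Module.End ℂ FunSpace where
  toFun f := ⟨fun z => starRingEnd ℂ z * f z, temperate_conj.fun_mul f.temperate⟩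
  map_add' f g := by ext z; exact mul_add _ _ _
  map_smul' c f := by ext z; exact mul_left_comm _ _ _

/-- The directional derivative along a fixed vector `w` of the plane. -/
def dirDeriv (w : ℂ) : Module.End ℂ FunSpace where
  toFun f := ⟨fun z => fderiv ℝ f z w,
    (ContinuousLinearMap.apply ℝ ℂ w).hasTemperateGrowth.comp (temperate_fderiv f.temperate)⟩
  map_add' f g := by
    ext z
    change fderiv ℝ (⇑f + ⇑g) z w = fderiv ℝ f z w + fderiv ℝ g z w
    rw [fderiv_add (f.differentiable z) (g.differentiable z)]
    rfl
  map_smul' c f := by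
    ext z
    change fderiv ℝ (c • ⇑f) z w = c * fderiv ℝ f z w
    rw [fderiv_const_smul (f.differentiable z) c]
    rfl

/-- The operator `2 ∂/∂z = ∂/∂x - i ∂/∂y`. -/
def twoDz : Module.End ℂ FunSpace := dirDeriv 1 - Complex.I • dirDeriv Complex.I

/-- The operator `2 ∂/∂z^* = ∂/∂x + i ∂/∂y`. -/
def twoDzbar : Module.End ℂ FunSpace := dirDeriv 1 + Complex.I • dirDeriv Complex.I

/-- The action of the reflection `R_k` on functions: `(R_k f)(z) = f (R_k z)`. -/
def reflOp (n k : ℕ) : Module.End ℂ FunSpace where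
  toFun f := ⟨fun z => f (reflect n k z), f.temperate.comp (temperate_reflect n k)⟩
  map_add' _ _ := rfl
  map_smul' _ _ := rfl

/-- The values of the function `(f - R_k f) / (z v_k^* + z^* v_k)`, extended by continuity to the line
`z v_k^* + z^* v_k = 0`, where it equals the derivative of `f` along `v_k`. -/
def divDiffFun (n k : ℕ) (f : ℂ → ℂ) (z : ℂ) : ℂ :=
  if pairing n k z = 0 then fderiv ℝ f z (root n k)
  else (f z - f (reflect n k z)) / pairing n k z

theorem pairing_eq_re (n k : ℕ) (z : ℂ) :
    pairing n k z = ((2 * (z * starRingEnd ℂ (root n k)).re : ℝ) : ℂ) := by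
  rw [← Complex.add_conj]
  simp [pairing]

theorem divDiffFun_eq_average (n k : ℕ) {f : ℂ → ℂ} (hf : f.HasTemperateGrowth) (z : ℂ) :
    divDiffFun n k f z = ∫ t in (0 : ℝ)..1,
      fderiv ℝ f (z - (t : ℂ) * (pairing n k z * root n k)) (root n k) := by
  rw [divDiffFun]
  split_ifs with h
  · simp [h]
  · have hd : Differentiable ℝ f := hf.1.differentiable (by simp)
    have hcont' : Continuous (fderiv ℝ f) := (temperate_fderiv hf).1.continuous
    set s : ℝ := 2 * (z * starRingEnd ℂ (root n k)).re with hs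
    have hps : pairing n k z = (s : ℂ) := pairing_eq_re n k z
    set v := root n k
    have key : ∀ t : ℝ, HasDerivAt (fun t : ℝ => f (z - (t : ℂ) * (pairing n k z * v)))
        (-(pairing n k z) * fderiv ℝ f (z - (t : ℂ) * (pairing n k z * v)) v) t := by
      intro t
      have h1 : HasDerivAt (fun t : ℝ => z - (t : ℂ) * (pairing n k z * v))
          (-(pairing n k z * v)) t := by
        have := ((hasDerivAt_id t).ofReal_comp.mul_const (pairing n k z * v)).const_sub z
        simpa using this
      have h2 := (hd _).hasFDerivAt.comp_hasDerivAt t h1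
      convert! h2 using 1
      have : -(pairing n k z * v) = (-s) • v := by rw [hps]; simp
      rw [this, map_smul, hps]
      simp
    have hI := intervalIntegral.integral_eq_sub_of_hasDerivAt (a := (0 : ℝ)) (b := 1)
      (fun t _ => key t) (Continuous.intervalIntegrable (by
        refine continuous_const.mul ?_
        exact (hcont'.comp (by fun_prop)).clm_apply continuous_const) _ _)
    rw [intervalIntegral.integral_const_mul] at hI
    have hr : reflect n k z = z - pairing n k z * v := reflect_eq n k z
    simp only [Complex.ofReal_one, one_mul, Complex.ofReal_zero, zero_mul, sub_zero] at hI
    rw [hr, div_eq_iff h]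
    linear_combination hI

theorem temperate_divDiffFun (n k : ℕ) {f : ℂ → ℂ} (hf : f.HasTemperateGrowth) :
    (divDiffFun n k f).HasTemperateGrowth := by
  have h : divDiffFun n k f = fun z => ∫ t in (0 : ℝ)..1,
      (fun p : ℝ × ℂ => fderiv ℝ f (p.2 - (p.1 : ℂ) * (pairing n k p.2 * root n k)) (root n k))
        (t, z) := funext fun z => divDiffFun_eq_average n k hf z
  rw [h]
  have hsnd : (fun p : ℝ × ℂ => p.2).HasTemperateGrowth :=
    (ContinuousLinearMap.snd ℝ ℝ ℂ).hasTemperateGrowth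
  have hfst : (fun p : ℝ × ℂ => (p.1 : ℂ)).HasTemperateGrowth :=
    Complex.ofRealCLM.hasTemperateGrowth.comp (ContinuousLinearMap.fst ℝ ℝ ℂ).hasTemperateGrowth
  have harg : (fun p : ℝ × ℂ =>
      p.2 - (p.1 : ℂ) * (pairing n k p.2 * root n k)).HasTemperateGrowth :=
    hsnd.fun_sub (hfst.fun_mul (((temperate_pairing n k).comp hsnd).fun_mul (.const _)))
  exact temperate_average ((ContinuousLinearMap.apply ℝ ℂ (root n k)).hasTemperateGrowth.comp
    ((temperate_fderiv hf).comp harg))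

/-- The operator `(z v_k^* + z^* v_k)⁻¹ (1 - R_k)`. -/
def divDiff (n k : ℕ) : Module.End ℂ FunSpace where
  toFun f := ⟨divDiffFun n k f, temperate_divDiffFun n k f.temperate⟩
  map_add' f g := by
    ext z
    change divDiffFun n k (⇑f + ⇑g) z = divDiffFun n k f z + divDiffFun n k g z
    simp only [divDiffFun, Pi.add_apply,
      fderiv_add (f.differentiable z) (g.differentiable z), _root_.add_apply]
    split_ifs <;> ring
  map_smul' c f := by
    ext z
    change divDiffFun n k (c • ⇑f) z = c * divDiffFun n k f z
    simp only [divDiffFun, Pi.smul_apply,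
      fderiv_const_smul (f.differentiable z) c, smul_eq_mul, _root_.smul_apply]
    split_ifs <;> ring

/-- The Dunkl operator `D_z` of the root system `I₂(n)` with coupling constants `ν₀` (roots `v_{2k}`)
and `ν₁` (roots `v_{2k+1}`). -/
def dunklZ (n : ℕ) (ν₀ ν₁ : ℂ) : Module.End ℂ FunSpace :=
  twoDzbar + ν₀ • ∑ k ∈ Finset.range n, root n (2 * k) • divDiff n (2 * k)
    + ν₁ • ∑ k ∈ Finset.range n, root n (2 * k + 1) • divDiff n (2 * k + 1)

/-- The Dunkl operator `D_{z^*}`. -/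
def dunklZbar (n : ℕ) (ν₀ ν₁ : ℂ) : Module.End ℂ FunSpace :=
  twoDz + ν₀ • ∑ k ∈ Finset.range n, starRingEnd ℂ (root n (2 * k)) • divDiff n (2 * k)
    + ν₁ • ∑ k ∈ Finset.range n, starRingEnd ℂ (root n (2 * k + 1)) • divDiff n (2 * k + 1)

/-- The deformed annihilation (`α = 0`) and creation (`α = 1`) operators
`a^α = (z + (-1)^α D_z) / 2`. -/
def opA (n : ℕ) (ν₀ ν₁ : ℂ) (α : Fin 2) : Module.End ℂ FunSpace :=
  (1 / 2 : ℂ) • (mulZ + (-1 : ℂ) ^ (α : ℕ) • dunklZ n ν₀ ν₁)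

/-- The operators `b^α = (z^* + (-1)^α D_{z^*}) / 2`. -/
def opB (n : ℕ) (ν₀ ν₁ : ℂ) (α : Fin 2) : Module.End ℂ FunSpace :=
  (1 / 2 : ℂ) • (mulZbar + (-1 : ℂ) ^ (α : ℕ) • dunklZbar n ν₀ ν₁)

/-! ### The superalgebra of observables and its supertraces -/

/-- Names of the generators of the algebra of observables; the reflections `R_0, …, R_{n-1}` generate
the dihedral group. -/
inductive Gen (n : ℕ) : Type
  | a (α : Fin 2)
  | b (α : Fin 2)
  | R (k : Fin n)

/-- The operator denoted by a generator. -/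
def Gen.op {n : ℕ} (ν₀ ν₁ : ℂ) : Gen n → Module.End ℂ FunSpace
  | .a α => opA n ν₀ ν₁ α
  | .b α => opB n ν₀ ν₁ α
  | .R k => reflOp n k

/-- The parity: `π (a^α) = π (b^α) = 1` and `π (R_k) = 0`. -/
def Gen.parity {n : ℕ} : Gen n → ZMod 2
  | .a _ => 1
  | .b _ => 1
  | .R _ => 0

/-- The algebra of observables of the rational Calogero model based on `I₂(n)`. -/
def Observables (n : ℕ) (ν₀ ν₁ : ℂ) : Subalgebra ℂ (Module.End ℂ FunSpace) :=
  Algebra.adjoin ℂ (Set.range (Gen.op (n := n) ν₀ ν₁))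

/-- The elements of parity `i`: the linear combinations of products of generators whose parities
add up to `i`. -/
def parityPart (n : ℕ) (ν₀ ν₁ : ℂ) (i : ZMod 2) : Submodule ℂ (Observables n ν₀ ν₁) :=
  Submodule.span ℂ {T | ∃ w : List (Gen n),
    (w.map Gen.parity).sum = i ∧ (T : Module.End ℂ FunSpace) = (w.map (Gen.op ν₀ ν₁)).prod}

/-- The operator `f(z) ↦ f(-z)`; commuting with it detects the parity of an observable. -/
def negArg : Module.End ℂ FunSpace where
  toFun f := ⟨fun z => f (-z), f.temperate.comp Function.HasTemperateGrowth.id'.fun_neg⟩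
  map_add' _ _ := rfl
  map_smul' _ _ := rfl

theorem neg_mul_neg' : negArg * negArg = 1 := by
  ext f z
  change f (- -z) = f z
  simp

theorem fderiv_neg_arg (f : FunSpace) (z w : ℂ) :
    fderiv ℝ (negArg f) z w = - fderiv ℝ f (-z) w := by
  have h := (f.differentiable (-z)).hasFDerivAt.comp z (hasFDerivAt_id z).neg
  have h2 : fderiv ℝ (negArg f) z = _ := h.fderiv
  rw [h2]; simp

theorem dirDeriv_neg (w : ℂ) : dirDeriv w * negArg = (-1 : ℂ) • (negArg * dirDeriv w) := by
  ext f z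
  change _ = (-1 : ℂ) * fderiv ℝ f (-z) w
  rw [neg_one_mul]
  exact fderiv_neg_arg f z w

theorem divDiff_neg (n k : ℕ) : divDiff n k * negArg = (-1 : ℂ) • (negArg * divDiff n k) := by
  ext f z
  change divDiffFun n k (negArg f) z = (-1 : ℂ) * divDiffFun n k f (-z)
  rw [neg_one_mul]
  have h1 : pairing n k (-z) = - pairing n k z := by simp [pairing]; ring
  have h2 : reflect n k (-z) = - reflect n k z := by simp [reflect]
  simp only [divDiffFun, h1, h2, neg_eq_zero, fderiv_neg_arg]
  split_ifs
  · rfl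
  · change (f (-z) - f (-reflect n k z)) / _ = _
    rw [div_neg, neg_neg]

theorem mulZ_neg : mulZ * negArg = (-1 : ℂ) • (negArg * mulZ) := by
  ext f z
  change z * f (-z) = (-1 : ℂ) * (-z * f (-z))
  ring

theorem mulZbar_neg : mulZbar * negArg = (-1 : ℂ) • (negArg * mulZbar) := by
  ext f z
  change starRingEnd ℂ z * f (-z) = (-1 : ℂ) * (starRingEnd ℂ (-z) * f (-z))
  simp

theorem reflOp_neg (n k : ℕ) : reflOp n k * negArg = negArg * reflOp n k := by
  ext f z
  change f (-reflect n k z) = f (reflect n k (-z))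
  simp [reflect]

theorem sum_smul_divDiff_neg (n : ℕ) (c : ℕ → ℂ) (e : ℕ → ℕ) :
    (∑ k ∈ Finset.range n, c k • divDiff n (e k)) * negArg =
      (-1 : ℂ) • (negArg * ∑ k ∈ Finset.range n, c k • divDiff n (e k)) := by
  simp only [Finset.sum_mul, Finset.mul_sum, smul_mul_assoc, divDiff_neg, mul_smul_comm,
    Finset.smul_sum, smul_comm (-1 : ℂ)]

theorem dunklZ_neg (n : ℕ) (ν₀ ν₁ : ℂ) : dunklZ n ν₀ ν₁ * negArg = (-1 : ℂ) • (negArg * dunklZ n ν₀ ν₁) := by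
  simp only [dunklZ, twoDzbar, add_mul, mul_add, smul_mul_assoc, mul_smul_comm, dirDeriv_neg,
    sum_smul_divDiff_neg]
  module

theorem dunklZbar_neg (n : ℕ) (ν₀ ν₁ : ℂ) :
    dunklZbar n ν₀ ν₁ * negArg = (-1 : ℂ) • (negArg * dunklZbar n ν₀ ν₁) := by
  have h : twoDz = dirDeriv 1 + (-Complex.I) • dirDeriv Complex.I := by
    rw [twoDz, sub_eq_add_neg, neg_smul]
  simp only [dunklZbar, h, add_mul, mul_add, smul_mul_assoc, mul_smul_comm,
    dirDeriv_neg, sum_smul_divDiff_neg]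
  module

theorem op_neg {n : ℕ} (ν₀ ν₁ : ℂ) (g : Gen n) :
    g.op ν₀ ν₁ * negArg = (-1 : ℂ) ^ g.parity.val • (negArg * g.op ν₀ ν₁) := by
  cases g with
  | a α =>
    simp only [Gen.op, Gen.parity, opA, add_mul, mul_add, smul_mul_assoc, mul_smul_comm, mulZ_neg,
      dunklZ_neg, ZMod.val_one, pow_one]
    module
  | b α =>
    simp only [Gen.op, Gen.parity, opB, add_mul, mul_add, smul_mul_assoc, mul_smul_comm,
      mulZbar_neg, dunklZbar_neg, ZMod.val_one, pow_one]
    module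
  | R k => simp [Gen.op, Gen.parity, reflOp_neg]

theorem pow_val_add (i j : ZMod 2) : (-1 : ℂ) ^ (i + j).val = (-1) ^ i.val * (-1) ^ j.val := by
  have h : ∀ i j : ZMod 2, (i + j).val % 2 = (i.val + j.val) % 2 := by decide
  rw [← pow_add, neg_one_pow_eq_pow_mod_two, h, ← neg_one_pow_eq_pow_mod_two]

theorem word_neg {n : ℕ} (ν₀ ν₁ : ℂ) (w : List (Gen n)) :
    (w.map (Gen.op ν₀ ν₁)).prod * negArg =
      (-1 : ℂ) ^ (w.map Gen.parity).sum.val • (negArg * (w.map (Gen.op ν₀ ν₁)).prod) := by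
  induction w with
  | nil => simp
  | cons g w ih =>
    simp only [List.map_cons, List.prod_cons, List.sum_cons, pow_val_add]
    rw [mul_assoc, ih, mul_smul_comm, ← mul_assoc, op_neg, smul_mul_assoc, smul_smul, mul_assoc,
      mul_comm]

theorem part_neg {n : ℕ} {ν₀ ν₁ : ℂ} {i : ZMod 2} {T} (hT : T ∈ parityPart n ν₀ ν₁ i) :
    (T : Module.End ℂ FunSpace) * negArg = (-1 : ℂ) ^ i.val • (negArg * (T : Module.End ℂ FunSpace)) := by
  induction hT using Submodule.span_induction with
  | mem T h => obtain ⟨w, rfl, h⟩ := h; rw [h, word_neg]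
  | zero => simp
  | add x y _ _ hx hy => rw [Subalgebra.coe_add, add_mul, mul_add, hx, hy, smul_add]
  | smul c x _ hx =>
    rw [Subalgebra.coe_smul, smul_mul_assoc, hx, mul_smul_comm, smul_comm c]

/-- The algebra of observables is the direct sum of its even and odd parts. -/
theorem isCompl_parityPart (n : ℕ) (ν₀ ν₁ : ℂ) :
    IsCompl (parityPart n ν₀ ν₁ 0) (parityPart n ν₀ ν₁ 1) := by
  constructor
  · rw [Submodule.disjoint_def]
    intro T h0 h1
    have e0 := part_neg h0
    have e1 := part_neg h1
    rw [e0] at e1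
    have e2 : negArg * (T : Module.End ℂ FunSpace) = 0 := by
      have : (2 : ℂ) • (negArg * (T : Module.End ℂ FunSpace)) = 0 := by
        rw [ZMod.val_zero, ZMod.val_one, pow_zero, pow_one] at e1
        have : (2 : ℂ) = 1 - (-1) := by norm_num
        rw [this, sub_smul, e1, sub_self]
      exact (smul_eq_zero.1 this).resolve_left two_ne_zero
    have := congrArg (negArg * ·) e2
    simp only [← mul_assoc, neg_mul_neg', one_mul, mul_zero] at this
    exact Subtype.ext this
  · rw [codisjoint_iff, eq_top_iff]
    rintro ⟨T, hT⟩ -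
    have h : T ∈ Submodule.span ℂ (Submonoid.closure (Set.range (Gen.op (n := n) ν₀ ν₁)) :
        Set (Module.End ℂ FunSpace)) := by
      rw [← Algebra.adjoin_eq_span]; exact hT
    have h2 : T ∈ (parityPart n ν₀ ν₁ 0 ⊔ parityPart n ν₀ ν₁ 1).map
        (Observables n ν₀ ν₁).val.toLinearMap := by
      refine Submodule.span_le.2 ?_ h
      intro x hx
      obtain ⟨l, hl, rfl⟩ := Submonoid.exists_list_of_mem_closure hx
      have : ∃ w : List (Gen n), w.map (Gen.op ν₀ ν₁) = l := by
        have : l ∈ Set.range (List.map (Gen.op (n := n) ν₀ ν₁)) := by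
          rw [Set.range_list_map]; exact hl
        exact this
      obtain ⟨w, rfl⟩ := this
      have hm : (w.map (Gen.op ν₀ ν₁)).prod ∈ Observables n ν₀ ν₁ := by
        refine Subalgebra.list_prod_mem _ fun x hx => Algebra.subset_adjoin (hl x hx)
      refine ⟨⟨_, hm⟩, ?_, rfl⟩
      have hi : (w.map Gen.parity).sum = 0 ∨ (w.map Gen.parity).sum = 1 := by
        generalize (w.map Gen.parity).sum = i
        revert i
        decide
      rcases hi with hi | hi
      · exact Submodule.mem_sup_left (Submodule.subset_span ⟨w, hi, rfl⟩)
      · exact Submodule.mem_sup_right (Submodule.subset_span ⟨w, hi, rfl⟩)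
    obtain ⟨y, hy, hyT⟩ := h2
    have : y = ⟨T, hT⟩ := Subtype.ext hyT
    rwa [← this]

/-- Parities add up under multiplication: the algebra of observables is a superalgebra. -/
theorem mul_mem_parityPart {n : ℕ} {ν₀ ν₁ : ℂ} {i j : ZMod 2} {S T : Observables n ν₀ ν₁}
    (hS : S ∈ parityPart n ν₀ ν₁ i) (hT : T ∈ parityPart n ν₀ ν₁ j) :
    S * T ∈ parityPart n ν₀ ν₁ (i + j) := by
  have h := Submodule.mul_mem_mul hS hT
  rw [parityPart, parityPart, Submodule.span_mul_span] at h
  refine Submodule.span_mono ?_ h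
  rintro _ ⟨x, ⟨w, hw, hx⟩, y, ⟨u, hu, hy⟩, rfl⟩
  exact ⟨w ++ u, by simp [hw, hu], by simp [hx, hy]⟩

/-- The space of supertraces: the linear functionals with `str (f g) = (-1)^{π(f) π(g)} str (g f)` for
all `f`, `g` with definite parity. -/
def supertraces (n : ℕ) (ν₀ ν₁ : ℂ) : Submodule ℂ (Module.Dual ℂ (Observables n ν₀ ν₁)) where
  carrier := {str | ∀ i j : ZMod 2, ∀ f ∈ parityPart n ν₀ ν₁ i, ∀ g ∈ parityPart n ν₀ ν₁ j,
    str (f * g) = (-1 : ℂ) ^ (i.val * j.val) * str (g * f)}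
  add_mem' := fun hs ht i j f hf g hg => by
    simp only [LinearMap.add_apply, hs i j f hf g hg, ht i j f hf g hg]
    ring
  zero_mem' := fun i j f _ g _ => by simp
  smul_mem' := fun c s hs i j f hf g hg => by
    simp only [LinearMap.smul_apply, smul_eq_mul, hs i j f hf g hg]
    ring

/-- The reflection `R_k`, as an element of the algebra of observables. -/
def reflection (n : ℕ) (ν₀ ν₁ : ℂ) (k : Fin n) : Observables n ν₀ ν₁ :=
  ⟨reflOp n k, Algebra.subset_adjoin ⟨Gen.R k, rfl⟩⟩

/-- The rotation `S_k = R_k R_0`, as an element of the algebra of observables. -/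
def rotation (n : ℕ) [NeZero n] (ν₀ ν₁ : ℂ) (k : Fin n) : Observables n ν₀ ν₁ :=
  reflection n ν₀ ν₁ k * reflection n ν₀ ν₁ 0

end Calogero

end

/-! ### The deformed oscillator algebra of a dihedral group. -/

noncomputable section

/-! The coordinates, the Dunkl operators and the dihedral group satisfy the relations of a
two-dimensional oscillator deformed by reflections. Passing from the rotations to their spectral
idempotents `ε m` replaces the coupling constants by their Fourier transform `γ`, which is supported
on the indices with `-m = m`. The quadratic elements `e = z zb / 2` and `f = D Db / 2` still
generate an `sl₂` by commutators: `(z, D)` and `(zb, Db)` are doublets, while the group and the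
angular momentum `J` are invariant. The algebra of observables is therefore the direct sum of the
invariants `inv` (powers of the angular momentum, corrected by group terms, times the group) and of
the nontrivial isotypic components `nontriv`; the Casimir operator separates the two.

A supertrace kills commutators with the even elements `e` and `f`, hence all of `nontriv`, so it is
determined by its restriction to `inv`. Conversely, a doublet times a vector of spin k/2 has an
invariant component only for k = 1. So a functional that vanishes on `nontriv` is a supertrace as
soon as it commutes with the group on `inv` and satisfies two further relations there, `raise` and
`lower`; this is the content of `IsSupertrace`.

Upper bound: a supertrace that vanishes on every rotation except the half turn satisfies L(ε m) +
L(ε (m - 1)) = 0. Induction on the degree in the angular momentum then shows that it vanishes.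
Values on reflections reduce to lower degree because `J` anticommutes with reflections. Values on
rotations alternate in m and, by `lower`, have an alternating antidifference on a finite cycle,
which forces them to be zero. The rotations by j and -j are conjugate, so at most ⌊(n + 1) / 2⌋
values are free.

Lower bound: the relations on `inv` are encoded by functionals `tm m`, `tp m` on polynomials in the
angular momentum, subject to a shift law, a reflection law and a jump of weight `κ m` at the points
± γ m / 2. They exist for every even `κ` orthogonal to the alternating sequences, because 1 + shift
is onto and its kernel consists of alternating constants (`exists_regularized_sum`). With χ the
standard additive character, the choices κ m = χ(m j) + χ(-m j), 2 j < n, give ⌊(n + 1) / 2⌋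
independent supertraces. Prescribing moments requires the spanning monomials of `inv` to be linearly
independent; this is checked on actual functions, by repeated commutators with the invariant z^n +
(-zb)^n evaluated at a generic point. -/

/-- Generators and relations of the deformed oscillator algebra of a dihedral group. The group is
encoded by one reflection `r` and the spectral idempotents `ε m` of the rotations. -/
structure DihedralOscillator (n : ℕ) [NeZero n] (A : Type*) [Ring A] [Algebra ℂ A] where
  z : A
  zb : A
  D : A
  Db : A
  r : A
  ε : ZMod n → A
  γ : ZMod n → ℂ
  γ_eq_zero : ∀ m, -m ≠ m → γ m = 0
  r_mul_r : r * r = 1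
  ε_mul_ε : ∀ i j, ε i * ε j = if i = j then ε i else 0
  sum_ε : ∑ m, ε m = 1
  r_mul_ε : ∀ m, r * ε m = ε (-m) * r
  ε_mul_z : ∀ m, ε m * z = z * ε (m - 1)
  ε_mul_zb : ∀ m, ε m * zb = zb * ε (m + 1)
  ε_mul_D : ∀ m, ε m * D = D * ε (m - 1)
  ε_mul_Db : ∀ m, ε m * Db = Db * ε (m + 1)
  r_mul_z : r * z = -(zb * r)
  r_mul_zb : r * zb = -(z * r)
  r_mul_D : r * D = -(Db * r)
  r_mul_Db : r * Db = -(D * r)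
  z_mul_zb : z * zb = zb * z
  D_mul_Db : D * Db = Db * D
  D_mul_z : D * z = z * D + ∑ m, γ (m - 1) • (ε m * r)
  D_mul_zb : D * zb = zb * D + 2 + ∑ m, γ m • (ε m * r)
  Db_mul_z : Db * z = z * Db + 2 + ∑ m, γ m • (ε m * r)
  Db_mul_zb : Db * zb = zb * Db + ∑ m, γ (m + 1) • (ε m * r)

namespace DihedralOscillator

variable {n : ℕ} [NeZero n] {A : Type*} [Ring A] [Algebra ℂ A] (S : DihedralOscillator n A)

theorem γ_neg (m : ZMod n) : S.γ (-m) = S.γ m := by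
  by_cases h : -m = m
  · rw [h]
  · rw [S.γ_eq_zero m h, S.γ_eq_zero (-m) (by rw [neg_neg]; exact fun h' => h h'.symm)]

/-- Transport along `-m = m`, valid wherever `γ m ≠ 0`. -/
theorem γ_smul_congr {M : Type*} [AddCommGroup M] [Module ℂ M] (m : ZMod n) (f : ZMod n → M) :
    S.γ m • f (-m) = S.γ m • f m := by
  by_cases h : -m = m
  · rw [h]
  · rw [S.γ_eq_zero m h, zero_smul, zero_smul]

/-- The weighted sums of reflections that occur in the commutation relations. -/
def ρ (a : ZMod n) : A := ∑ m, S.γ (m - a) • (S.ε m * S.r)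

theorem sum_shift {M : Type*} [AddCommMonoid M] (f : ZMod n → M) (a : ZMod n) :
    ∑ m, f (m + a) = ∑ m, f m :=
  Fintype.sum_equiv (Equiv.addRight a) _ _ fun _ => rfl

/-- The reflection exchanges two conjugate generators with a sign, and moving the idempotents past
`v` shifts their index. Keeping `u` and `v` abstract serves the coordinates and the derivatives at
once. -/
theorem ρ_mul_of_raise {u v : A} (hr : S.r * u = -(v * S.r))
    (hε : ∀ m, S.ε m * v = v * S.ε (m + 1)) (a : ZMod n) :
    S.ρ a * u = -(v * S.ρ (a + 1)) := by
  rw [ρ, ρ, Finset.sum_mul, Finset.mul_sum, ← Finset.sum_neg_distrib,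
    ← sum_shift (fun m => -(v * S.γ (m - (a + 1)) • (S.ε m * S.r))) 1]
  refine Finset.sum_congr rfl fun m _ => ?_
  rw [smul_mul_assoc, mul_assoc, hr, mul_neg, ← mul_assoc, hε, mul_smul_comm, mul_assoc,
    add_sub_add_right_eq_sub, smul_neg]

theorem ρ_mul_of_lower {u v : A} (hr : S.r * u = -(v * S.r))
    (hε : ∀ m, S.ε m * v = v * S.ε (m - 1)) (a : ZMod n) :
    S.ρ a * u = -(v * S.ρ (a - 1)) := by
  rw [ρ, ρ, Finset.sum_mul, Finset.mul_sum, ← Finset.sum_neg_distrib,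
    ← sum_shift (fun m => -(v * S.γ (m - (a - 1)) • (S.ε m * S.r))) (-1)]
  refine Finset.sum_congr rfl fun m _ => ?_
  have h : m + -1 - (a - 1) = m - a := by ring
  rw [smul_mul_assoc, mul_assoc, hr, mul_neg, ← mul_assoc, hε, mul_smul_comm, mul_assoc,
    smul_neg, h, sub_eq_add_neg m 1]

theorem ρ_mul_z (a : ZMod n) : S.ρ a * S.z = -(S.zb * S.ρ (a + 1)) :=
  S.ρ_mul_of_raise S.r_mul_z S.ε_mul_zb a

theorem ρ_mul_zb (a : ZMod n) : S.ρ a * S.zb = -(S.z * S.ρ (a - 1)) :=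
  S.ρ_mul_of_lower S.r_mul_zb S.ε_mul_z a

theorem ρ_mul_D (a : ZMod n) : S.ρ a * S.D = -(S.Db * S.ρ (a + 1)) :=
  S.ρ_mul_of_raise S.r_mul_D S.ε_mul_Db a

theorem ρ_mul_Db (a : ZMod n) : S.ρ a * S.Db = -(S.D * S.ρ (a - 1)) :=
  S.ρ_mul_of_lower S.r_mul_Db S.ε_mul_D a

theorem D_z : S.D * S.z = S.z * S.D + S.ρ 1 := S.D_mul_z

theorem D_zb : S.D * S.zb = S.zb * S.D + 2 + S.ρ 0 := by
  simpa [ρ] using S.D_mul_zb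

theorem Db_z : S.Db * S.z = S.z * S.Db + 2 + S.ρ 0 := by
  simpa [ρ] using S.Db_mul_z

theorem Db_zb : S.Db * S.zb = S.zb * S.Db + S.ρ (-1) := by
  simpa [ρ] using S.Db_mul_zb

theorem ε_ρ (m a : ZMod n) : S.ε m * S.ρ a = S.γ (m - a) • (S.ε m * S.r) := by
  rw [ρ, Finset.mul_sum, Finset.sum_eq_single m]
  · rw [mul_smul_comm, ← mul_assoc, S.ε_mul_ε, if_pos rfl]
  · intro b _ hb
    rw [mul_smul_comm, ← mul_assoc, S.ε_mul_ε, if_neg hb.symm, zero_mul, smul_zero]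
  · simp

theorem ρ_ε (m a : ZMod n) : S.ρ a * S.ε m = S.γ (m + a) • (S.ε (-m) * S.r) := by
  have h : ∀ i, S.r * S.ε i = S.ε (-i) * S.r := S.r_mul_ε
  rw [ρ, Finset.sum_mul, Finset.sum_eq_single (-m)]
  · rw [smul_mul_assoc, mul_assoc, h, ← mul_assoc, S.ε_mul_ε, if_pos rfl, ← S.γ_neg]
    congr 2
    ring
  · intro b _ hb
    rw [smul_mul_assoc, mul_assoc, h, ← mul_assoc, S.ε_mul_ε, if_neg hb, zero_mul, smul_zero]
  · simp

theorem ρ_zero_ε (m : ZMod n) : S.ρ 0 * S.ε m = S.γ m • (S.ε m * S.r) := by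
  rw [ρ_ε, add_zero, S.γ_smul_congr m fun i => S.ε i * S.r]

theorem ε_comm_ρ_zero (m : ZMod n) : S.ε m * S.ρ 0 = S.ρ 0 * S.ε m := by
  rw [ρ_zero_ε, ε_ρ, sub_zero]

theorem r_comm_ρ_zero : S.r * S.ρ 0 = S.ρ 0 * S.r := by
  rw [ρ, Finset.mul_sum, Finset.sum_mul]
  refine Finset.sum_congr rfl fun m _ => ?_
  rw [mul_smul_comm, smul_mul_assoc, ← mul_assoc, S.r_mul_ε, sub_zero,
    S.γ_smul_congr m fun i => S.ε i * S.r * S.r]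

/-- The angular momentum. -/
def J : A := (1 / 2 : ℂ) • (S.z * S.Db - S.zb * S.D)

/-- The commutators of `J` with the doublets contain group elements. Shifting `J` by half of `ρ 0`
in either direction absorbs them, at the price that `Jm` on one side of a generator becomes `Jp` on
the other. -/
def Jp : A := S.J + (1 / 2 : ℂ) • S.ρ 0

def Jm : A := S.J - (1 / 2 : ℂ) • S.ρ 0

/-- Clears the factor 1/2 in `J`, so that the commutation rules become ring identities with integer
coefficients. -/
theorem eq_of_double {a b : A} (h : a + a = b + b) : a = b := by
  have h2 : (2 : ℂ) • a = (2 : ℂ) • b := by rw [two_smul, two_smul, h]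
  exact smul_right_injective A two_ne_zero h2

theorem J_double : S.J + S.J = S.z * S.Db - S.zb * S.D := by
  rw [J, ← add_smul]; norm_num

theorem Jp_double : S.Jp + S.Jp = S.J + S.J + S.ρ 0 := by
  rw [Jp]; module

theorem Jm_double : S.Jm + S.Jm = S.J + S.J - S.ρ 0 := by
  rw [Jm]; module

theorem Jp_eq : S.Jp = S.Jm + S.ρ 0 := by
  rw [Jp, Jm]; module

theorem Jp_double' : S.Jp + S.Jp = S.z * S.Db - S.zb * S.D + S.ρ 0 := by
  rw [Jp_double, J_double]

theorem Jm_double' : S.Jm + S.Jm = S.z * S.Db - S.zb * S.D - S.ρ 0 := by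
  rw [Jm_double, J_double]

theorem r_J : S.r * S.J = -(S.J * S.r) := by
  apply eq_of_double
  linear_combination (norm := noncomm_ring) S.r * S.J_double + S.J_double * S.r +
    S.r_mul_z * S.Db - S.zb * S.r_mul_Db - S.r_mul_zb * S.D + S.z * S.r_mul_D

theorem ε_J (m : ZMod n) : S.ε m * S.J = S.J * S.ε m := by
  apply eq_of_double
  have h1 := S.ε_mul_Db (m - 1)
  have h2 := S.ε_mul_D (m + 1)
  rw [sub_add_cancel] at h1
  rw [add_sub_cancel_right] at h2
  linear_combination (norm := noncomm_ring) S.ε m * S.J_double - S.J_double * S.ε m +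
    S.ε_mul_z m * S.Db + S.z * h1 - S.ε_mul_zb m * S.D - S.zb * h2

theorem ρ_J (a : ZMod n) : S.ρ a * S.J = -(S.J * S.ρ a) := by
  rw [ρ, Finset.sum_mul, Finset.mul_sum, ← Finset.sum_neg_distrib]
  refine Finset.sum_congr rfl fun m _ => ?_
  rw [smul_mul_assoc, mul_assoc, r_J, mul_neg, ← mul_assoc, ε_J, mul_smul_comm, mul_assoc, smul_neg]

theorem Jm_z : S.Jm * S.z = S.z * (S.Jp + 1) := by
  apply eq_of_double
  have h1 := S.ρ_mul_z 0
  rw [zero_add] at h1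
  linear_combination (norm := noncomm_ring) S.Jm_double' * S.z - S.z * S.Jp_double'
    + S.z * S.Db_z - S.zb * S.D_z - h1 + S.z_mul_zb * S.D

theorem Jp_zb : S.Jp * S.zb = S.zb * (S.Jm - 1) := by
  apply eq_of_double
  have h1 := S.ρ_mul_zb 0
  rw [zero_sub] at h1
  linear_combination (norm := noncomm_ring) S.Jp_double' * S.zb - S.zb * S.Jm_double'
    + S.z * S.Db_zb - S.zb * S.D_zb + h1 + S.z_mul_zb * S.Db

theorem Jm_D : S.Jm * S.D = S.D * (S.Jp + 1) := by
  apply eq_of_double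
  have h1 := S.ρ_mul_Db 1
  rw [sub_self] at h1
  linear_combination (norm := noncomm_ring) S.Jm_double' * S.D - S.D * S.Jp_double'
    - S.D_z * S.Db + S.D_zb * S.D - S.z * S.D_mul_Db - h1

theorem Jp_Db : S.Jp * S.Db = S.Db * (S.Jm - 1) := by
  apply eq_of_double
  have h1 := S.ρ_mul_D (-1)
  rw [neg_add_cancel] at h1
  linear_combination (norm := noncomm_ring) S.Jp_double' * S.Db - S.Db * S.Jm_double'
    - S.Db_z * S.Db + S.Db_zb * S.D - S.zb * S.D_mul_Db + h1

theorem r_Jp : S.r * S.Jp = -(S.Jm * S.r) := by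
  apply eq_of_double
  linear_combination (norm := noncomm_ring) S.r * S.Jp_double + S.Jm_double * S.r
    + S.r_J + S.r_J + S.r_comm_ρ_zero

theorem r_Jm : S.r * S.Jm = -(S.Jp * S.r) := by
  apply eq_of_double
  linear_combination (norm := noncomm_ring) S.r * S.Jm_double + S.Jp_double * S.r
    + S.r_J + S.r_J - S.r_comm_ρ_zero

theorem ε_Jp (m : ZMod n) : S.ε m * S.Jp = S.Jp * S.ε m := by
  rw [Jp, mul_add, add_mul, ε_J, mul_smul_comm, smul_mul_assoc, ε_comm_ρ_zero]

theorem ε_Jm (m : ZMod n) : S.ε m * S.Jm = S.Jm * S.ε m := by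
  rw [Jm, mul_sub, sub_mul, ε_J, mul_smul_comm, smul_mul_assoc, ε_comm_ρ_zero]

theorem ρ_zero_Jp : S.ρ 0 * S.Jp = -(S.Jm * S.ρ 0) := by
  apply eq_of_double
  linear_combination (norm := noncomm_ring) S.ρ 0 * S.Jp_double + S.Jm_double * S.ρ 0
    + S.ρ_J 0 + S.ρ_J 0

theorem ρ_zero_Jm : S.ρ 0 * S.Jm = -(S.Jp * S.ρ 0) := by
  apply eq_of_double
  linear_combination (norm := noncomm_ring) S.ρ 0 * S.Jm_double + S.Jp_double * S.ρ 0
    + S.ρ_J 0 + S.ρ_J 0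

/-- The difference `ρ 0` anticommutes its way through: (Jm + ρ 0) Jp = Jm Jp - Jm ρ 0 = Jm (Jp - ρ
0). Hence only odd powers distinguish `Jp` from `Jm`. -/
theorem Jp_sq : S.Jp * S.Jp = S.Jm * S.Jm := by
  linear_combination (norm := noncomm_ring) S.Jp_eq * S.Jp + S.Jm * S.Jp_eq + S.ρ_zero_Jp

/-! ### The inner `sl₂` -/

/-- The commutator `x ↦ a x - x a`. -/
def com (a : A) : A →ₗ[ℂ] A := LinearMap.mulLeft ℂ a - LinearMap.mulRight ℂ a

theorem com_apply (a x : A) : com a x = a * x - x * a := rfl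

theorem com_mul (a x y : A) : com a (x * y) = com a x * y + x * com a y := by
  simp only [com_apply]; noncomm_ring

/-- Together with `f` and their commutator this forms an inner `sl₂`. Its adjoint action `E` raises
and `F` lowers, with `z` and `zb` as highest weight vectors of weight one. -/
def e : A := (1 / 2 : ℂ) • (S.z * S.zb)

def f : A := (1 / 2 : ℂ) • (S.D * S.Db)

def E : A →ₗ[ℂ] A := com S.e

def F : A →ₗ[ℂ] A := com S.f

def N : A →ₗ[ℂ] A := com (S.f * S.e - S.e * S.f)

theorem N_eq : S.N = S.F ∘ₗ S.E - S.E ∘ₗ S.F := by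
  ext x
  simp only [N, F, E, LinearMap.sub_apply, LinearMap.comp_apply, com_apply]
  noncomm_ring

theorem E_mul (x y : A) : S.E (x * y) = S.E x * y + x * S.E y := com_mul _ _ _

theorem F_mul (x y : A) : S.F (x * y) = S.F x * y + x * S.F y := com_mul _ _ _

theorem N_mul (x y : A) : S.N (x * y) = S.N x * y + x * S.N y := com_mul _ _ _

theorem com_half (c x y : A) (h : c * x - x * c = y + y) : com ((1 / 2 : ℂ) • c) x = y := by
  rw [com_apply, smul_mul_assoc, mul_smul_comm, ← smul_sub, h]
  module

/-- The two group terms `D * ρ 0` and `ρ 1 * Db` of the commutator cancel, so `f` acts on `z` as in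
the undeformed oscillator. The same cancellation underlies `F_zb`, `E_D` and `E_Db`. -/
theorem F_z : S.F S.z = S.D := com_half _ _ _ <| by
  have h := S.ρ_mul_Db 1
  rw [sub_self] at h
  linear_combination (norm := noncomm_ring) S.D * S.Db_z + S.D_z * S.Db + h

theorem F_zb : S.F S.zb = S.Db := com_half _ _ _ <| by
  have h := S.ρ_mul_Db 0
  rw [zero_sub] at h
  linear_combination (norm := noncomm_ring) S.D * S.Db_zb + S.D_zb * S.Db + h

theorem F_D : S.F S.D = 0 := com_half _ _ _ <| by
  linear_combination (norm := noncomm_ring) -S.D * S.D_mul_Db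

theorem F_Db : S.F S.Db = 0 := com_half _ _ _ <| by
  linear_combination (norm := noncomm_ring) S.D_mul_Db * S.Db

theorem E_z : S.E S.z = 0 := com_half _ _ _ <| by
  linear_combination (norm := noncomm_ring) -S.z * S.z_mul_zb

theorem E_zb : S.E S.zb = 0 := com_half _ _ _ <| by
  linear_combination (norm := noncomm_ring) S.z_mul_zb * S.zb

theorem E_D : S.E S.D = -S.z := com_half _ _ _ <| by
  have h := S.ρ_mul_zb 1
  rw [sub_self] at h
  linear_combination (norm := noncomm_ring) -S.z * S.D_zb - S.D_z * S.zb - h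

theorem E_Db : S.E S.Db = -S.zb := com_half _ _ _ <| by
  have h := S.ρ_mul_zb 0
  rw [zero_sub] at h
  linear_combination (norm := noncomm_ring) -S.z * S.Db_zb - S.Db_z * S.zb - h

theorem com_comm {c x : A} (h : x * c = c * x) : com ((1 / 2 : ℂ) • c) x = 0 := by
  rw [com_apply, smul_mul_assoc, mul_smul_comm, h, sub_self]

theorem F_ε (m : ZMod n) : S.F (S.ε m) = 0 := com_comm <| by
  have h := S.ε_mul_Db (m - 1)
  rw [sub_add_cancel] at h
  rw [← mul_assoc, S.ε_mul_D, mul_assoc, h, mul_assoc]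

theorem E_ε (m : ZMod n) : S.E (S.ε m) = 0 := com_comm <| by
  have h := S.ε_mul_zb (m - 1)
  rw [sub_add_cancel] at h
  rw [← mul_assoc, S.ε_mul_z, mul_assoc, h, mul_assoc]

theorem F_r : S.F S.r = 0 := com_comm <| by
  linear_combination (norm := noncomm_ring) S.r_mul_D * S.Db - S.Db * S.r_mul_Db - S.D_mul_Db * S.r

theorem E_r : S.E S.r = 0 := com_comm <| by
  linear_combination (norm := noncomm_ring) S.r_mul_z * S.zb - S.zb * S.r_mul_zb - S.z_mul_zb * S.r

/-- `J` is the antisymmetric combination, that is, the singlet in the product of the doublets `(z,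
D)` and `(zb, Db)`. -/
theorem F_J : S.F S.J = 0 := by
  rw [J, map_smul, map_sub, F_mul, F_mul, F_z, F_zb, F_D, F_Db, S.D_mul_Db]
  simp

theorem E_J : S.E S.J = 0 := by
  rw [J, map_smul, map_sub, E_mul, E_mul, E_z, E_zb, E_D, E_Db, mul_neg, mul_neg, S.z_mul_zb]
  simp

theorem N_of_EF {x : A} (hE : S.E x = 0) (hF : S.F x = 0) : S.N x = 0 := by
  rw [N_eq, LinearMap.sub_apply, LinearMap.comp_apply, LinearMap.comp_apply, hE, hF, map_zero,
    map_zero, sub_zero]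

theorem N_z : S.N S.z = S.z := by
  rw [N_eq, LinearMap.sub_apply, LinearMap.comp_apply, LinearMap.comp_apply, E_z, F_z, E_D]
  simp

theorem N_zb : S.N S.zb = S.zb := by
  rw [N_eq, LinearMap.sub_apply, LinearMap.comp_apply, LinearMap.comp_apply, E_zb, F_zb, E_Db]
  simp

theorem N_D : S.N S.D = -S.D := by
  rw [N_eq, LinearMap.sub_apply, LinearMap.comp_apply, LinearMap.comp_apply, E_D, F_D]
  simp [F_z]

theorem N_Db : S.N S.Db = -S.Db := by
  rw [N_eq, LinearMap.sub_apply, LinearMap.comp_apply, LinearMap.comp_apply, E_Db, F_Db]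
  simp [F_zb]

theorem com_com (a b x : A) : com a (com b x) - com b (com a x) = com (com a b) x := by
  simp only [com_apply]; noncomm_ring

/-- As a product of two vectors of weight -1, `f` has weight -2; the Jacobi identity `com_com`
transfers this to the operators. -/
theorem N_F (x : A) : S.N (S.F x) = S.F (S.N x) - (2 : ℂ) • S.F x := by
  have h : S.N S.f = -((2 : ℂ) • S.f) := by
    rw [f, map_smul, N_mul, N_D, N_Db]
    simp only [neg_mul, mul_neg]
    module
  have h2 := com_com (S.f * S.e - S.e * S.f) S.f x
  change S.N (S.F x) - S.F (S.N x) = com (S.N S.f) x at h2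
  rw [h] at h2
  have h3 : com (-((2 : ℂ) • S.f)) x = -((2 : ℂ) • S.F x) := by
    simp only [F, com_apply, neg_mul, mul_neg, smul_mul_assoc, mul_smul_comm]
    module
  rw [h3] at h2
  rw [sub_eq_iff_eq_add.1 h2]
  abel

theorem E_F (x : A) : S.E (S.F x) = S.F (S.E x) - S.N x := by
  rw [N_eq, LinearMap.sub_apply, LinearMap.comp_apply, LinearMap.comp_apply]
  abel

/-- The Casimir operator of the adjoint action of `sl₂`. -/
def casimir : A →ₗ[ℂ] A := S.N ∘ₗ S.N + (2 : ℂ) • S.N - (4 : ℂ) • (S.F ∘ₗ S.E)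

theorem casimir_apply (x : A) :
    S.casimir x = S.N (S.N x) + (2 : ℂ) • S.N x - (4 : ℂ) • S.F (S.E x) := rfl

theorem casimir_F (x : A) : S.casimir (S.F x) = S.F (S.casimir x) := by
  simp only [casimir_apply, N_F, E_F, map_sub, map_add, map_smul, N_F]
  module

/-! ### Invariants and highest weight vectors -/

/-- The span of the ordered monomials in the angular momentum and the dihedral group. -/
def inv : Submodule ℂ A :=
  Submodule.span ℂ (Set.range (fun p : ℕ × ZMod n => S.Jm ^ p.1 * S.ε p.2) ∪
    Set.range (fun p : ℕ × ZMod n => S.Jp ^ p.1 * (S.ε p.2 * S.r)))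

theorem Jm_pow_mem (l : ℕ) (m : ZMod n) : S.Jm ^ l * S.ε m ∈ S.inv :=
  Submodule.subset_span (Or.inl ⟨(l, m), rfl⟩)

theorem Jp_pow_mem (l : ℕ) (m : ZMod n) : S.Jp ^ l * (S.ε m * S.r) ∈ S.inv :=
  Submodule.subset_span (Or.inr ⟨(l, m), rfl⟩)

theorem inv_le {P : Submodule ℂ A} (h1 : ∀ l m, S.Jm ^ l * S.ε m ∈ P)
    (h2 : ∀ l m, S.Jp ^ l * (S.ε m * S.r) ∈ P) : S.inv ≤ P := by
  refine Submodule.span_le.2 ?_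
  rintro _ (⟨p, rfl⟩ | ⟨p, rfl⟩)
  · exact h1 _ _
  · exact h2 _ _

theorem anti_pow {a x y : A} (h : a * x = -(y * a)) (l : ℕ) :
    a * x ^ l = (-1 : ℂ) ^ l • (y ^ l * a) := by
  induction l with
  | zero => simp
  | succ l ih =>
    rw [pow_succ, ← mul_assoc, ih, smul_mul_assoc, mul_assoc, h, mul_neg, ← mul_assoc, ← pow_succ,
      pow_succ (-1 : ℂ), mul_neg_one, neg_smul, smul_neg]

theorem r_Jm_pow (l : ℕ) : S.r * S.Jm ^ l = (-1 : ℂ) ^ l • (S.Jp ^ l * S.r) := anti_pow S.r_Jm l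

theorem r_Jp_pow (l : ℕ) : S.r * S.Jp ^ l = (-1 : ℂ) ^ l • (S.Jm ^ l * S.r) := anti_pow S.r_Jp l

theorem ρ_zero_Jm_pow (l : ℕ) : S.ρ 0 * S.Jm ^ l = (-1 : ℂ) ^ l • (S.Jp ^ l * S.ρ 0) :=
  anti_pow S.ρ_zero_Jm l

theorem ρ_zero_Jp_pow (l : ℕ) : S.ρ 0 * S.Jp ^ l = (-1 : ℂ) ^ l • (S.Jm ^ l * S.ρ 0) :=
  anti_pow S.ρ_zero_Jp l

theorem ε_Jm_pow (m : ZMod n) (l : ℕ) : S.ε m * S.Jm ^ l = S.Jm ^ l * S.ε m :=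
  Commute.pow_right (S.ε_Jm m) l

theorem ε_Jp_pow (m : ZMod n) (l : ℕ) : S.ε m * S.Jp ^ l = S.Jp ^ l * S.ε m :=
  Commute.pow_right (S.ε_Jp m) l

theorem ρ_zero_mul_ε_mul_r (m : ZMod n) : S.ρ 0 * (S.ε m * S.r) = S.γ m • S.ε m := by
  rw [← mul_assoc, ρ_zero_ε, smul_mul_assoc, mul_assoc, S.r_mul_r, mul_one]

theorem ρ_zero_mul_Jm_mem (l : ℕ) (m : ZMod n) : S.ρ 0 * (S.Jm ^ l * S.ε m) ∈ S.inv := by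
  rw [← mul_assoc, ρ_zero_Jm_pow, smul_mul_assoc, mul_assoc, ρ_zero_ε, mul_smul_comm]
  exact Submodule.smul_mem _ _ (Submodule.smul_mem _ _ (S.Jp_pow_mem l m))

theorem ρ_zero_mul_Jp_mem (l : ℕ) (m : ZMod n) : S.ρ 0 * (S.Jp ^ l * (S.ε m * S.r)) ∈ S.inv := by
  rw [← mul_assoc, ρ_zero_Jp_pow, smul_mul_assoc, mul_assoc, ρ_zero_mul_ε_mul_r, mul_smul_comm]
  exact Submodule.smul_mem _ _ (Submodule.smul_mem _ _ (S.Jm_pow_mem l m))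

/-- A subspace is stable under left multiplication by `u` as soon as the spanning set of the
invariants is. -/
theorem inv_mul_left {u : A} (h1 : ∀ l m, u * (S.Jm ^ l * S.ε m) ∈ S.inv)
    (h2 : ∀ l m, u * (S.Jp ^ l * (S.ε m * S.r)) ∈ S.inv) {X : A} (hX : X ∈ S.inv) :
    u * X ∈ S.inv :=
  S.inv_le (P := S.inv.comap (LinearMap.mulLeft ℂ u)) h1 h2 hX

theorem inv_mul_right {u : A} (h1 : ∀ l m, S.Jm ^ l * S.ε m * u ∈ S.inv)
    (h2 : ∀ l m, S.Jp ^ l * (S.ε m * S.r) * u ∈ S.inv) {X : A} (hX : X ∈ S.inv) :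
    X * u ∈ S.inv :=
  S.inv_le (P := S.inv.comap (LinearMap.mulRight ℂ u)) h1 h2 hX

theorem ρ_zero_mul_mem {X : A} (hX : X ∈ S.inv) : S.ρ 0 * X ∈ S.inv :=
  S.inv_mul_left S.ρ_zero_mul_Jm_mem S.ρ_zero_mul_Jp_mem hX

theorem Jm_mul_mem {X : A} (hX : X ∈ S.inv) : S.Jm * X ∈ S.inv := by
  refine S.inv_mul_left (fun l m => ?_) (fun l m => ?_) hX
  · rw [← mul_assoc, ← pow_succ']; exact S.Jm_pow_mem _ _
  -- Reflections are spanned with powers of `Jp`, so `Jm` is replaced by `Jp - ρ 0`; the factor `ρ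
  -- 0` turns the reflection into a rotation and `Jp` into `Jm`.
  · have h : S.Jm = S.Jp - S.ρ 0 := by rw [Jp_eq]; abel
    rw [h, sub_mul]
    refine Submodule.sub_mem _ ?_ (S.ρ_zero_mul_Jp_mem l m)
    rw [← mul_assoc, ← pow_succ']; exact S.Jp_pow_mem _ _

theorem Jp_mul_mem {X : A} (hX : X ∈ S.inv) : S.Jp * X ∈ S.inv := by
  rw [Jp_eq, add_mul]
  exact Submodule.add_mem _ (S.Jm_mul_mem hX) (S.ρ_zero_mul_mem hX)

theorem J_mul_mem {X : A} (hX : X ∈ S.inv) : S.J * X ∈ S.inv := by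
  have h : S.J = S.Jm + (1 / 2 : ℂ) • S.ρ 0 := by rw [Jm]; abel
  rw [h, add_mul, smul_mul_assoc]
  exact Submodule.add_mem _ (S.Jm_mul_mem hX) (Submodule.smul_mem _ _ (S.ρ_zero_mul_mem hX))

theorem pow_mul_mem {u : A} (h : ∀ X ∈ S.inv, u * X ∈ S.inv) (l : ℕ) {X : A} (hX : X ∈ S.inv) :
    u ^ l * X ∈ S.inv := by
  induction l with
  | zero => simpa using hX
  | succ l ih => rw [pow_succ', mul_assoc]; exact h _ ih

theorem ε_mem (m : ZMod n) : S.ε m ∈ S.inv := by simpa using S.Jm_pow_mem 0 m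

theorem ε_mul_r_mem (m : ZMod n) : S.ε m * S.r ∈ S.inv := by simpa using S.Jp_pow_mem 0 m

theorem one_mem_inv : (1 : A) ∈ S.inv := by
  rw [← S.sum_ε]; exact Submodule.sum_mem _ fun m _ => S.ε_mem m

theorem ε_mul_mem (i : ZMod n) {X : A} (hX : X ∈ S.inv) : S.ε i * X ∈ S.inv := by
  refine S.inv_mul_left (fun l m => ?_) (fun l m => ?_) hX
  · rw [← mul_assoc, ε_Jm_pow, mul_assoc, S.ε_mul_ε]
    split_ifs
    · exact S.Jm_pow_mem _ _
    · simp
  · rw [← mul_assoc, ε_Jp_pow, mul_assoc, ← mul_assoc (S.ε i), S.ε_mul_ε]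
    split_ifs
    · exact S.Jp_pow_mem _ _
    · simp

theorem r_mul_mem {X : A} (hX : X ∈ S.inv) : S.r * X ∈ S.inv := by
  refine S.inv_mul_left (fun l m => ?_) (fun l m => ?_) hX
  · rw [← mul_assoc, r_Jm_pow, smul_mul_assoc, mul_assoc, S.r_mul_ε]
    exact Submodule.smul_mem _ _ (S.Jp_pow_mem _ _)
  · rw [← mul_assoc, r_Jp_pow, smul_mul_assoc, mul_assoc, ← mul_assoc S.r, S.r_mul_ε, mul_assoc,
      S.r_mul_r, mul_one]
    exact Submodule.smul_mem _ _ (S.Jm_pow_mem _ _)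

theorem mul_ε_mem (i : ZMod n) {X : A} (hX : X ∈ S.inv) : X * S.ε i ∈ S.inv := by
  refine S.inv_mul_right (fun l m => ?_) (fun l m => ?_) hX
  · rw [mul_assoc, S.ε_mul_ε]
    split_ifs
    · exact S.Jm_pow_mem _ _
    · simp
  · rw [mul_assoc, mul_assoc, S.r_mul_ε, ← mul_assoc (S.ε m), S.ε_mul_ε]
    split_ifs
    · exact S.Jp_pow_mem _ _
    · simp

theorem mul_r_mem {X : A} (hX : X ∈ S.inv) : X * S.r ∈ S.inv := by
  refine S.inv_mul_right (fun l m => ?_) (fun l m => ?_) hX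
  · rw [mul_assoc]
    exact S.pow_mul_mem (fun X => S.Jm_mul_mem) l (S.ε_mul_r_mem m)
  · rw [mul_assoc, mul_assoc, S.r_mul_r, mul_one]
    exact S.pow_mul_mem (fun X => S.Jp_mul_mem) l (S.ε_mem m)

theorem F_ρ (a : ZMod n) : S.F (S.ρ a) = 0 := by
  simp [ρ, F_mul, F_ε, F_r]

theorem E_ρ (a : ZMod n) : S.E (S.ρ a) = 0 := by
  simp [ρ, E_mul, E_ε, E_r]

theorem com_pow {a x : A} (h : com a x = 0) (l : ℕ) : com a (x ^ l) = 0 := by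
  induction l with
  | zero => simp [com_apply]
  | succ l ih => rw [pow_succ, com_mul, ih, h]; simp

theorem F_inv {X : A} (hX : X ∈ S.inv) : S.F X = 0 := by
  have hp : S.F S.Jp = 0 := by simp [Jp, F_J, F_ρ]
  have hm : S.F S.Jm = 0 := by simp [Jm, F_J, F_ρ]
  refine S.inv_le (P := LinearMap.ker S.F) (fun l m => ?_) (fun l m => ?_) hX
  · rw [LinearMap.mem_ker, F_mul, F_ε, F, com_pow hm]; simp
  · rw [LinearMap.mem_ker, F_mul, F_mul, F_ε, F_r, F, com_pow hp]; simp

theorem E_inv {X : A} (hX : X ∈ S.inv) : S.E X = 0 := by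
  have hp : S.E S.Jp = 0 := by simp [Jp, E_J, E_ρ]
  have hm : S.E S.Jm = 0 := by simp [Jm, E_J, E_ρ]
  refine S.inv_le (P := LinearMap.ker S.E) (fun l m => ?_) (fun l m => ?_) hX
  · rw [LinearMap.mem_ker, E_mul, E_ε, E, com_pow hm]; simp
  · rw [LinearMap.mem_ker, E_mul, E_mul, E_ε, E_r, E, com_pow hp]; simp

theorem N_inv {X : A} (hX : X ∈ S.inv) : S.N X = 0 := S.N_of_EF (S.E_inv hX) (S.F_inv hX)

end DihedralOscillator

/-! ### Highest weight vectors and multiplication by the doublets. -/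

namespace DihedralOscillator

variable {n : ℕ} [NeZero n] {A : Type*} [Ring A] [Algebra ℂ A] (S : DihedralOscillator n A)

/-- The highest weight vectors of weight `k`. -/
def hw (k : ℕ) : Submodule ℂ A :=
  Submodule.span ℂ {y | ∃ a b X, a + b = k ∧ X ∈ S.inv ∧ y = S.z ^ a * (S.zb ^ b * X)}

/-- The highest weight vectors of weight `k - 1`; zero for `k = 0`. -/
def hwPred (k : ℕ) : Submodule ℂ A :=
  Submodule.span ℂ {y | ∃ a b X, a + b + 1 = k ∧ X ∈ S.inv ∧ y = S.z ^ a * (S.zb ^ b * X)}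

theorem hwPred_succ (k : ℕ) : S.hwPred (k + 1) = S.hw k := by
  simp only [hwPred, hw, add_left_inj]

theorem hwPred_zero : S.hwPred 0 = ⊥ := by
  simp [hwPred]

theorem mem_hw (a b : ℕ) {X : A} (hX : X ∈ S.inv) : S.z ^ a * (S.zb ^ b * X) ∈ S.hw (a + b) :=
  Submodule.subset_span ⟨a, b, X, rfl, hX, rfl⟩

theorem hw_le {k : ℕ} {P : Submodule ℂ A}
    (h : ∀ a b X, a + b = k → X ∈ S.inv → S.z ^ a * (S.zb ^ b * X) ∈ P) : S.hw k ≤ P := by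
  refine Submodule.span_le.2 ?_
  rintro _ ⟨a, b, X, hk, hX, rfl⟩
  exact h a b X hk hX

theorem hw_zero : S.hw 0 = S.inv := by
  refine le_antisymm (S.hw_le fun a b X hk hX => ?_) fun X hX => by simpa using S.mem_hw 0 0 hX
  obtain ⟨rfl, rfl⟩ : a = 0 ∧ b = 0 := by omega
  simpa using hX

theorem zb_z_pow (a : ℕ) : S.zb * S.z ^ a = S.z ^ a * S.zb :=
  Commute.pow_right (show Commute S.zb S.z from S.z_mul_zb.symm) a

theorem z_mul_hw {k : ℕ} {y : A} (hy : y ∈ S.hw k) : S.z * y ∈ S.hw (k + 1) := by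
  refine S.hw_le (P := (S.hw (k + 1)).comap (LinearMap.mulLeft ℂ S.z)) (fun a b X hk hX => ?_) hy
  rw [Submodule.mem_comap, LinearMap.mulLeft_apply, ← mul_assoc, ← pow_succ']
  convert! S.mem_hw (a + 1) b hX using 2
  omega

theorem zb_mul_hw {k : ℕ} {y : A} (hy : y ∈ S.hw k) : S.zb * y ∈ S.hw (k + 1) := by
  refine S.hw_le (P := (S.hw (k + 1)).comap (LinearMap.mulLeft ℂ S.zb)) (fun a b X hk hX => ?_) hy
  rw [Submodule.mem_comap, LinearMap.mulLeft_apply, ← mul_assoc, zb_z_pow, mul_assoc,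
    ← mul_assoc S.zb, ← pow_succ']
  convert! S.mem_hw a (b + 1) hX using 2
  omega

theorem z_mul_hwPred {k : ℕ} {y : A} (hy : y ∈ S.hwPred k) : S.z * y ∈ S.hwPred (k + 1) := by
  cases k with
  | zero => rw [hwPred_zero, Submodule.mem_bot] at hy; simp [hy]
  | succ k => rw [hwPred_succ] at *; exact S.z_mul_hw hy

theorem zb_mul_hwPred {k : ℕ} {y : A} (hy : y ∈ S.hwPred k) : S.zb * y ∈ S.hwPred (k + 1) := by
  cases k with
  | zero => rw [hwPred_zero, Submodule.mem_bot] at hy; simp [hy]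
  | succ k => rw [hwPred_succ] at *; exact S.zb_mul_hw hy

theorem ε_z_pow (m : ZMod n) (a : ℕ) : S.ε m * S.z ^ a = S.z ^ a * S.ε (m - a) := by
  induction a generalizing m with
  | zero => simp
  | succ a ih =>
    rw [pow_succ', ← mul_assoc, S.ε_mul_z, mul_assoc, ih, mul_assoc]
    congr 3
    push_cast
    ring

theorem ε_zb_pow (m : ZMod n) (a : ℕ) : S.ε m * S.zb ^ a = S.zb ^ a * S.ε (m + a) := by
  induction a generalizing m with
  | zero => simp
  | succ a ih =>
    rw [pow_succ', ← mul_assoc, S.ε_mul_zb, mul_assoc, ih, mul_assoc]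
    congr 3
    push_cast
    ring

theorem ε_mul_hw (m : ZMod n) {k : ℕ} {y : A} (hy : y ∈ S.hw k) : S.ε m * y ∈ S.hw k := by
  refine S.hw_le (P := (S.hw k).comap (LinearMap.mulLeft ℂ (S.ε m))) (fun a b X hk hX => ?_) hy
  rw [Submodule.mem_comap, LinearMap.mulLeft_apply, ← mul_assoc, ε_z_pow, mul_assoc,
    ← mul_assoc (S.ε _), ε_zb_pow, mul_assoc, ← hk]
  exact S.mem_hw a b (S.ε_mul_mem _ hX)

theorem r_mul_hw {k : ℕ} {y : A} (hy : y ∈ S.hw k) : S.r * y ∈ S.hw k := by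
  refine S.hw_le (P := (S.hw k).comap (LinearMap.mulLeft ℂ S.r)) (fun a b X hk hX => ?_) hy
  have h : S.zb ^ a * S.z ^ b = S.z ^ b * S.zb ^ a :=
    (Commute.pow_pow (show Commute S.zb S.z from S.z_mul_zb.symm) a b)
  rw [Submodule.mem_comap, LinearMap.mulLeft_apply, ← mul_assoc, anti_pow S.r_mul_z, smul_mul_assoc,
    mul_assoc, ← mul_assoc S.r, anti_pow S.r_mul_zb, smul_mul_assoc, mul_smul_comm, mul_assoc,
    ← mul_assoc (S.zb ^ a), h, mul_assoc, ← hk, add_comm]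
  exact Submodule.smul_mem _ _ (Submodule.smul_mem _ _ (S.mem_hw b a (S.r_mul_mem hX)))

theorem ρ_mul_hw (a : ZMod n) {k : ℕ} {y : A} (hy : y ∈ S.hw k) : S.ρ a * y ∈ S.hw k := by
  rw [ρ, Finset.sum_mul]
  refine Submodule.sum_mem _ fun m _ => ?_
  rw [smul_mul_assoc, mul_assoc]
  exact Submodule.smul_mem _ _ (S.ε_mul_hw _ (S.r_mul_hw hy))

/-- Moving a derivative through a monomial in the coordinates produces lower terms only. -/
theorem D_mul_monomial (a b : ℕ) {X : A} (hX : X ∈ S.inv) :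
    S.D * (S.z ^ a * (S.zb ^ b * X)) - S.z ^ a * (S.zb ^ b * (S.D * X)) ∈ S.hwPred (a + b) := by
  induction a with
  | zero =>
    induction b with
    | zero => simp
    | succ b ih =>
      simp only [pow_zero, one_mul] at ih ⊢
      have h : S.D * (S.zb ^ (b + 1) * X) - S.zb ^ (b + 1) * (S.D * X) =
          S.zb * (S.D * (S.zb ^ b * X) - S.zb ^ b * (S.D * X)) +
            ((2 : ℂ) • (S.zb ^ b * X) + S.ρ 0 * (S.zb ^ b * X)) := by
        rw [two_smul, pow_succ']
        linear_combination (norm := noncomm_ring) S.D_zb * (S.zb ^ b * X)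
      have hm : S.zb ^ b * X ∈ S.hw b := by simpa using S.mem_hw 0 b hX
      rw [h]
      refine Submodule.add_mem _ (S.zb_mul_hwPred ih) ?_
      rw [← add_assoc, hwPred_succ, zero_add]
      exact Submodule.add_mem _ (Submodule.smul_mem _ _ hm) (S.ρ_mul_hw 0 hm)
  | succ a ih =>
    have h : S.D * (S.z ^ (a + 1) * (S.zb ^ b * X)) - S.z ^ (a + 1) * (S.zb ^ b * (S.D * X)) =
        S.z * (S.D * (S.z ^ a * (S.zb ^ b * X)) - S.z ^ a * (S.zb ^ b * (S.D * X))) +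
          S.ρ 1 * (S.z ^ a * (S.zb ^ b * X)) := by
      rw [pow_succ']
      linear_combination (norm := noncomm_ring) S.D_z * (S.z ^ a * (S.zb ^ b * X))
    rw [h, Nat.add_right_comm]
    refine Submodule.add_mem _ (S.z_mul_hwPred ih) ?_
    rw [hwPred_succ]
    exact S.ρ_mul_hw 1 (S.mem_hw a b hX)

theorem Db_mul_monomial (a b : ℕ) {X : A} (hX : X ∈ S.inv) :
    S.Db * (S.z ^ a * (S.zb ^ b * X)) - S.z ^ a * (S.zb ^ b * (S.Db * X)) ∈ S.hwPred (a + b) := by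
  induction a with
  | zero =>
    induction b with
    | zero => simp
    | succ b ih =>
      simp only [pow_zero, one_mul] at ih ⊢
      have h : S.Db * (S.zb ^ (b + 1) * X) - S.zb ^ (b + 1) * (S.Db * X) =
          S.zb * (S.Db * (S.zb ^ b * X) - S.zb ^ b * (S.Db * X)) + S.ρ (-1) * (S.zb ^ b * X) := by
        rw [pow_succ']
        linear_combination (norm := noncomm_ring) S.Db_zb * (S.zb ^ b * X)
      have hm : S.zb ^ b * X ∈ S.hw b := by simpa using S.mem_hw 0 b hX
      rw [h]
      refine Submodule.add_mem _ (S.zb_mul_hwPred ih) ?_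
      rw [← add_assoc, hwPred_succ, zero_add]
      exact S.ρ_mul_hw _ hm
  | succ a ih =>
    have h : S.Db * (S.z ^ (a + 1) * (S.zb ^ b * X)) - S.z ^ (a + 1) * (S.zb ^ b * (S.Db * X)) =
        S.z * (S.Db * (S.z ^ a * (S.zb ^ b * X)) - S.z ^ a * (S.zb ^ b * (S.Db * X))) +
          ((2 : ℂ) • (S.z ^ a * (S.zb ^ b * X)) + S.ρ 0 * (S.z ^ a * (S.zb ^ b * X))) := by
      rw [two_smul, pow_succ']
      linear_combination (norm := noncomm_ring) S.Db_z * (S.z ^ a * (S.zb ^ b * X))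
    rw [h, Nat.add_right_comm]
    refine Submodule.add_mem _ (S.z_mul_hwPred ih) ?_
    rw [hwPred_succ]
    exact Submodule.add_mem _ (Submodule.smul_mem _ _ (S.mem_hw a b hX))
      (S.ρ_mul_hw 0 (S.mem_hw a b hX))

theorem zero_mem_of_zero {P : Submodule ℂ A} {x : A} (h : x = 0) : x ∈ P := h ▸ P.zero_mem

/-- By the Leibniz rule each of the b + 1 factors `zb` becomes `Db` in turn, and moving `Db` to the
right costs lower terms only. -/
theorem F_zb_pow (b : ℕ) {X : A} (hX : X ∈ S.inv) :
    S.F (S.zb ^ (b + 1) * X) - ((b : ℂ) + 1) • (S.zb ^ b * (S.Db * X)) ∈ S.hwPred b := by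
  induction b with
  | zero =>
    refine zero_mem_of_zero ?_
    simp [S.F_inv hX, F_mul, F_zb]
  | succ b ih =>
    have h1 := S.Db_mul_monomial 0 (b + 1) hX
    simp only [pow_zero, one_mul, zero_add] at h1
    have h : S.F (S.zb ^ (b + 1 + 1) * X) - (((b + 1 : ℕ) : ℂ) + 1) • (S.zb ^ (b + 1) * (S.Db * X)) =
        S.zb * (S.F (S.zb ^ (b + 1) * X) - ((b : ℂ) + 1) • (S.zb ^ b * (S.Db * X))) +
          (S.Db * (S.zb ^ (b + 1) * X) - S.zb ^ (b + 1) * (S.Db * X)) := by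
      rw [pow_succ' S.zb (b + 1), mul_assoc, F_mul, F_zb, mul_sub, mul_smul_comm, ← mul_assoc S.zb _ (S.Db * X),
        ← pow_succ']
      push_cast
      module
    rw [h]
    exact Submodule.add_mem _ (S.zb_mul_hwPred ih) h1

/-- The action of the lowering operator on a highest weight vector, modulo lower terms. -/
theorem z_mul_F_monomial (a b : ℕ) {X : A} (hX : X ∈ S.inv) :
    S.z * S.F (S.z ^ a * (S.zb ^ b * X)) - ((a : ℂ) + b) • (S.z ^ a * (S.zb ^ b * (S.D * X)))
      ∈ S.hwPred (a + b) := by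
  induction a with
  | zero =>
    cases b with
    | zero => refine zero_mem_of_zero ?_; simp [S.F_inv hX]
    | succ b =>
      have h1 := S.z_mul_hwPred (S.F_zb_pow b hX)
      have h2 : S.zb ^ b * (S.J * X) ∈ S.hwPred (b + 1) := by
        rw [hwPred_succ]; simpa using S.mem_hw 0 b (S.J_mul_mem hX)
      have h3 : S.z * S.zb ^ b = S.zb ^ b * S.z :=
        Commute.pow_right (show Commute S.z S.zb from S.z_mul_zb) b
      -- The identity z Db = 2 J + zb D trades `Db` for `D`; the term with `J` is an invariant times
      -- a shorter monomial, hence a lower term.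
      have h4 : S.z * (S.zb ^ b * (S.Db * X)) =
          (2 : ℂ) • (S.zb ^ b * (S.J * X)) + S.zb ^ (b + 1) * (S.D * X) := by
        rw [two_smul, pow_succ]
        linear_combination (norm := noncomm_ring) h3 * (S.Db * X) - S.zb ^ b * S.J_double * X
      have h := Submodule.add_mem _ h1 (Submodule.smul_mem _ (2 * ((b : ℂ) + 1)) h2)
      rw [mul_sub, mul_smul_comm, h4] at h
      convert! h using 1
      · rw [zero_add]
      · simp only [pow_zero, one_mul]
        push_cast
        module
  | succ a ih =>
    have h : S.z * S.F (S.z ^ (a + 1) * (S.zb ^ b * X))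
        - (((a + 1 : ℕ) : ℂ) + b) • (S.z ^ (a + 1) * (S.zb ^ b * (S.D * X))) =
        S.z * ((S.z * S.F (S.z ^ a * (S.zb ^ b * X))
          - ((a : ℂ) + b) • (S.z ^ a * (S.zb ^ b * (S.D * X)))) +
          (S.D * (S.z ^ a * (S.zb ^ b * X)) - S.z ^ a * (S.zb ^ b * (S.D * X)))) := by
      rw [pow_succ' S.z a, mul_assoc, F_mul, F_z, mul_add, mul_add, mul_sub, mul_sub, mul_smul_comm,
        mul_assoc S.z (S.z ^ a)]
      push_cast
      module
    rw [h, Nat.add_right_comm]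
    exact S.z_mul_hwPred (Submodule.add_mem _ ih (S.D_mul_monomial a b hX))

/-- The Clebsch–Gordan rule for a doublet times spin k/2. In F(z y) = D y + z F(y) the second term
is k D y up to lower terms by `z_mul_F_monomial`. So `D * y` splits into the descendant of a highest
weight vector of weight k + 1 and a vector of weight k - 1. -/
theorem D_mul_hw {k : ℕ} {y : A} (hy : y ∈ S.hw k) :
    ((k : ℂ) + 1) • (S.D * y) - S.F (S.z * y) ∈ S.hwPred k := by
  refine S.hw_le (P := (S.hwPred k).comap (((k : ℂ) + 1) • LinearMap.mulLeft ℂ S.D -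
    S.F ∘ₗ LinearMap.mulLeft ℂ S.z)) (fun a b X hk hX => ?_) hy
  subst hk
  have h := Submodule.sub_mem _ (Submodule.smul_mem _ ((a : ℂ) + b) (S.D_mul_monomial a b hX))
    (S.z_mul_F_monomial a b hX)
  rw [Submodule.mem_comap]
  convert! h using 1
  simp only [LinearMap.sub_apply, LinearMap.smul_apply, LinearMap.comp_apply, LinearMap.mulLeft_apply,
    F_mul, F_z]
  push_cast
  module

theorem F_r_mul (x : A) : S.F (S.r * x) = S.r * S.F x := by
  rw [F_mul, F_r, zero_mul, zero_add]

theorem r_mul_r_mul (x : A) : S.r * (S.r * x) = x := by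
  rw [← mul_assoc, S.r_mul_r, one_mul]

theorem r_mul_hwPred {k : ℕ} {y : A} (hy : y ∈ S.hwPred k) : S.r * y ∈ S.hwPred k := by
  cases k with
  | zero => rw [hwPred_zero, Submodule.mem_bot] at *; simp [hy]
  | succ k => rw [hwPred_succ] at *; exact S.r_mul_hw hy

/-- Conjugate of `D_mul_hw` under the reflection, which swaps the two doublets up to sign. -/
theorem Db_mul_hw {k : ℕ} {y : A} (hy : y ∈ S.hw k) :
    ((k : ℂ) + 1) • (S.Db * y) - S.F (S.zb * y) ∈ S.hwPred k := by
  have h := S.r_mul_hwPred (S.D_mul_hw (S.r_mul_hw hy))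
  have h1 : S.r * (S.D * (S.r * y)) = -(S.Db * y) := by
    rw [← mul_assoc, S.r_mul_D, neg_mul, mul_assoc, r_mul_r_mul]
  have h2 : S.r * S.F (S.z * (S.r * y)) = -S.F (S.zb * y) := by
    rw [← F_r_mul, ← mul_assoc, S.r_mul_z, neg_mul, mul_assoc, r_mul_r_mul, map_neg]
  rw [mul_sub, mul_smul_comm, h1, h2] at h
  convert! Submodule.neg_mem _ h using 1
  module

/-! ### Isotypic components -/

/-- The smallest subspace containing `P` and stable under the lowering operator. -/
def orbit (P : Submodule ℂ A) : Submodule ℂ A := ⨆ i : ℕ, P.map ((S.F : Module.End ℂ A) ^ i)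

theorem F_pow_mem_orbit {P : Submodule ℂ A} {y : A} (hy : y ∈ P) (i : ℕ) :
    ((S.F : Module.End ℂ A) ^ i) y ∈ S.orbit P :=
  Submodule.mem_iSup_of_mem i (Submodule.mem_map_of_mem hy)

theorem mem_orbit {P : Submodule ℂ A} {y : A} (hy : y ∈ P) : y ∈ S.orbit P := by
  simpa using S.F_pow_mem_orbit hy 0

theorem orbit_le {P Q : Submodule ℂ A} (h : ∀ i, ∀ y ∈ P, ((S.F : Module.End ℂ A) ^ i) y ∈ Q) :
    S.orbit P ≤ Q :=
  iSup_le fun i => Submodule.map_le_iff_le_comap.2 fun y hy => h i y hy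

theorem orbit_le_of_stable {P Q : Submodule ℂ A} (h : P ≤ Q) (hQ : ∀ x ∈ Q, S.F x ∈ Q) :
    S.orbit P ≤ Q := by
  refine S.orbit_le fun i y hy => ?_
  induction i with
  | zero => simpa using h hy
  | succ i ih => rw [pow_succ', Module.End.mul_apply]; exact hQ _ ih

theorem F_mem_orbit {P : Submodule ℂ A} {x : A} (hx : x ∈ S.orbit P) : S.F x ∈ S.orbit P := by
  refine S.orbit_le (Q := (S.orbit P).comap S.F) (fun i y hy => ?_) hx
  rw [Submodule.mem_comap, ← Module.End.mul_apply, ← pow_succ']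
  exact S.F_pow_mem_orbit hy _

/-- Left multiplication by the two members of a doublet. -/
theorem orbit_mul_left {P T : Submodule ℂ A} (hT : ∀ x ∈ T, S.F x ∈ T) {u v : A} (hu : S.F u = v)
    (hv : S.F v = 0) (h1 : ∀ y ∈ P, u * y ∈ T) (h2 : ∀ y ∈ P, v * y ∈ T) {x : A}
    (hx : x ∈ S.orbit P) : u * x ∈ T ∧ v * x ∈ T := by
  -- The vectors that both `u` and `v` send into `T` form an `F`-stable subspace, since u F(x) = F(u
  -- x) - v x and v F(x) = F(v x).
  let Q : Submodule ℂ A := T.comap (LinearMap.mulLeft ℂ u) ⊓ T.comap (LinearMap.mulLeft ℂ v)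
  refine S.orbit_le_of_stable (Q := Q) (fun y hy => ⟨h1 y hy, h2 y hy⟩) ?_ hx
  rintro x ⟨hx1, hx2⟩
  change u * x ∈ T at hx1
  change v * x ∈ T at hx2
  have e1 := S.F_mul u x
  have e2 := S.F_mul v x
  rw [hu] at e1
  rw [hv, zero_mul, zero_add] at e2
  refine ⟨?_, ?_⟩
  · change u * S.F x ∈ T
    rw [← sub_eq_iff_eq_add'.2 e1]
    exact T.sub_mem (hT _ hx1) hx2
  · change v * S.F x ∈ T
    rw [← e2]
    exact hT _ hx2

/-- Right multiplication by the two members of a doublet. -/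
theorem orbit_mul_right {P T : Submodule ℂ A} (hT : ∀ x ∈ T, S.F x ∈ T) {u v : A} (hu : S.F u = v)
    (hv : S.F v = 0) (h1 : ∀ y ∈ P, y * u ∈ T) (h2 : ∀ y ∈ P, y * v ∈ T) {x : A}
    (hx : x ∈ S.orbit P) : x * u ∈ T ∧ x * v ∈ T := by
  let Q : Submodule ℂ A := T.comap (LinearMap.mulRight ℂ u) ⊓ T.comap (LinearMap.mulRight ℂ v)
  refine S.orbit_le_of_stable (Q := Q) (fun y hy => ⟨h1 y hy, h2 y hy⟩) ?_ hx
  rintro x ⟨hx1, hx2⟩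
  change x * u ∈ T at hx1
  change x * v ∈ T at hx2
  have e1 := S.F_mul x u
  have e2 := S.F_mul x v
  rw [hu] at e1
  rw [hv, mul_zero, add_zero] at e2
  refine ⟨?_, ?_⟩
  · change S.F x * u ∈ T
    rw [← sub_eq_iff_eq_add.2 e1]
    exact T.sub_mem (hT _ hx1) hx2
  · change S.F x * v ∈ T
    rw [← e2]
    exact hT _ hx2

/-- The isotypic component of spin `k / 2`. -/
def spin (k : ℕ) : Submodule ℂ A := S.orbit (S.hw k)

/-- The sum of the isotypic components which a doublet times a vector of spin `k / 2` may reach. -/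
def spinNext (k : ℕ) : Submodule ℂ A := S.spin (k + 1) ⊔ S.orbit (S.hwPred k)

theorem spinNext_zero : S.spinNext 0 = S.spin 1 := by
  rw [spinNext, hwPred_zero, sup_eq_left]
  exact S.orbit_le fun i y hy => by
    rw [Submodule.mem_bot] at hy
    simp [hy]

theorem spinNext_succ (k : ℕ) : S.spinNext (k + 1) = S.spin (k + 2) ⊔ S.spin k := by
  rw [spinNext, hwPred_succ, spin, spin]

theorem F_mem_spinNext {k : ℕ} {x : A} (hx : x ∈ S.spinNext k) : S.F x ∈ S.spinNext k := by
  obtain ⟨y, hy, w, hw, rfl⟩ := Submodule.mem_sup.1 hx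
  rw [map_add]
  exact Submodule.add_mem_sup (S.F_mem_orbit hy) (S.F_mem_orbit hw)

theorem hw_succ_le_spinNext {k : ℕ} {y : A} (hy : y ∈ S.hw (k + 1)) : y ∈ S.spinNext k :=
  Submodule.mem_sup_left (S.mem_orbit hy)

theorem hwPred_le_spinNext {k : ℕ} {y : A} (hy : y ∈ S.hwPred k) : y ∈ S.spinNext k :=
  Submodule.mem_sup_right (S.mem_orbit hy)

theorem mem_of_smul_sub {T : Submodule ℂ A} {c : ℂ} (hc : c ≠ 0) {x y : A} (h : c • x - y ∈ T)
    (hy : y ∈ T) : x ∈ T := by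
  have := T.add_mem h hy
  rw [sub_add_cancel] at this
  exact (T.smul_mem_iff hc).1 this

theorem D_mul_hw_mem {k : ℕ} {y : A} (hy : y ∈ S.hw k) : S.D * y ∈ S.spinNext k :=
  mem_of_smul_sub (Nat.cast_add_one_ne_zero k) (S.hwPred_le_spinNext (S.D_mul_hw hy))
    (S.F_mem_spinNext (S.hw_succ_le_spinNext (S.z_mul_hw hy)))

theorem Db_mul_hw_mem {k : ℕ} {y : A} (hy : y ∈ S.hw k) : S.Db * y ∈ S.spinNext k :=
  mem_of_smul_sub (Nat.cast_add_one_ne_zero k) (S.hwPred_le_spinNext (S.Db_mul_hw hy))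
    (S.F_mem_spinNext (S.hw_succ_le_spinNext (S.zb_mul_hw hy)))

theorem mul_spin {k : ℕ} {x : A} (hx : x ∈ S.spin k) :
    S.z * x ∈ S.spinNext k ∧ S.D * x ∈ S.spinNext k :=
  S.orbit_mul_left (fun _ => S.F_mem_spinNext) S.F_z S.F_D
    (fun _ hy => S.hw_succ_le_spinNext (S.z_mul_hw hy)) (fun _ hy => S.D_mul_hw_mem hy) hx

theorem mul_spin' {k : ℕ} {x : A} (hx : x ∈ S.spin k) :
    S.zb * x ∈ S.spinNext k ∧ S.Db * x ∈ S.spinNext k :=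
  S.orbit_mul_left (fun _ => S.F_mem_spinNext) S.F_zb S.F_Db
    (fun _ hy => S.hw_succ_le_spinNext (S.zb_mul_hw hy)) (fun _ hy => S.Db_mul_hw_mem hy) hx

theorem mul_spin_of_comm {u : A} (hu : S.F u = 0) {k : ℕ} (h : ∀ y ∈ S.hw k, u * y ∈ S.hw k) {x : A}
    (hx : x ∈ S.spin k) : u * x ∈ S.spin k :=
  (S.orbit_mul_left (fun _ => S.F_mem_orbit) hu (map_zero _) (fun y hy => S.mem_orbit (h y hy))
    (fun y _ => by simp) hx).1

theorem spin_mul_of_comm {u : A} (hu : S.F u = 0) {k : ℕ} (h : ∀ y ∈ S.hw k, y * u ∈ S.hw k) {x : A}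
    (hx : x ∈ S.spin k) : x * u ∈ S.spin k :=
  (S.orbit_mul_right (fun _ => S.F_mem_orbit) hu (map_zero _) (fun y hy => S.mem_orbit (h y hy))
    (fun y _ => by simp) hx).1

theorem r_mul_spin {k : ℕ} {x : A} (hx : x ∈ S.spin k) : S.r * x ∈ S.spin k :=
  S.mul_spin_of_comm S.F_r (fun _ => S.r_mul_hw) hx

theorem ε_mul_spin (m : ZMod n) {k : ℕ} {x : A} (hx : x ∈ S.spin k) : S.ε m * x ∈ S.spin k :=
  S.mul_spin_of_comm (S.F_ε m) (fun _ => S.ε_mul_hw m) hx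

theorem hw_mul_of_inv {u : A} (h : ∀ X ∈ S.inv, X * u ∈ S.inv) {k : ℕ} {y : A} (hy : y ∈ S.hw k) :
    y * u ∈ S.hw k := by
  refine S.hw_le (P := (S.hw k).comap (LinearMap.mulRight ℂ u)) (fun a b X hk hX => ?_) hy
  rw [Submodule.mem_comap, LinearMap.mulRight_apply, mul_assoc, mul_assoc, ← hk]
  exact S.mem_hw a b (h X hX)

theorem spin_mul_r {k : ℕ} {x : A} (hx : x ∈ S.spin k) : x * S.r ∈ S.spin k :=
  S.spin_mul_of_comm S.F_r (fun _ => S.hw_mul_of_inv fun _ => S.mul_r_mem) hx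

theorem spin_mul_ε (m : ZMod n) {k : ℕ} {x : A} (hx : x ∈ S.spin k) : x * S.ε m ∈ S.spin k :=
  S.spin_mul_of_comm (S.F_ε m) (fun _ => S.hw_mul_of_inv fun _ => S.mul_ε_mem m) hx

theorem spin_zero : S.spin 0 = S.inv := by
  refine le_antisymm (S.orbit_le_of_stable S.hw_zero.le fun x hx => ?_)
    fun X hX => S.mem_orbit (S.hw_zero.ge hX)
  exact zero_mem_of_zero (S.F_inv hx)

/-! ### Weights and the Casimir operator on isotypic components -/

theorem N_hw {k : ℕ} {y : A} (hy : y ∈ S.hw k) : S.N y = (k : ℂ) • y := by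
  have hpow : ∀ {u : A}, S.N u = u → ∀ a : ℕ, S.N (u ^ a) = (a : ℂ) • u ^ a := by
    intro u hu a
    induction a with
    | zero => simp [N, com_apply]
    | succ a ih =>
      rw [pow_succ, N_mul, ih, hu, smul_mul_assoc]
      push_cast
      module
  have h : S.hw k ≤ LinearMap.ker (S.N - (k : ℂ) • LinearMap.id) := by
    refine S.hw_le fun a b X hk hX => ?_
    rw [LinearMap.mem_ker, LinearMap.sub_apply, N_mul, N_mul, hpow S.N_z, hpow S.N_zb, S.N_inv hX,
      ← hk]
    simp only [LinearMap.smul_apply, LinearMap.id_apply, mul_zero, add_zero, smul_mul_assoc,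
      mul_smul_comm]
    push_cast
    module
  have := h hy
  rwa [LinearMap.mem_ker, LinearMap.sub_apply, sub_eq_zero] at this

theorem E_hw {k : ℕ} {y : A} (hy : y ∈ S.hw k) : S.E y = 0 := by
  have h : S.hw k ≤ LinearMap.ker S.E := by
    refine S.hw_le fun a b X hk hX => ?_
    rw [LinearMap.mem_ker, E_mul, E_mul, S.E_inv hX, E, com_pow S.E_z, com_pow S.E_zb]
    simp
  exact h hy

theorem casimir_spin {k : ℕ} {x : A} (hx : x ∈ S.spin k) :
    S.casimir x = ((k : ℂ) * (k + 2)) • x := by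
  have h : S.spin k ≤ LinearMap.ker (S.casimir - ((k : ℂ) * (k + 2)) • LinearMap.id) := by
    refine S.orbit_le_of_stable (fun y hy => ?_) (fun x hx => ?_)
    · rw [LinearMap.mem_ker, LinearMap.sub_apply, casimir_apply, S.E_hw hy, S.N_hw hy, map_smul,
        S.N_hw hy]
      simp only [map_zero, LinearMap.smul_apply, LinearMap.id_apply]
      module
    · rw [LinearMap.mem_ker, LinearMap.sub_apply, LinearMap.smul_apply, LinearMap.id_apply,
        sub_eq_zero] at *
      rw [casimir_F, hx, map_smul]
  have := h hx
  rwa [LinearMap.mem_ker, LinearMap.sub_apply, sub_eq_zero] at this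

/-- The sum of all nontrivial isotypic components. -/
def nontriv : Submodule ℂ A := ⨆ k : ℕ, S.spin (k + 1)

theorem spin_succ_le (k : ℕ) : S.spin (k + 1) ≤ S.nontriv := le_iSup (fun k => S.spin (k + 1)) k

/-- The Casimir eigenvalue k (k + 2) is zero only for k = 0, and eigenspaces are independent. -/
theorem disjoint_inv_nontriv : Disjoint S.inv S.nontriv := by
  have h := Module.End.eigenspaces_iSupIndep (S.casimir : Module.End ℂ A) 0
  refine h.mono (fun X hX => ?_) (iSup_le fun k => ?_)
  · rw [Module.End.mem_eigenspace_iff]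
    rw [← spin_zero] at hX
    have := S.casimir_spin hX
    simpa using this
  · have hk : ((k + 1 : ℕ) : ℂ) * ((k + 1 : ℕ) + 2) ≠ 0 := by
      have : ((k + 1 : ℕ) : ℂ) * ((k + 1 : ℕ) + 2) = (((k + 1) * (k + 3) : ℕ) : ℂ) := by
        push_cast; ring
      rw [this]
      exact Nat.cast_ne_zero.2 (by positivity)
    refine le_trans (fun x hx => ?_) (le_iSup₂ (f := fun (j : ℂ) (_ : j ≠ 0) =>
      Module.End.eigenspace (S.casimir : Module.End ℂ A) j) _ hk)
    rw [Module.End.mem_eigenspace_iff]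
    exact S.casimir_spin hx

/-- The sum of the components of integer (`i = 0`) or half-integer (`i = 1`) spin. -/
def part (i : ZMod 2) : Submodule ℂ A := ⨆ k : {k : ℕ // (k : ZMod 2) = i}, S.spin k

theorem spin_le_part (k : ℕ) : S.spin k ≤ S.part k :=
  le_iSup (fun k' : {k' : ℕ // (k' : ZMod 2) = (k : ZMod 2)} => S.spin k') ⟨k, rfl⟩

theorem part_le {i : ZMod 2} {P : Submodule ℂ A} (h : ∀ k : ℕ, (k : ZMod 2) = i → S.spin k ≤ P) :
    S.part i ≤ P := iSup_le fun k => h k k.2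

/-- Tensoring with a doublet changes k by ± 1, so it switches between integer and half-integer spin.
-/
theorem spinNext_le_part (k : ℕ) : S.spinNext k ≤ S.part (k + 1) := by
  cases k with
  | zero =>
    rw [spinNext_zero]
    exact (S.spin_le_part 1).trans (by simp)
  | succ k =>
    rw [spinNext_succ]
    have h : (((k + 1 : ℕ) : ZMod 2) + 1) = k := by
      push_cast
      rw [add_assoc, CharTwo.add_self_eq_zero, add_zero]
    refine sup_le ?_ ?_
    · have := S.spin_le_part (k + 2)
      push_cast at this ⊢
      convert! this using 2
      ring
    · rw [h]
      exact S.spin_le_part k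

theorem mul_part {u : A} (h : ∀ k, ∀ x ∈ S.spin k, u * x ∈ S.spinNext k) {i : ZMod 2} {x : A}
    (hx : x ∈ S.part i) : u * x ∈ S.part (i + 1) := by
  refine S.part_le (P := (S.part (i + 1)).comap (LinearMap.mulLeft ℂ u)) (fun k hk x hx => ?_) hx
  rw [← hk]
  exact S.spinNext_le_part k (h k x hx)

theorem mul_part_of_spin {u : A} (h : ∀ k, ∀ x ∈ S.spin k, u * x ∈ S.spin k) {i : ZMod 2} {x : A}
    (hx : x ∈ S.part i) : u * x ∈ S.part i := by
  refine S.part_le (P := (S.part i).comap (LinearMap.mulLeft ℂ u)) (fun k hk x hx => ?_) hx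
  rw [← hk]
  exact S.spin_le_part k (h k x hx)

theorem one_mem_part : (1 : A) ∈ S.part 0 := by
  have h := S.spin_le_part 0
  rw [spin_zero, Nat.cast_zero] at h
  exact h S.one_mem_inv

theorem part_le_sup (i : ZMod 2) : S.part i ≤ S.inv ⊔ S.nontriv := by
  refine S.part_le fun k _ => ?_
  cases k with
  | zero => rw [spin_zero]; exact le_sup_left
  | succ k => exact (S.spin_succ_le k).trans le_sup_right

end DihedralOscillator

/-! ### Difference equations for cyclic families of polynomials. -/

open Polynomial in
-- Discrete integration. A difference with nonzero step lowers the degree by exactly one, so the top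
-- coefficient of `p` can be removed and the degree bound descends.
theorem exists_taylor_sub_eq {h : ℂ} (hh : h ≠ 0) (p : ℂ[X]) : ∃ q : ℂ[X], q - taylor h q = p := by
  suffices H : ∀ d : ℕ, ∀ p : ℂ[X], (∀ k, d ≤ k → p.coeff k = 0) → ∃ q : ℂ[X], q - taylor h q = p from
    H (p.natDegree + 1) p fun k hk => coeff_eq_zero_of_natDegree_lt hk
  intro d
  induction d with
  | zero =>
    intro p hp
    refine ⟨0, ?_⟩
    ext k
    simp [hp k (Nat.zero_le _)]
  | succ d ih =>
    intro p hp
    -- The difference of c X^(d+1) has top coefficient -c (d + 1) h, which is to equal the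
    -- coefficient of X^d in `p`.
    set c : ℂ := -(p.coeff d / ((d + 1) * h)) with hc
    have hd : (d : ℂ) + 1 ≠ 0 := Nat.cast_add_one_ne_zero d
    have htay : taylor h (C c * X ^ (d + 1)) = C c * (X + C h) ^ (d + 1) := by
      rw [taylor_mul, taylor_C, taylor_pow, taylor_X]
    obtain ⟨q, hq⟩ := ih (p - (C c * X ^ (d + 1) - taylor h (C c * X ^ (d + 1)))) (by
      intro k hk
      rw [htay, coeff_sub, coeff_sub, coeff_C_mul, coeff_C_mul, coeff_X_pow, coeff_X_add_C_pow]
      rcases hk.eq_or_lt with rfl | hk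
      · rw [if_neg (by omega), Nat.choose_succ_self_right, Nat.add_sub_cancel_left, pow_one, hc]
        push_cast
        field_simp
        ring
      · rcases (Nat.succ_le_of_lt hk).eq_or_lt with rfl | hk
        · simp [hp]
        · rw [if_neg (by omega), Nat.choose_eq_zero_of_lt (by omega), hp k (by omega)]
          simp)
    refine ⟨q + C c * X ^ (d + 1), ?_⟩
    rw [map_add]
    linear_combination hq

open Polynomial in
-- A periodic polynomial takes its value at 0 at infinitely many points.
theorem eq_C_of_taylor_eq {h : ℂ} (hh : h ≠ 0) {q : ℂ[X]} (hq : taylor h q = q) :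
    q = C (q.eval 0) := by
  refine eq_of_infinite_eval_eq _ _ ?_
  have hper : ∀ i : ℕ, q.eval (i * h) = q.eval 0 := by
    intro i
    induction i with
    | zero => simp
    | succ i ih =>
      have h1 := taylor_eval h q ((i : ℂ) * h)
      rw [hq, ih] at h1
      rw [h1]
      congr 1
      push_cast
      ring
  refine (Set.infinite_range_of_injective (f := fun i : ℕ => (i : ℂ) * h) ?_).mono ?_
  · intro i j hij
    exact Nat.cast_injective (mul_right_cancel₀ hh hij)
  · rintro _ ⟨i, rfl⟩
    simp [hper]

open Polynomial

section

set_option linter.unusedSectionVars false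

variable {n : ℕ} [NeZero n]

/-- The simultaneous shift of the index and of the argument. -/
def shift : Module.End ℂ (ZMod n → ℂ[X]) where
  toFun u m := taylor 1 (u (m + 1))
  map_add' u v := by ext1 m; simp
  map_smul' c u := by ext1 m; simp

theorem shift_apply (u : ZMod n → ℂ[X]) (m : ZMod n) : shift u m = taylor 1 (u (m + 1)) := rfl

theorem shift_pow_apply (k : ℕ) (u : ZMod n → ℂ[X]) (m : ZMod n) :
    (shift ^ k) u m = taylor (k : ℂ) (u (m + k)) := by
  induction k generalizing m with
  | zero => simp
  | succ k ih =>
    rw [pow_succ', Module.End.mul_apply, shift_apply, ih, taylor_taylor]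
    push_cast
    congr 2
    · ring
    · ring

theorem shift_pow_period (u : ZMod n → ℂ[X]) (m : ZMod n) :
    (shift ^ (2 * n)) u m = taylor ((2 * n : ℕ) : ℂ) (u m) := by
  rw [shift_pow_apply]; simp

theorem period_ne_zero (n : ℕ) [NeZero n] : ((2 * n : ℕ) : ℂ) ≠ 0 :=
  Nat.cast_ne_zero.2 (mul_ne_zero two_ne_zero (NeZero.ne n))

/-- The 2n-th power of the shift fixes the index and translates the argument by 2n, so 1 -
shift^(2n) is onto by discrete integration. Since 2n is even, 1 + shift divides it through a
geometric sum. -/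
theorem one_add_shift_surjective : Function.Surjective (1 + shift : Module.End ℂ (ZMod n → ℂ[X])) := by
  intro p
  choose w hw using fun m => exists_taylor_sub_eq (period_ne_zero n) (p m)
  refine ⟨(∑ i ∈ Finset.range (2 * n), (-shift) ^ i : Module.End ℂ (ZMod n → ℂ[X])) w, ?_⟩
  have h := mul_neg_geom_sum (-shift : Module.End ℂ (ZMod n → ℂ[X])) (2 * n)
  have h2 : (-shift : Module.End ℂ (ZMod n → ℂ[X])) ^ (2 * n) = shift ^ (2 * n) :=
    (even_two_mul n).neg_pow (shift : Module.End ℂ (ZMod n → ℂ[X]))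
  rw [sub_neg_eq_add, h2] at h
  rw [← Module.End.mul_apply, h]
  ext1 m
  rw [LinearMap.sub_apply, Pi.sub_apply, shift_pow_period]
  exact hw m

/-- The kernel of 1 + shift: after 2n steps the sign is gone, each polynomial is periodic and
therefore constant, and only the alternation in the index is left. -/
theorem shift_eq_neg {u : ZMod n → ℂ[X]} (hu : shift u = -u) :
    ∃ c : ZMod n → ℂ, (∀ m, c (m + 1) = -c m) ∧ ∀ m, u m = C (c m) := by
  have h1 : ∀ i : ℕ, (shift ^ i) u = (-1 : ℂ) ^ i • u := by
    intro i
    induction i with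
    | zero => simp
    | succ i ih =>
      rw [pow_succ, Module.End.mul_apply, hu, map_neg, ih, pow_succ, mul_neg_one, neg_smul]
  have h2 : ∀ m, u m = C ((u m).eval 0) := by
    intro m
    refine eq_C_of_taylor_eq (period_ne_zero n) ?_
    rw [← shift_pow_period, h1, (even_two_mul n).neg_one_pow, one_smul]
  refine ⟨fun m => (u m).eval 0, fun m => ?_, h2⟩
  have h3 := congrFun hu m
  rw [shift_apply, h2 (m + 1), taylor_C, Pi.neg_apply] at h3
  have := congrArg (Polynomial.eval 0) h3
  simpa using this

/-- The reflection of the index and of the argument. -/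
def flipNeg : Module.End ℂ (ZMod n → ℂ[X]) where
  toFun u m := (u (-m)).comp (-X)
  map_add' u v := by ext1 m; simp
  map_smul' c u := by ext1 m; simp

theorem flipNeg_apply (u : ZMod n → ℂ[X]) (m : ZMod n) : flipNeg u m = (u (-m)).comp (-X) := rfl

/-- The dihedral relation: the flip conjugates the shift to its inverse. -/
theorem shift_flipNeg_shift (u : ZMod n → ℂ[X]) : shift (flipNeg (shift u)) = flipNeg u := by
  ext1 m
  rw [shift_apply, flipNeg_apply, flipNeg_apply, shift_apply, taylor_apply, taylor_apply, comp_assoc,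
    comp_assoc]
  have h : -(m + 1) + 1 = -m := by ring
  rw [h]
  congr 1
  simp

/-- The sum of the values of the polynomials at the points `± g m`, with weights `κ m`. -/
def pointSum (κ g : ZMod n → ℂ) : (ZMod n → ℂ[X]) →ₗ[ℂ] ℂ where
  toFun u := ∑ m, κ m * ((u m).eval (g m) + (u m).eval (-g m))
  map_add' u v := by
    rw [← Finset.sum_add_distrib]
    refine Finset.sum_congr rfl fun m _ => ?_
    simp only [Pi.add_apply, eval_add]
    ring
  map_smul' c u := by
    rw [RingHom.id_apply, smul_eq_mul, Finset.mul_sum]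
    refine Finset.sum_congr rfl fun m _ => ?_
    simp only [Pi.smul_apply, eval_smul, smul_eq_mul]
    ring

theorem pointSum_apply (κ g : ZMod n → ℂ) (u : ZMod n → ℂ[X]) :
    pointSum κ g u = ∑ m, κ m * ((u m).eval (g m) + (u m).eval (-g m)) := rfl

theorem pointSum_flipNeg {κ g : ZMod n → ℂ} (hκ : ∀ m, κ (-m) = κ m) (hg : ∀ m, g (-m) = g m)
    (u : ZMod n → ℂ[X]) : pointSum κ g (flipNeg u) = pointSum κ g u := by
  rw [pointSum_apply, pointSum_apply]
  refine Fintype.sum_equiv (Equiv.neg _) _ _ fun m => ?_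
  rw [flipNeg_apply, Equiv.neg_apply, hκ, hg]
  simp only [eval_comp, eval_neg, eval_X, neg_neg]
  ring

theorem pointSum_single (κ g : ZMod n → ℂ) (m : ZMod n) (p : ℂ[X]) :
    pointSum κ g (Pi.single m p) = κ m * (p.eval (g m) + p.eval (-g m)) := by
  rw [pointSum_apply, Finset.sum_eq_single m]
  · rw [Pi.single_eq_same]
  · intro b _ hb
    rw [Pi.single_eq_of_ne hb]
    simp
  · simp

/-- Regularized alternating summation: a functional with prescribed alternating shift. -/
theorem exists_regularized_sum {κ g : ZMod n → ℂ} (hκ : ∀ m, κ (-m) = κ m) (hg : ∀ m, g (-m) = g m)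
    (halt : ∀ c : ZMod n → ℂ, (∀ m, c (m + 1) = -c m) → ∑ m, κ m * c m = 0) :
    ∃ t : (ZMod n → ℂ[X]) →ₗ[ℂ] ℂ, (∀ u, t u + t (shift u) = pointSum κ g (shift u)) ∧
      ∀ u, t u - pointSum κ g u = -t (flipNeg u) := by
  set Nn : Module.End ℂ (ZMod n → ℂ[X]) := 1 + shift with hN
  have hNapp : ∀ u, Nn u = u + shift u := fun u => rfl
  obtain ⟨G, hG⟩ := LinearMap.exists_rightInverse_of_surjective Nn
    (LinearMap.range_eq_top.2 one_add_shift_surjective)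
  -- Consistency of the equation for `t`: on the kernel of 1 + shift the prescribed value is zero,
  -- exactly by `halt`. Hence the definition through the section `G` satisfies the equation for
  -- every `u`.
  have hker : ∀ u, Nn u = 0 → pointSum κ g (shift u) = 0 := by
    intro u hu
    have hu' : shift u = -u := eq_neg_of_add_eq_zero_right hu
    obtain ⟨c, hc, huc⟩ := shift_eq_neg hu'
    rw [hu', map_neg, pointSum_apply, neg_eq_zero]
    have : ∀ m, κ m * ((u m).eval (g m) + (u m).eval (-g m)) = 2 * (κ m * c m) := by
      intro m
      rw [huc, eval_C, eval_C]
      ring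
    simp only [this]
    rw [← Finset.mul_sum, halt c hc, mul_zero]
  set t : (ZMod n → ℂ[X]) →ₗ[ℂ] ℂ := (pointSum κ g ∘ₗ shift) ∘ₗ G with ht
  have htN : ∀ u, t (Nn u) = pointSum κ g (shift u) := by
    intro u
    have h1 : Nn (G (Nn u) - u) = 0 := by
      rw [map_sub, ← LinearMap.comp_apply Nn G, hG, LinearMap.id_apply, sub_self]
    have h2 := hker _ h1
    rw [map_sub, map_sub, sub_eq_zero] at h2
    exact h2
  refine ⟨t, fun u => ?_, fun u => ?_⟩
  · rw [← map_add, ← hNapp, htN]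
  -- Writing u = v + shift v evaluates `t` on `u`, and the flip of `u` is again in this form, with
  -- `flipNeg (shift v)` in place of `v`.
  · obtain ⟨v, rfl⟩ := one_add_shift_surjective u
    change t (Nn v) - pointSum κ g (Nn v) = -t (flipNeg (Nn v))
    have h1 : flipNeg (Nn v) = Nn (flipNeg (shift v)) := by
      rw [hNapp, hNapp, map_add, shift_flipNeg_shift, add_comm]
    rw [h1, htN, htN, shift_flipNeg_shift, pointSum_flipNeg hκ hg, hNapp, map_add]
    ring

end

namespace DihedralOscillator

variable {n : ℕ} [NeZero n] {A : Type*} [Ring A] [Algebra ℂ A] (S : DihedralOscillator n A)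

/-! ### Right multiplication -/

theorem Jm_pow_mul {u : A} (h : S.Jm * u = u * (S.Jp + 1)) (l : ℕ) :
    S.Jm ^ l * u = u * (S.Jp + 1) ^ l :=
  ((show SemiconjBy u (S.Jp + 1) S.Jm from h.symm).pow_right l).eq.symm

theorem Jp_pow_mul {u : A} (h : S.Jp * u = u * (S.Jm - 1)) (l : ℕ) :
    S.Jp ^ l * u = u * (S.Jm - 1) ^ l :=
  ((show SemiconjBy u (S.Jm - 1) S.Jp from h.symm).pow_right l).eq.symm

theorem Jp_add_one_pow_mem (l : ℕ) (m : ZMod n) : (S.Jp + 1) ^ l * S.ε m ∈ S.inv :=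
  S.pow_mul_mem (fun X hX => by
    rw [add_mul, one_mul]; exact Submodule.add_mem _ (S.Jp_mul_mem hX) hX) l (S.ε_mem m)

theorem Jm_sub_one_pow_mem (l : ℕ) (m : ZMod n) : (S.Jm - 1) ^ l * (S.ε m * S.r) ∈ S.inv :=
  S.pow_mul_mem (fun X hX => by
    rw [sub_mul, one_mul]; exact Submodule.sub_mem _ (S.Jm_mul_mem hX) hX) l (S.ε_mul_r_mem m)

theorem Jm_pow_ε_mul_z (l : ℕ) (m : ZMod n) :
    S.Jm ^ l * S.ε m * S.z = S.z * ((S.Jp + 1) ^ l * S.ε (m - 1)) := by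
  rw [mul_assoc, S.ε_mul_z, ← mul_assoc, Jm_pow_mul S S.Jm_z, mul_assoc]

theorem Jm_pow_ε_mul_D (l : ℕ) (m : ZMod n) :
    S.Jm ^ l * S.ε m * S.D = S.D * ((S.Jp + 1) ^ l * S.ε (m - 1)) := by
  rw [mul_assoc, S.ε_mul_D, ← mul_assoc, Jm_pow_mul S S.Jm_D, mul_assoc]

theorem Jp_pow_ε_r_mul_z (l : ℕ) (m : ZMod n) :
    S.Jp ^ l * (S.ε m * S.r) * S.z = -(S.zb * ((S.Jm - 1) ^ l * (S.ε (m + 1) * S.r))) := by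
  rw [mul_assoc, mul_assoc, S.r_mul_z, mul_neg, ← mul_assoc (S.ε m), S.ε_mul_zb, mul_assoc, mul_neg,
    ← mul_assoc (S.Jp ^ l), Jp_pow_mul S S.Jp_zb, mul_assoc]

theorem Jp_pow_ε_r_mul_D (l : ℕ) (m : ZMod n) :
    S.Jp ^ l * (S.ε m * S.r) * S.D = -(S.Db * ((S.Jm - 1) ^ l * (S.ε (m + 1) * S.r))) := by
  rw [mul_assoc, mul_assoc, S.r_mul_D, mul_neg, ← mul_assoc (S.ε m), S.ε_mul_Db, mul_assoc, mul_neg,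
    ← mul_assoc (S.Jp ^ l), Jp_pow_mul S S.Jp_Db, mul_assoc]

theorem hw_mul_z {k : ℕ} {y : A} (hy : y ∈ S.hw k) : y * S.z ∈ S.hw (k + 1) := by
  refine S.hw_le (P := (S.hw (k + 1)).comap (LinearMap.mulRight ℂ S.z)) (fun a b X hk hX => ?_) hy
  refine S.inv_le (P := (S.hw (k + 1)).comap (LinearMap.mulRight ℂ S.z ∘ₗ
    LinearMap.mulLeft ℂ (S.z ^ a) ∘ₗ LinearMap.mulLeft ℂ (S.zb ^ b))) (fun l m => ?_) (fun l m => ?_) hX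
  · change S.z ^ a * (S.zb ^ b * (S.Jm ^ l * S.ε m)) * S.z ∈ S.hw (k + 1)
    have h : S.zb ^ b * S.z = S.z * S.zb ^ b :=
      Commute.pow_left (show Commute S.zb S.z from S.z_mul_zb.symm) b
    rw [mul_assoc, mul_assoc, Jm_pow_ε_mul_z, ← mul_assoc (S.zb ^ b), h, mul_assoc S.z,
      ← mul_assoc (S.z ^ a), ← pow_succ, ← hk, Nat.add_right_comm]
    exact S.mem_hw _ _ (S.Jp_add_one_pow_mem _ _)
  · change S.z ^ a * (S.zb ^ b * (S.Jp ^ l * (S.ε m * S.r))) * S.z ∈ S.hw (k + 1)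
    rw [mul_assoc, mul_assoc, Jp_pow_ε_r_mul_z, mul_neg, mul_neg, ← mul_assoc (S.zb ^ b), ← pow_succ,
      ← hk, Nat.add_assoc]
    exact Submodule.neg_mem _ (S.mem_hw _ _ (S.Jm_sub_one_pow_mem _ _))

theorem monomial_D_mem (a b : ℕ) {X : A} (hX : X ∈ S.inv) :
    S.z ^ a * (S.zb ^ b * (S.D * X)) ∈ S.spinNext (a + b) := by
  have h := Submodule.sub_mem _ (S.D_mul_hw_mem (S.mem_hw a b hX))
    (S.hwPred_le_spinNext (S.D_mul_monomial a b hX))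
  rwa [sub_sub_cancel] at h

theorem monomial_Db_mem (a b : ℕ) {X : A} (hX : X ∈ S.inv) :
    S.z ^ a * (S.zb ^ b * (S.Db * X)) ∈ S.spinNext (a + b) := by
  have h := Submodule.sub_mem _ (S.Db_mul_hw_mem (S.mem_hw a b hX))
    (S.hwPred_le_spinNext (S.Db_mul_monomial a b hX))
  rwa [sub_sub_cancel] at h

theorem hw_mul_D_mem {k : ℕ} {y : A} (hy : y ∈ S.hw k) : y * S.D ∈ S.spinNext k := by
  refine S.hw_le (P := (S.spinNext k).comap (LinearMap.mulRight ℂ S.D)) (fun a b X hk hX => ?_) hy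
  refine S.inv_le (P := (S.spinNext k).comap (LinearMap.mulRight ℂ S.D ∘ₗ
    LinearMap.mulLeft ℂ (S.z ^ a) ∘ₗ LinearMap.mulLeft ℂ (S.zb ^ b))) (fun l m => ?_) (fun l m => ?_) hX
  · change S.z ^ a * (S.zb ^ b * (S.Jm ^ l * S.ε m)) * S.D ∈ S.spinNext k
    rw [mul_assoc, mul_assoc, Jm_pow_ε_mul_D, ← hk]
    exact S.monomial_D_mem a b (S.Jp_add_one_pow_mem _ _)
  · change S.z ^ a * (S.zb ^ b * (S.Jp ^ l * (S.ε m * S.r))) * S.D ∈ S.spinNext k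
    rw [mul_assoc, mul_assoc, Jp_pow_ε_r_mul_D, mul_neg, mul_neg, ← hk]
    exact Submodule.neg_mem _ (S.monomial_Db_mem a b (S.Jm_sub_one_pow_mem _ _))

theorem spin_mul {k : ℕ} {x : A} (hx : x ∈ S.spin k) :
    x * S.z ∈ S.spinNext k ∧ x * S.D ∈ S.spinNext k :=
  S.orbit_mul_right (fun _ => S.F_mem_spinNext) S.F_z S.F_D
    (fun _ hy => S.hw_succ_le_spinNext (S.hw_mul_z hy)) (fun _ hy => S.hw_mul_D_mem hy) hx

/-! ### A criterion for supertraces -/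

/-- The conditions on a linear functional which characterize supertraces. -/
structure IsSupertrace (L : A →ₗ[ℂ] ℂ) : Prop where
  nontriv : ∀ x ∈ S.nontriv, L x = 0
  r_comm : ∀ X ∈ S.inv, L (S.r * X) = L (X * S.r)
  ε_comm : ∀ m, ∀ X ∈ S.inv, L (S.ε m * X) = L (X * S.ε m)
  raise : ∀ X ∈ S.inv, L (S.D * X * S.z) - L (S.z * X * S.D) = L (S.ρ 1 * X)
  lower : ∀ X ∈ S.inv,
    2 * L ((S.Jm - 1) * X) + (L (S.Db * X * S.z) - L (S.zb * X * S.D)) = 0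

theorem F_F_mem {k : ℕ} {y : A} (hy : y ∈ S.hw k) : S.F y ∈ S.spin k ∧ S.F (S.F y) ∈ S.spin k :=
  ⟨S.F_mem_orbit (S.mem_orbit hy), S.F_mem_orbit (S.F_mem_orbit (S.mem_orbit hy))⟩

namespace IsSupertrace

variable {S} {L : A →ₗ[ℂ] ℂ} (hL : S.IsSupertrace L)

include hL

theorem spin_succ {k : ℕ} {x : A} (hx : x ∈ S.spin (k + 1)) : L x = 0 :=
  hL.nontriv x (S.spin_succ_le k hx)

theorem hw_two {y : A} (hy : y ∈ S.hw 2) : L y = 0 ∧ L (S.F y) = 0 ∧ L (S.F (S.F y)) = 0 :=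
  ⟨hL.spin_succ (k := 1) (S.mem_orbit hy), hL.spin_succ (k := 1) (S.F_F_mem hy).1,
    hL.spin_succ (k := 1) (S.F_F_mem hy).2⟩

/-- A product of two doublets has a spin 1 and a spin 0 part. `L` kills the first, being the
descendants of highest weight vectors of weight 2; the second is governed by `raise`. -/
theorem doublet_z {X : A} (hX : X ∈ S.inv) :
    (L (S.z * (S.z * X) + S.z * X * S.z) = 0 ∧ L (S.D * (S.z * X) + S.z * X * S.D) = 0) ∧
    (L (S.z * (S.D * X) + S.D * X * S.z) = 0 ∧ L (S.D * (S.D * X) + S.D * X * S.D) = 0) := by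
  have hX0 : X ∈ S.hw 0 := S.hw_zero.ge hX
  have h1 := hL.hw_two (S.z_mul_hw (S.z_mul_hw hX0))
  have h2 := hL.hw_two (S.z_mul_hw (S.hw_mul_z hX0))
  have h3 := hL.raise X hX
  have h4 : S.D * (S.z * X) = S.z * (S.D * X) + S.ρ 1 * X := by
    rw [← mul_assoc, D_z, add_mul, mul_assoc]
  simp only [F_mul, F_z, F_D, S.F_inv hX, map_add, mul_zero, zero_mul, add_zero, zero_add] at h1 h2
  have h5 := congrArg L h4
  rw [map_add] at h5
  simp only [map_add, mul_assoc] at *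
  obtain ⟨a1, a2, a3⟩ := h1
  obtain ⟨b1, b2, b3⟩ := h2
  refine ⟨⟨?_, ?_⟩, ?_, ?_⟩
  · linear_combination a1 + b1
  · linear_combination (1 / 2) * a2 + (1 / 2) * b2 + (1 / 2) * h5 - (1 / 2) * h3
  · linear_combination (1 / 2) * a2 + (1 / 2) * b2 - (1 / 2) * h5 + (1 / 2) * h3
  · linear_combination (1 / 2) * a3 + (1 / 2) * b3

/-- As for `doublet_z`, with the spin 0 part governed by `lower`. -/
theorem doublet_zb {X : A} (hX : X ∈ S.inv) :
    (L (S.z * (S.zb * X) + S.zb * X * S.z) = 0 ∧ L (S.D * (S.zb * X) + S.zb * X * S.D) = 0) ∧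
    (L (S.z * (S.Db * X) + S.Db * X * S.z) = 0 ∧ L (S.D * (S.Db * X) + S.Db * X * S.D) = 0) := by
  have hX0 : X ∈ S.hw 0 := S.hw_zero.ge hX
  have h1 := hL.hw_two (S.z_mul_hw (S.zb_mul_hw hX0))
  have h2 := hL.hw_two (S.zb_mul_hw (S.hw_mul_z hX0))
  have h3 := hL.lower X hX
  have h4 : (S.Jm - 1) * X + (S.Jm - 1) * X = S.z * (S.Db * X) - S.D * (S.zb * X) := by
    linear_combination (norm := noncomm_ring) S.Jm_double' * X + S.D_zb * X
  simp only [F_mul, F_z, F_zb, F_D, F_Db, S.F_inv hX, map_add, mul_zero, zero_mul, add_zero,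
    zero_add] at h1 h2
  have h5 := congrArg L h4
  rw [map_add, map_sub] at h5
  simp only [map_add, mul_assoc] at *
  obtain ⟨a1, a2, a3⟩ := h1
  obtain ⟨b1, b2, b3⟩ := h2
  refine ⟨⟨?_, ?_⟩, ?_, ?_⟩
  · linear_combination a1 + b1
  · linear_combination (1 / 2) * a2 + (1 / 2) * b2 + (1 / 2) * h5 - (1 / 2) * h3
  · linear_combination (1 / 2) * a2 + (1 / 2) * b2 - (1 / 2) * h5 + (1 / 2) * h3
  · linear_combination (1 / 2) * a3 + (1 / 2) * b3

/-- The component of spin 1/2 is spanned by the doublets `(z X, D X)` and `(zb X, Db X)` with `X`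
invariant, so the two preceding lemmas suffice. -/
theorem spin_one {x : A} (hx : x ∈ S.spin 1) :
    L (S.z * x + x * S.z) = 0 ∧ L (S.D * x + x * S.D) = 0 := by
  let Q : Submodule ℂ A :=
    LinearMap.ker (L ∘ₗ (LinearMap.mulLeft ℂ S.z + LinearMap.mulRight ℂ S.z)) ⊓
      LinearMap.ker (L ∘ₗ (LinearMap.mulLeft ℂ S.D + LinearMap.mulRight ℂ S.D))
  have hQ : ∀ {x}, (L (S.z * x + x * S.z) = 0 ∧ L (S.D * x + x * S.D) = 0) → x ∈ Q := fun h => h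
  have hle : S.spin 1 ≤ Q := by
    refine S.orbit_le fun i y hy => ?_
    refine S.hw_le (P := Q.comap ((S.F : Module.End ℂ A) ^ i)) (fun a b X hk hX => ?_) hy
    rw [Submodule.mem_comap]
    have hab : (a = 1 ∧ b = 0) ∨ (a = 0 ∧ b = 1) := by omega
    have hF : ∀ u v : A, S.F u = v → S.F v = 0 → u * X ∈ Q → v * X ∈ Q →
        ((S.F : Module.End ℂ A) ^ i) (u * X) ∈ Q := by
      intro u v hu hv h1 h2
      have hs : ∀ x ∈ Submodule.span ℂ {u * X, v * X},
          S.F x ∈ Submodule.span ℂ {u * X, v * X} := by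
        intro x hx
        refine Submodule.span_induction (p := fun x _ => S.F x ∈ Submodule.span ℂ {u * X, v * X})
          ?_ ?_ ?_ ?_ hx
        · rintro x (rfl | rfl)
          · rw [F_mul, hu, S.F_inv hX, mul_zero, add_zero]
            exact Submodule.subset_span (by simp)
          · exact zero_mem_of_zero (by rw [F_mul, hv, S.F_inv hX, mul_zero, zero_mul, add_zero])
        · simp
        · intro x y _ _ h1 h2; rw [map_add]; exact Submodule.add_mem _ h1 h2
        · intro c x _ h; rw [map_smul]; exact Submodule.smul_mem _ _ h
      have hle : Submodule.span ℂ {u * X, v * X} ≤ Q := Submodule.span_le.2 (by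
        rintro x (rfl | rfl) <;> assumption)
      refine hle (S.orbit_le_of_stable le_rfl hs (S.F_pow_mem_orbit ?_ i))
      exact Submodule.subset_span (by simp)
    rcases hab with ⟨rfl, rfl⟩ | ⟨rfl, rfl⟩
    · rw [pow_one, pow_zero, one_mul]
      exact hF _ _ S.F_z S.F_D (hQ (hL.doublet_z hX).1) (hQ (hL.doublet_z hX).2)
    · rw [pow_one, pow_zero, one_mul]
      exact hF _ _ S.F_zb S.F_Db (hQ (hL.doublet_zb hX).1) (hQ (hL.doublet_zb hX).2)
  exact hle hx

theorem spinNext_eq_zero {k : ℕ} (hk : k ≠ 1) {x : A} (hx : x ∈ S.spinNext k) : L x = 0 := by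
  match k, hk with
  | 0, _ => rw [spinNext_zero] at hx; exact hL.spin_succ (k := 0) hx
  | k + 2, _ =>
    rw [spinNext_succ] at hx
    obtain ⟨y, hy, w, hw, rfl⟩ := Submodule.mem_sup.1 hx
    rw [map_add, hL.spin_succ (k := k + 2) hy, hL.spin_succ (k := k) hw, add_zero]

/-- Only spin 1/2 can reach an invariant after multiplication by a doublet; for every other k both
sides are zero. -/
theorem spin_comm {k : ℕ} {x : A} (hx : x ∈ S.spin k) :
    L (S.z * x) = (-1) ^ k * L (x * S.z) ∧ L (S.D * x) = (-1) ^ k * L (x * S.D) := by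
  by_cases hk : k = 1
  · subst hk
    have h := hL.spin_one hx
    rw [map_add, map_add] at h
    exact ⟨by linear_combination h.1, by linear_combination h.2⟩
  · rw [hL.spinNext_eq_zero hk (S.mul_spin hx).1, hL.spinNext_eq_zero hk (S.mul_spin hx).2,
      hL.spinNext_eq_zero hk (S.spin_mul hx).1, hL.spinNext_eq_zero hk (S.spin_mul hx).2]
    simp

theorem spin_r {k : ℕ} {x : A} (hx : x ∈ S.spin k) : L (S.r * x) = L (x * S.r) := by
  cases k with
  | zero => rw [spin_zero] at hx; exact hL.r_comm x hx
  | succ k => rw [hL.spin_succ (S.r_mul_spin hx), hL.spin_succ (S.spin_mul_r hx)]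

theorem spin_ε (m : ZMod n) {k : ℕ} {x : A} (hx : x ∈ S.spin k) :
    L (S.ε m * x) = L (x * S.ε m) := by
  cases k with
  | zero => rw [spin_zero] at hx; exact hL.ε_comm m x hx
  | succ k => rw [hL.spin_succ (S.ε_mul_spin m hx), hL.spin_succ (S.spin_mul_ε m hx)]

theorem conj_r {x : A} (hx : x ∈ S.inv ⊔ S.nontriv) : L (S.r * x * S.r) = L x := by
  have h : ∀ k, S.spin k ≤ LinearMap.ker
      (L ∘ₗ LinearMap.mulRight ℂ S.r ∘ₗ LinearMap.mulLeft ℂ S.r - L) := by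
    intro k x hx
    rw [LinearMap.mem_ker, LinearMap.sub_apply, sub_eq_zero]
    change L (S.r * x * S.r) = L x
    rw [mul_assoc, hL.spin_r (S.spin_mul_r hx), mul_assoc, S.r_mul_r, mul_one]
  have h2 : S.inv ⊔ S.nontriv ≤ LinearMap.ker
      (L ∘ₗ LinearMap.mulRight ℂ S.r ∘ₗ LinearMap.mulLeft ℂ S.r - L) :=
    sup_le (S.spin_zero ▸ h 0) (iSup_le fun k => h (k + 1))
  have h3 := h2 hx
  rw [LinearMap.mem_ker, LinearMap.sub_apply, sub_eq_zero] at h3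
  exact h3

/-- Conjugation by the reflection carries `spin_comm` to the second doublet, since `L` is invariant
under this conjugation. -/
theorem spin_comm' {k : ℕ} {x : A} (hx : x ∈ S.spin k) :
    L (S.zb * x) = (-1) ^ k * L (x * S.zb) ∧ L (S.Db * x) = (-1) ^ k * L (x * S.Db) := by
  have hle : ∀ {k x}, x ∈ S.spinNext k → x ∈ S.inv ⊔ S.nontriv := fun hx =>
    S.part_le_sup _ (S.spinNext_le_part _ hx)
  have hx' : S.r * x * S.r ∈ S.spin k := S.spin_mul_r (S.r_mul_spin hx)
  have h := hL.spin_comm hx'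
  have l1 := hL.conj_r (hle (S.mul_spin hx').1)
  have l2 := hL.conj_r (hle (S.mul_spin hx').2)
  have l3 := hL.conj_r (hle (S.spin_mul hx').1)
  have l4 := hL.conj_r (hle (S.spin_mul hx').2)
  have e1 : S.r * (S.z * (S.r * x * S.r)) * S.r = -(S.zb * x) := by
    linear_combination (norm := noncomm_ring) S.r_mul_z * S.r * x * S.r * S.r
      - S.zb * S.r_mul_r * x * S.r * S.r - S.zb * x * S.r_mul_r
  have e2 : S.r * (S.D * (S.r * x * S.r)) * S.r = -(S.Db * x) := by
    linear_combination (norm := noncomm_ring) S.r_mul_D * S.r * x * S.r * S.r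
      - S.Db * S.r_mul_r * x * S.r * S.r - S.Db * x * S.r_mul_r
  have e3 : S.r * (S.r * x * S.r * S.z) * S.r = -(x * S.zb) := by
    linear_combination (norm := noncomm_ring) S.r_mul_r * x * S.r * S.z * S.r
      + x * S.r_mul_z * S.r - x * S.zb * S.r_mul_r
  have e4 : S.r * (S.r * x * S.r * S.D) * S.r = -(x * S.Db) := by
    linear_combination (norm := noncomm_ring) S.r_mul_r * x * S.r * S.D * S.r
      + x * S.r_mul_D * S.r - x * S.Db * S.r_mul_r
  rw [e1, map_neg] at l1
  rw [e2, map_neg] at l2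
  rw [e3, map_neg] at l3
  rw [e4, map_neg] at l4
  rw [← l1, ← l2, ← l3, ← l4] at h
  exact ⟨by linear_combination -h.1, by linear_combination -h.2⟩

end IsSupertrace

end DihedralOscillator

/-! ### Moment functionals. -/

open Polynomial

/-- Functionals on polynomials with the shift and reflection laws satisfied by the moments of a
supertrace. -/
structure DihedralMoments (n : ℕ) [NeZero n] (γ : ZMod n → ℂ) where
  κ : ZMod n → ℂ
  tm : ZMod n → ℂ[X] →ₗ[ℂ] ℂ
  tp : ZMod n → ℂ[X] →ₗ[ℂ] ℂ
  jump : ∀ m p, tp m p = tm m p - κ m * (p.eval (γ m / 2) + p.eval (-(γ m / 2)))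
  shift : ∀ m p, tm m p = -tp (m - 1) (taylor 1 p)
  reflect : ∀ m p, tp m p = -tm (-m) (p.comp (-X))

/-- `tm` is the regularized sum read index by index, and `tp` is the same minus the point sum, so
the jump holds by construction. The shift and reflection laws are the two properties of the
regularized sum. -/
theorem exists_dihedralMoments {n : ℕ} [NeZero n] {γ κ : ZMod n → ℂ} (hκ : ∀ m, κ (-m) = κ m)
    (hγ : ∀ m, γ (-m) = γ m)
    (halt : ∀ c : ZMod n → ℂ, (∀ m, c (m + 1) = -c m) → ∑ m, κ m * c m = 0) :
    ∃ M : DihedralMoments n γ, M.κ = κ := by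
  obtain ⟨t, h1, h2⟩ := exists_regularized_sum (g := fun m => γ m / 2) hκ
    (fun m => by rw [hγ]) halt
  have hs : ∀ (m : ZMod n) (p : ℂ[X]), (_root_.shift (Pi.single m p) : ZMod n → ℂ[X]) =
      Pi.single (m - 1) (taylor 1 p) := by
    intro m p
    ext1 i
    rw [shift_apply]
    by_cases h : i = m - 1
    · subst h; rw [sub_add_cancel, Pi.single_eq_same, Pi.single_eq_same]
    · rw [Pi.single_eq_of_ne h, Pi.single_eq_of_ne (fun h' => h (eq_sub_of_add_eq h')), map_zero]
  have hf : ∀ (m : ZMod n) (p : ℂ[X]), (flipNeg (Pi.single m p) : ZMod n → ℂ[X]) =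
      Pi.single (-m) (p.comp (-X)) := by
    intro m p
    ext1 i
    rw [flipNeg_apply]
    by_cases h : i = -m
    · subst h; rw [neg_neg, Pi.single_eq_same, Pi.single_eq_same]
    · rw [Pi.single_eq_of_ne h, Pi.single_eq_of_ne (fun h' => h (by rw [← h', neg_neg])), zero_comp]
  refine ⟨{
    κ := κ
    tm := fun m => t ∘ₗ LinearMap.single ℂ (fun _ => ℂ[X]) m
    tp := fun m => (t - pointSum κ fun m => γ m / 2) ∘ₗ LinearMap.single ℂ (fun _ => ℂ[X]) m
    jump := fun m p => ?_
    shift := fun m p => ?_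
    reflect := fun m p => ?_ }, rfl⟩
  · change t (Pi.single m p) - pointSum κ (fun m => γ m / 2) (Pi.single m p) = _
    rw [pointSum_single]
    rfl
  · change t (Pi.single m p) =
      -(t (Pi.single (m - 1) (taylor 1 p)) -
        pointSum κ (fun m => γ m / 2) (Pi.single (m - 1) (taylor 1 p)))
    rw [← hs, ← h1]
    ring
  · change t (Pi.single m p) - pointSum κ (fun m => γ m / 2) (Pi.single m p) =
      -t (Pi.single (-m) (p.comp (-X)))
    rw [← hf, ← h2]

namespace DihedralMoments

variable {n : ℕ} [NeZero n] {γ : ZMod n → ℂ} (M : DihedralMoments n γ)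

theorem tm_reflect (m : ZMod n) (p : ℂ[X]) : M.tm m p = -M.tp (-m) (p.comp (-X)) := by
  rw [M.reflect, neg_neg, neg_neg, comp_assoc]
  simp

theorem tp_odd (m : ZMod n) (i : ℕ) : M.tp m (X ^ (2 * i + 1)) = M.tm m (X ^ (2 * i + 1)) := by
  rw [M.jump]
  simp only [eval_pow, eval_X, Odd.neg_pow ⟨i, rfl⟩]
  ring

/-- Where `γ m` is nonzero, m is its own negative, so the reflection law compares `tp` and `tm` at
the same index. -/
theorem γ_mul_tp_even (hγ : ∀ m, -m ≠ m → γ m = 0) (m : ZMod n) (i : ℕ) :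
    γ m * M.tp m (X ^ (2 * i)) = -(γ m * M.tm m (X ^ (2 * i))) := by
  by_cases h : -m = m
  · have h1 := M.reflect m (X ^ (2 * i))
    rw [h, pow_comp, X_comp, (even_two_mul i).neg_pow] at h1
    rw [h1]
    ring
  · rw [hγ m h]; ring

/-- The jump of X^(2i+2) is (γ m / 2)² times that of X^(2i), since it sits at ± γ m / 2;
`γ_mul_tp_even` then expresses the latter by `tp` alone. This is the moment form of the relation
`Jp_odd`. -/
theorem tp_even_succ (hγ : ∀ m, -m ≠ m → γ m = 0) (m : ZMod n) (i : ℕ) :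
    M.tp m (X ^ (2 * i + 2)) = M.tm m (X ^ (2 * i + 2)) + γ m * (γ m / 2 * M.tp m (X ^ (2 * i))) := by
  have h1 := M.jump m (X ^ (2 * i + 2))
  have h2 := M.jump m (X ^ (2 * i))
  have h3 := M.γ_mul_tp_even hγ m i
  have e : Even (2 * i + 2) := ⟨i + 1, by ring⟩
  simp only [eval_pow, eval_X, (even_two_mul i).neg_pow, e.neg_pow] at h1 h2
  rw [h1]
  linear_combination (-γ m / 4) * h3 - (γ m ^ 2 / 4) * h2

end DihedralMoments

/-! ### Moments define supertraces. -/

namespace DihedralOscillator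

variable {n : ℕ} [NeZero n] {A : Type*} [Ring A] [Algebra ℂ A] (S : DihedralOscillator n A)

theorem Jp_even (i : ℕ) : S.Jp ^ (2 * i) = S.Jm ^ (2 * i) := by
  rw [pow_mul, pow_mul, pow_two, pow_two, Jp_sq]

theorem Jp_odd (i : ℕ) : S.Jp ^ (2 * i + 1) = S.Jm ^ (2 * i + 1) + S.Jp ^ (2 * i) * S.ρ 0 := by
  conv_lhs => rw [pow_succ, Jp_eq, mul_add, ← Jp_eq]
  rw [Jp_even, pow_succ]

theorem aeval_semiconj {a x y : A} (h : a * x = y * a) (p : ℂ[X]) :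
    a * aeval x p = aeval y p * a := by
  induction p using Polynomial.induction_on' with
  | add p q hp hq => rw [map_add, mul_add, hp, hq, map_add, add_mul]
  | monomial l c =>
    have hl : a * x ^ l = y ^ l * a := (show SemiconjBy a x y from h).pow_right l
    rw [aeval_monomial, aeval_monomial, ← mul_assoc, ← Algebra.commutes, mul_assoc, hl, mul_assoc]

theorem aeval_anti {a x y : A} (h : a * x = -(y * a)) (p : ℂ[X]) :
    a * aeval x p = aeval y (p.comp (-X)) * a := by
  rw [aeval_comp, map_neg, aeval_X]
  exact aeval_semiconj (by rw [h, neg_mul]) p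

theorem aeval_taylor (x : A) (c : ℂ) (p : ℂ[X]) :
    aeval x (taylor c p) = aeval (x + algebraMap ℂ A c) p := by
  rw [taylor_apply, aeval_comp, map_add, aeval_X, aeval_C]

theorem aeval_Jm_mul {u : A} (h : S.Jm * u = u * (S.Jp + 1)) (p : ℂ[X]) :
    aeval S.Jm p * u = u * aeval S.Jp (taylor 1 p) := by
  rw [aeval_taylor, map_one]
  exact (aeval_semiconj h.symm p).symm

theorem aeval_Jp_mul {u : A} (h : S.Jp * u = u * (S.Jm - 1)) (p : ℂ[X]) :
    aeval S.Jp p * u = u * aeval S.Jm (taylor (-1) p) := by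
  rw [aeval_taylor, map_neg, map_one, ← sub_eq_add_neg]
  exact (aeval_semiconj h.symm p).symm

theorem aeval_comm_ε_Jm (m : ZMod n) (p : ℂ[X]) : S.ε m * aeval S.Jm p = aeval S.Jm p * S.ε m :=
  aeval_semiconj (S.ε_Jm m) p

theorem aeval_comm_ε_Jp (m : ZMod n) (p : ℂ[X]) : S.ε m * aeval S.Jp p = aeval S.Jp p * S.ε m :=
  aeval_semiconj (S.ε_Jp m) p

theorem ε_aeval_r {x y : A} (hx : S.r * x = -(y * S.r)) (hy : ∀ m, S.ε m * y = y * S.ε m)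
    (i m : ZMod n) (p : ℂ[X]) :
    S.ε i * S.r * (aeval x p * S.ε m) =
      if i = -m then aeval y (p.comp (-X)) * (S.ε (-m) * S.r) else 0 := by
  rw [mul_assoc, ← mul_assoc S.r, aeval_anti hx, mul_assoc, S.r_mul_ε, ← mul_assoc,
    aeval_semiconj (hy i), mul_assoc, ← mul_assoc (S.ε i), S.ε_mul_ε]
  split_ifs with h
  · rw [h]
  · simp

theorem ρ_aeval_ε {x y : A} (hx : S.r * x = -(y * S.r)) (hy : ∀ m, S.ε m * y = y * S.ε m)
    (a m : ZMod n) (p : ℂ[X]) :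
    S.ρ a * (aeval x p * S.ε m) = S.γ (m + a) • (aeval y (p.comp (-X)) * (S.ε (-m) * S.r)) := by
  rw [ρ, Finset.sum_mul, Finset.sum_eq_single (-m)]
  · rw [smul_mul_assoc, S.ε_aeval_r hx hy, if_pos rfl, ← S.γ_neg]
    congr 2
    ring
  · intro i _ hi
    rw [smul_mul_assoc, S.ε_aeval_r hx hy, if_neg hi, smul_zero]
  · simp

theorem ρ_aeval_ε_r {x y : A} (hx : S.r * x = -(y * S.r)) (hy : ∀ m, S.ε m * y = y * S.ε m)
    (a m : ZMod n) (p : ℂ[X]) :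
    S.ρ a * (aeval x p * (S.ε m * S.r)) = S.γ (m + a) • (aeval y (p.comp (-X)) * S.ε (-m)) := by
  rw [← mul_assoc (aeval x p), ← mul_assoc, S.ρ_aeval_ε hx hy, smul_mul_assoc, mul_assoc, mul_assoc,
    S.r_mul_r, mul_one]

/-- The values on the invariants are given by moments. -/
structure HasMoments (M : DihedralMoments n S.γ) (L : A →ₗ[ℂ] ℂ) : Prop where
  Jm_ε : ∀ l m, L (S.Jm ^ l * S.ε m) = M.tm m (X ^ (l + 1))
  Jp_r : ∀ l m, L (S.Jp ^ l * (S.ε m * S.r)) = S.γ m / 2 * M.tp m (X ^ l)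

namespace HasMoments

variable {S} {M : DihedralMoments n S.γ} {L : A →ₗ[ℂ] ℂ} (hL : S.HasMoments M L)

theorem of_pow {x w : A} {φ : ℂ[X] →ₗ[ℂ] ℂ} (h : ∀ l : ℕ, L (x ^ l * w) = φ (X ^ l)) (p : ℂ[X]) :
    L (aeval x p * w) = φ p := by
  induction p using Polynomial.induction_on' with
  | add p q hp hq => rw [map_add, add_mul, map_add, hp, hq, map_add]
  | monomial l c =>
    rw [← smul_X_eq_monomial, map_smul, map_smul, smul_mul_assoc, map_smul, map_pow, aeval_X, h]

include hL

/-- Even powers of `Jp` and `Jm` agree. Odd powers differ by a reflection term, whose value is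
precisely the discrepancy computed in `tp_even_succ`. -/
theorem Jp_ε (l : ℕ) (m : ZMod n) : L (S.Jp ^ l * S.ε m) = M.tp m (X ^ (l + 1)) := by
  rcases Nat.even_or_odd' l with ⟨i, rfl | rfl⟩
  · rw [Jp_even, hL.Jm_ε, M.tp_odd]
  · rw [Jp_odd, add_mul, map_add, hL.Jm_ε, mul_assoc, ρ_zero_ε, mul_smul_comm, map_smul, hL.Jp_r,
      M.tp_even_succ S.γ_eq_zero, smul_eq_mul]

theorem Jm_r (l : ℕ) (m : ZMod n) :
    L (S.Jm ^ l * (S.ε m * S.r)) = -(S.γ m / 2) * M.tm m (X ^ l) := by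
  rcases Nat.even_or_odd' l with ⟨i, rfl | rfl⟩
  · have h := M.γ_mul_tp_even S.γ_eq_zero m i
    rw [← Jp_even, hL.Jp_r]
    linear_combination (1 / 2) * h
  · have h : S.Jm ^ (2 * i + 1) = S.Jp ^ (2 * i + 1) - S.Jp ^ (2 * i) * S.ρ 0 := by
      rw [Jp_odd]; abel
    rw [h, sub_mul, map_sub, hL.Jp_r, mul_assoc, ρ_zero_mul_ε_mul_r, mul_smul_comm, map_smul,
      hL.Jp_ε, M.tp_odd, smul_eq_mul]
    ring

theorem aeval_Jm_ε (m : ZMod n) (p : ℂ[X]) : L (aeval S.Jm p * S.ε m) = M.tm m (X * p) :=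
  of_pow (φ := M.tm m ∘ₗ LinearMap.mulLeft ℂ X) (fun l => by
    rw [hL.Jm_ε, LinearMap.comp_apply, LinearMap.mulLeft_apply, pow_succ']) p

theorem aeval_Jp_ε (m : ZMod n) (p : ℂ[X]) : L (aeval S.Jp p * S.ε m) = M.tp m (X * p) :=
  of_pow (φ := M.tp m ∘ₗ LinearMap.mulLeft ℂ X) (fun l => by
    rw [hL.Jp_ε, LinearMap.comp_apply, LinearMap.mulLeft_apply, pow_succ']) p

theorem aeval_Jp_r (m : ZMod n) (p : ℂ[X]) :
    L (aeval S.Jp p * (S.ε m * S.r)) = S.γ m / 2 * M.tp m p :=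
  of_pow (φ := (S.γ m / 2) • M.tp m) (fun l => hL.Jp_r l m) p

theorem aeval_Jm_r (m : ZMod n) (p : ℂ[X]) :
    L (aeval S.Jm p * (S.ε m * S.r)) = -(S.γ m / 2) * M.tm m p :=
  of_pow (φ := (-(S.γ m / 2)) • M.tm m) (fun l => hL.Jm_r l m) p

theorem ρ_Jm_ε (a m : ZMod n) (p : ℂ[X]) :
    L (S.ρ a * (aeval S.Jm p * S.ε m)) = -(S.γ (m + a) * (S.γ m / 2) * M.tm m p) := by
  rw [S.ρ_aeval_ε S.r_Jm S.ε_Jp, map_smul, hL.aeval_Jp_r, S.γ_neg, M.tm_reflect, smul_eq_mul]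
  ring

theorem ρ_Jp_ε (a m : ZMod n) (p : ℂ[X]) :
    L (S.ρ a * (aeval S.Jp p * S.ε m)) = S.γ (m + a) * (S.γ m / 2) * M.tp m p := by
  rw [S.ρ_aeval_ε S.r_Jp S.ε_Jm, map_smul, hL.aeval_Jm_r, S.γ_neg, M.reflect, smul_eq_mul]
  ring

theorem ρ_Jp_r (a m : ZMod n) (p : ℂ[X]) :
    L (S.ρ a * (aeval S.Jp p * (S.ε m * S.r))) = S.γ (m + a) * M.tp m (X * p) := by
  rw [S.ρ_aeval_ε_r S.r_Jp S.ε_Jm, map_smul, hL.aeval_Jm_ε, M.reflect m, mul_comp, X_comp, neg_mul,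
    map_neg, neg_neg, smul_eq_mul]

theorem ρ_Jm_r (a m : ZMod n) (p : ℂ[X]) :
    L (S.ρ a * (aeval S.Jm p * (S.ε m * S.r))) = S.γ (m + a) * M.tm m (X * p) := by
  rw [S.ρ_aeval_ε_r S.r_Jm S.ε_Jp, map_smul, hL.aeval_Jp_ε, M.tm_reflect m, mul_comp, X_comp, neg_mul,
    map_neg, neg_neg, smul_eq_mul]

omit hL in
/-- An identity between linear functions of an invariant need only be checked on spanning
elements. -/
theorem inv_ext {V : Type*} [AddCommGroup V] [Module ℂ V] {φ ψ : A →ₗ[ℂ] V}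
    (h1 : ∀ (p : ℂ[X]) m, φ (aeval S.Jm p * S.ε m) = ψ (aeval S.Jm p * S.ε m))
    (h2 : ∀ (p : ℂ[X]) m, φ (aeval S.Jp p * (S.ε m * S.r)) = ψ (aeval S.Jp p * (S.ε m * S.r)))
    {x : A} (hx : x ∈ S.inv) : φ x = ψ x := by
  have h : S.inv ≤ LinearMap.ker (φ - ψ) := by
    refine S.inv_le (fun l m => ?_) (fun l m => ?_)
    · have := h1 (X ^ l) m
      rw [map_pow, aeval_X] at this
      rw [LinearMap.mem_ker, LinearMap.sub_apply, this, sub_self]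
    · have := h2 (X ^ l) m
      rw [map_pow, aeval_X] at this
      rw [LinearMap.mem_ker, LinearMap.sub_apply, this, sub_self]
  have h3 := h hx
  rwa [LinearMap.mem_ker, LinearMap.sub_apply, sub_eq_zero] at h3

theorem r_comm {x : A} (hx : x ∈ S.inv) : L (S.r * x) = L (x * S.r) := by
  refine inv_ext (S := S) (φ := L ∘ₗ LinearMap.mulLeft ℂ S.r) (ψ := L ∘ₗ LinearMap.mulRight ℂ S.r)
    (fun p m => ?_) (fun p m => ?_) hx
  · change L (S.r * (aeval S.Jm p * S.ε m)) = L (aeval S.Jm p * S.ε m * S.r)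
    rw [← mul_assoc, aeval_anti S.r_Jm, mul_assoc, S.r_mul_ε, hL.aeval_Jp_r, mul_assoc, hL.aeval_Jm_r,
      S.γ_neg, M.tm_reflect m]
    ring
  · change L (S.r * (aeval S.Jp p * (S.ε m * S.r))) = L (aeval S.Jp p * (S.ε m * S.r) * S.r)
    rw [← mul_assoc, aeval_anti S.r_Jp, mul_assoc, ← mul_assoc S.r, S.r_mul_ε, mul_assoc, S.r_mul_r,
      mul_one, mul_assoc, mul_assoc, S.r_mul_r, mul_one, hL.aeval_Jm_ε, hL.aeval_Jp_ε, M.reflect m,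
      mul_comp, X_comp, neg_mul, map_neg, neg_neg]

theorem ε_comm (i : ZMod n) {x : A} (hx : x ∈ S.inv) : L (S.ε i * x) = L (x * S.ε i) := by
  refine inv_ext (S := S) (φ := L ∘ₗ LinearMap.mulLeft ℂ (S.ε i))
    (ψ := L ∘ₗ LinearMap.mulRight ℂ (S.ε i)) (fun p m => ?_) (fun p m => ?_) hx
  · change L (S.ε i * (aeval S.Jm p * S.ε m)) = L (aeval S.Jm p * S.ε m * S.ε i)
    rw [← mul_assoc, aeval_comm_ε_Jm, mul_assoc, mul_assoc, S.ε_mul_ε, S.ε_mul_ε]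
    by_cases h : i = m
    · rw [if_pos h, if_pos h.symm, h]
    · rw [if_neg h, if_neg (Ne.symm h)]
  · change L (S.ε i * (aeval S.Jp p * (S.ε m * S.r))) = L (aeval S.Jp p * (S.ε m * S.r) * S.ε i)
    rw [← mul_assoc, aeval_comm_ε_Jp, mul_assoc, ← mul_assoc (S.ε i), S.ε_mul_ε, mul_assoc (aeval S.Jp p),
      mul_assoc (S.ε m), S.r_mul_ε, ← mul_assoc (S.ε m), S.ε_mul_ε]
    -- Moving ε i through the reflection turns it into ε (-i). The two sides match when -m = m;
    -- otherwise γ m = 0 and every value involved is zero.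
    by_cases hm : -m = m
    · by_cases h : i = m
      · rw [if_pos h, if_pos (by rw [h, hm]), h]
      · rw [if_neg h, if_neg (fun h' => h (by rw [← hm, h', neg_neg]))]
    · have h0 : L (aeval S.Jp p * (S.ε m * S.r)) = 0 := by
        rw [hL.aeval_Jp_r, S.γ_eq_zero m hm]; simp
      have e1 : L (aeval S.Jp p * ((if i = m then S.ε i else 0) * S.r)) = 0 := by
        split_ifs with h
        · rw [h, h0]
        · simp
      have e2 : L (aeval S.Jp p * ((if m = -i then S.ε m else 0) * S.r)) = 0 := by
        split_ifs with h
        · exact h0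
        · simp
      rw [e1, e2]

omit hL in
-- If -m = m, then m + 1 and m - 1 are negatives of each other and `γ` is even; otherwise both sides
-- are zero.
theorem γ_mul_γ (m : ZMod n) : S.γ (m + 1) * S.γ m = S.γ m * S.γ (m - 1) := by
  by_cases h : -m = m
  · have : S.γ (m - 1) = S.γ (m + 1) := by
      rw [← S.γ_neg (m - 1)]
      congr 1
      linear_combination h
    rw [this, mul_comm]
  · rw [S.γ_eq_zero m h]; ring

omit hL in
theorem taylor_neg_taylor (p : ℂ[X]) : taylor 1 (taylor (-1) p) = p := by
  rw [taylor_taylor]; simp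

/-- Moving `z` and `D` leftwards through `x` shifts the polynomial argument by one and leaves a
quadratic expression in the generators: `ρ 1` when `x` is a rotation term, 2 (Jm - 1) when it is a
reflection term. The shift law of the moments then gives the right-hand side. -/
theorem raise {x : A} (hx : x ∈ S.inv) : L (S.D * x * S.z) - L (S.z * x * S.D) = L (S.ρ 1 * x) := by
  refine inv_ext (S := S) (φ := L ∘ₗ LinearMap.mulRight ℂ S.z ∘ₗ LinearMap.mulLeft ℂ S.D -
    L ∘ₗ LinearMap.mulRight ℂ S.D ∘ₗ LinearMap.mulLeft ℂ S.z) (ψ := L ∘ₗ LinearMap.mulLeft ℂ (S.ρ 1))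
    (fun p m => ?_) (fun p m => ?_) hx
  · change L (S.D * (aeval S.Jm p * S.ε m) * S.z) - L (S.z * (aeval S.Jm p * S.ε m) * S.D) =
      L (S.ρ 1 * (aeval S.Jm p * S.ε m))
    have e1 : aeval S.Jm p * S.ε m * S.z = S.z * (aeval S.Jp (taylor 1 p) * S.ε (m - 1)) := by
      rw [mul_assoc, S.ε_mul_z, ← mul_assoc, S.aeval_Jm_mul S.Jm_z, mul_assoc]
    have e2 : aeval S.Jm p * S.ε m * S.D = S.D * (aeval S.Jp (taylor 1 p) * S.ε (m - 1)) := by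
      rw [mul_assoc, S.ε_mul_D, ← mul_assoc, S.aeval_Jm_mul S.Jm_D, mul_assoc]
    rw [mul_assoc, e1, mul_assoc, e2, ← map_sub, ← mul_assoc, D_z, add_mul, mul_assoc,
      add_sub_cancel_left, hL.ρ_Jp_ε, hL.ρ_Jm_ε, M.shift m, sub_add_cancel]
    linear_combination (-M.tp (m - 1) (taylor 1 p) / 2) * γ_mul_γ (S := S) m
  · change L (S.D * (aeval S.Jp p * (S.ε m * S.r)) * S.z) -
      L (S.z * (aeval S.Jp p * (S.ε m * S.r)) * S.D) = L (S.ρ 1 * (aeval S.Jp p * (S.ε m * S.r)))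
    have e1 : aeval S.Jp p * (S.ε m * S.r) * S.z =
        -(S.zb * (aeval S.Jm (taylor (-1) p) * (S.ε (m + 1) * S.r))) := by
      rw [mul_assoc, mul_assoc, S.r_mul_z, mul_neg, ← mul_assoc (S.ε m), S.ε_mul_zb, mul_assoc, mul_neg,
        ← mul_assoc (aeval S.Jp p), S.aeval_Jp_mul S.Jp_zb, mul_assoc]
    have e2 : aeval S.Jp p * (S.ε m * S.r) * S.D =
        -(S.Db * (aeval S.Jm (taylor (-1) p) * (S.ε (m + 1) * S.r))) := by
      rw [mul_assoc, mul_assoc, S.r_mul_D, mul_neg, ← mul_assoc (S.ε m), S.ε_mul_Db, mul_assoc, mul_neg,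
        ← mul_assoc (aeval S.Jp p), S.aeval_Jp_mul S.Jp_Db, mul_assoc]
    set q := taylor (-1) p with hq
    set w := S.ε (m + 1) * S.r with hw
    have e3 : S.D * -(S.zb * (aeval S.Jm q * w)) - S.z * -(S.Db * (aeval S.Jm q * w)) =
        aeval S.Jm ((X - 1) * q) * w + aeval S.Jm ((X - 1) * q) * w := by
      rw [map_mul, map_sub, aeval_X, map_one]
      linear_combination (norm := noncomm_ring) -(S.D_zb * (aeval S.Jm q * w)) -
        S.Jm_double' * (aeval S.Jm q * w)
    rw [mul_assoc, e1, mul_assoc, e2, ← map_sub, e3, map_add, hL.aeval_Jm_r, hL.ρ_Jp_r, M.shift (m + 1),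
      add_sub_cancel_right, taylor_mul, hq, taylor_neg_taylor, map_sub, taylor_X, taylor_one, C_1,
      add_sub_cancel_right]
    ring

/-- The mechanism of `raise`, with quadratic expression 2 (Jp + 1) on rotation terms and -ρ (-1) on
reflection terms. -/
theorem lower {x : A} (hx : x ∈ S.inv) :
    2 * L ((S.Jm - 1) * x) + (L (S.Db * x * S.z) - L (S.zb * x * S.D)) = 0 := by
  refine inv_ext (S := S) (φ := (2 : ℂ) • (L ∘ₗ LinearMap.mulLeft ℂ (S.Jm - 1)) +
    (L ∘ₗ LinearMap.mulRight ℂ S.z ∘ₗ LinearMap.mulLeft ℂ S.Db -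
    L ∘ₗ LinearMap.mulRight ℂ S.D ∘ₗ LinearMap.mulLeft ℂ S.zb)) (ψ := 0)
    (fun p m => ?_) (fun p m => ?_) hx
  · change 2 * L ((S.Jm - 1) * (aeval S.Jm p * S.ε m)) + (L (S.Db * (aeval S.Jm p * S.ε m) * S.z) -
      L (S.zb * (aeval S.Jm p * S.ε m) * S.D)) = 0
    have e1 : aeval S.Jm p * S.ε m * S.z = S.z * (aeval S.Jp (taylor 1 p) * S.ε (m - 1)) := by
      rw [mul_assoc, S.ε_mul_z, ← mul_assoc, S.aeval_Jm_mul S.Jm_z, mul_assoc]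
    have e2 : aeval S.Jm p * S.ε m * S.D = S.D * (aeval S.Jp (taylor 1 p) * S.ε (m - 1)) := by
      rw [mul_assoc, S.ε_mul_D, ← mul_assoc, S.aeval_Jm_mul S.Jm_D, mul_assoc]
    set q := taylor 1 p with hq
    set w := S.ε (m - 1) with hw
    have e3 : S.Db * (S.z * (aeval S.Jp q * w)) - S.zb * (S.D * (aeval S.Jp q * w)) =
        aeval S.Jp ((X + 1) * q) * w + aeval S.Jp ((X + 1) * q) * w := by
      rw [map_mul, map_add, aeval_X, map_one]
      linear_combination (norm := noncomm_ring) S.Db_z * (aeval S.Jp q * w) -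
        S.Jp_double' * (aeval S.Jp q * w)
    have e4 : (S.Jm - 1) * (aeval S.Jm p * S.ε m) = aeval S.Jm ((X - 1) * p) * S.ε m := by
      rw [map_mul, map_sub, aeval_X, map_one, mul_assoc]
    rw [mul_assoc S.Db, e1, mul_assoc S.zb, e2, ← map_sub, e3, e4, map_add, hL.aeval_Jm_ε, hL.aeval_Jp_ε,
      M.shift m, taylor_mul, taylor_mul, map_sub, taylor_X, taylor_one, C_1, add_sub_cancel_right, ← hq,
      mul_left_comm]
    ring
  · change 2 * L ((S.Jm - 1) * (aeval S.Jp p * (S.ε m * S.r))) +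
      (L (S.Db * (aeval S.Jp p * (S.ε m * S.r)) * S.z) -
      L (S.zb * (aeval S.Jp p * (S.ε m * S.r)) * S.D)) = 0
    have e1 : aeval S.Jp p * (S.ε m * S.r) * S.z =
        -(S.zb * (aeval S.Jm (taylor (-1) p) * (S.ε (m + 1) * S.r))) := by
      rw [mul_assoc, mul_assoc, S.r_mul_z, mul_neg, ← mul_assoc (S.ε m), S.ε_mul_zb, mul_assoc, mul_neg,
        ← mul_assoc (aeval S.Jp p), S.aeval_Jp_mul S.Jp_zb, mul_assoc]
    have e2 : aeval S.Jp p * (S.ε m * S.r) * S.D =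
        -(S.Db * (aeval S.Jm (taylor (-1) p) * (S.ε (m + 1) * S.r))) := by
      rw [mul_assoc, mul_assoc, S.r_mul_D, mul_neg, ← mul_assoc (S.ε m), S.ε_mul_Db, mul_assoc, mul_neg,
        ← mul_assoc (aeval S.Jp p), S.aeval_Jp_mul S.Jp_Db, mul_assoc]
    set q := taylor (-1) p with hq
    have e3 : S.Db * -(S.zb * (aeval S.Jm q * (S.ε (m + 1) * S.r))) -
        S.zb * -(S.Db * (aeval S.Jm q * (S.ε (m + 1) * S.r))) =
        -(S.ρ (-1) * (aeval S.Jm q * (S.ε (m + 1) * S.r))) := by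
      linear_combination (norm := noncomm_ring) -(S.Db_zb * (aeval S.Jm q * (S.ε (m + 1) * S.r)))
    have e4 : (S.Jm - 1) * (aeval S.Jp p * (S.ε m * S.r)) =
        aeval S.Jp ((X - 1) * p) * (S.ε m * S.r) - S.ρ 0 * (aeval S.Jp p * (S.ε m * S.r)) := by
      rw [map_mul, map_sub, aeval_X, map_one]
      linear_combination (norm := noncomm_ring) -(S.Jp_eq * (aeval S.Jp p * (S.ε m * S.r)))
    have e5 : X * p = (X - 1) * p + p := by ring
    have e6 : (X + 1) * p = (X - 1) * p + (2 : ℂ) • p := by rw [two_smul]; ring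
    rw [mul_assoc S.Db, e1, mul_assoc S.zb, e2, ← map_sub, e3, e4, map_sub, map_neg, hL.aeval_Jp_r,
      hL.ρ_Jp_r, hL.ρ_Jm_r, M.shift (m + 1), add_sub_cancel_right, taylor_mul, hq, taylor_neg_taylor,
      taylor_X, C_1, e5, e6, map_add, map_add, map_smul, smul_eq_mul, add_zero, add_neg_cancel_right]
    ring

/-- A functional that vanishes on nontrivial components and is given by moments on invariants is a
supertrace. -/
theorem isSupertrace (h0 : ∀ x ∈ S.nontriv, L x = 0) : S.IsSupertrace L where
  nontriv := h0
  r_comm _ := hL.r_comm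
  ε_comm m _ := hL.ε_comm m
  raise _ := hL.raise
  lower _ := hL.lower

end HasMoments

/-- The ordered monomials in the angular momentum and the dihedral group. -/
def invFamily : (ℕ × ZMod n) ⊕ (ℕ × ZMod n) → A :=
  Sum.elim (fun p => S.Jm ^ p.1 * S.ε p.2) (fun p => S.Jp ^ p.1 * (S.ε p.2 * S.r))

/-- Disjointness keeps the family independent modulo `K`, so the functional is defined on its span
in the quotient and extended. -/
theorem exists_functional {ι V : Type*} [AddCommGroup V] [Module ℂ V] {v : ι → V} {K : Submodule ℂ V}
    (hv : LinearIndependent ℂ v) (hK : Disjoint (Submodule.span ℂ (Set.range v)) K) (c : ι → ℂ) :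
    ∃ L : V →ₗ[ℂ] ℂ, (∀ i, L (v i) = c i) ∧ ∀ x ∈ K, L x = 0 := by
  have hq : LinearIndependent ℂ (K.mkQ ∘ v) := hv.map (by rwa [Submodule.ker_mkQ])
  obtain ⟨g, hg⟩ := LinearMap.exists_extend (Finsupp.linearCombination ℂ c ∘ₗ hq.repr)
  refine ⟨g ∘ₗ K.mkQ, fun i => ?_, fun x hx => ?_⟩
  · have h1 := LinearMap.congr_fun hg ⟨(K.mkQ ∘ v) i, Submodule.subset_span ⟨i, rfl⟩⟩
    rw [LinearMap.comp_apply, LinearMap.comp_apply, hq.repr_eq_single i _ rfl] at h1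
    simpa using h1
  · rw [LinearMap.comp_apply, Submodule.mkQ_apply, (Submodule.Quotient.mk_eq_zero K).2 hx, map_zero]

theorem exists_isSupertrace (hS : LinearIndependent ℂ S.invFamily) (M : DihedralMoments n S.γ) :
    ∃ L : A →ₗ[ℂ] ℂ, S.IsSupertrace L ∧ S.HasMoments M L := by
  have hspan : Submodule.span ℂ (Set.range S.invFamily) = S.inv := by
    rw [invFamily, Set.Sum.elim_range]; rfl
  obtain ⟨L, h1, h2⟩ := exists_functional hS (hspan ▸ S.disjoint_inv_nontriv)
    (Sum.elim (fun p => M.tm p.2 (X ^ (p.1 + 1))) fun p => S.γ p.2 / 2 * M.tp p.2 (X ^ p.1))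
  have hm : S.HasMoments M L := ⟨fun l m => h1 (Sum.inl (l, m)), fun l m => h1 (Sum.inr (l, m))⟩
  exact ⟨L, hm.isSupertrace h2, hm⟩

end DihedralOscillator

/-! ### Uniqueness: supertraces that vanish on rotations. -/

/-- An alternating function whose alternating antidifference exists on the cyclic group vanishes. -/
theorem eq_zero_of_alternating {n : ℕ} [NeZero n] {u w : ZMod n → ℂ} {c : ℂ} (hc : c ≠ 0)
    (hu : ∀ m, u m + u (m - 1) = 0) (hw : ∀ m, w m + w (m - 1) = c * u m) (m : ZMod n) : u m = 0 := by
  have h1 : ∀ j : ℕ, u (m + j) = (-1) ^ j * u m := by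
    intro j
    induction j with
    | zero => simp
    | succ j ih =>
      have := hu (m + (j + 1 : ℕ))
      rw [show m + ((j + 1 : ℕ) : ZMod n) - 1 = m + j by push_cast; ring, ih] at this
      rw [pow_succ]
      linear_combination this
  have h2 : ∀ j : ℕ, w (m + j) = (-1) ^ j * (w m + j * (c * u m)) := by
    intro j
    induction j with
    | zero => simp
    | succ j ih =>
      have := hw (m + (j + 1 : ℕ))
      rw [show m + ((j + 1 : ℕ) : ZMod n) - 1 = m + j by push_cast; ring, ih, h1] at this
      rw [pow_succ] at *
      push_cast at *
      linear_combination this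
  -- After 2n steps `w` is back at its start but has drifted by 2n c u(m), so u(m) must be zero.
  have h3 := h2 (2 * n)
  rw [(even_two_mul n).neg_one_pow] at h3
  have h4 : ((2 * n : ℕ) : ZMod n) = 0 := by simp
  rw [h4, add_zero, one_mul, left_eq_add, mul_eq_zero, mul_eq_zero] at h3
  exact (h3.resolve_left (period_ne_zero n)).resolve_left hc

namespace DihedralOscillator

variable {n : ℕ} [NeZero n] {A : Type*} [Ring A] [Algebra ℂ A] (S : DihedralOscillator n A)

/-- `J` is the mean of `Jp` and `Jm`, and an even power of one is the same power of the other. -/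
theorem J_comm_even (i : ℕ) : S.J * S.Jp ^ (2 * i) = S.Jp ^ (2 * i) * S.J := by
  have h1 : Commute S.Jp (S.Jp ^ (2 * i)) := Commute.self_pow _ _
  have h2 : Commute S.Jm (S.Jp ^ (2 * i)) := by rw [Jp_even]; exact Commute.self_pow _ _
  have h : S.J = (1 / 2 : ℂ) • (S.Jp + S.Jm) := by rw [Jp, Jm]; module
  rw [h]
  exact ((h1.add_left h2).smul_left _)

theorem ε_r_J (m : ZMod n) : S.ε m * S.r * S.J = -(S.J * (S.ε m * S.r)) := by
  rw [mul_assoc, r_J, mul_neg, ← mul_assoc, ε_J, mul_assoc]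

namespace IsSupertrace

variable {S} {L : A →ₗ[ℂ] ℂ} (hL : S.IsSupertrace L)

/-- `J` commutes with even powers of `Jp` and anticommutes with reflections, so cyclicity makes the
value equal to its own negative. -/
theorem even_step (i : ℕ) (m : ZMod n) (l : ℕ) (hJ : ∀ x ∈ S.inv, L (S.J * x) = L (x * S.J)) :
    L (S.J ^ (l + 1) * (S.Jp ^ (2 * i) * (S.ε m * S.r))) = 0 := by
  have hmem : S.J ^ l * (S.Jp ^ (2 * i) * (S.ε m * S.r)) ∈ S.inv :=
    S.pow_mul_mem (fun X => S.J_mul_mem) l (S.Jp_pow_mem _ _)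
  have h := hJ _ hmem
  have e : S.J ^ l * (S.Jp ^ (2 * i) * (S.ε m * S.r)) * S.J =
      -(S.J ^ (l + 1) * (S.Jp ^ (2 * i) * (S.ε m * S.r))) := by
    rw [mul_assoc, mul_assoc, ε_r_J, mul_neg, mul_neg, ← mul_assoc (S.Jp ^ (2 * i)) S.J, ← J_comm_even,
      mul_assoc S.J, ← mul_assoc (S.J ^ l), ← pow_succ]
  rw [e, ← mul_assoc S.J, ← pow_succ', map_neg] at h
  have h2 : (2 : ℂ) * L (S.J ^ (l + 1) * (S.Jp ^ (2 * i) * (S.ε m * S.r))) = 0 := by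
    linear_combination h
  exact (mul_eq_zero.1 h2).resolve_left two_ne_zero

include hL

/-- `raise` at `ε (m - 1) * r` expresses 2 L(ε m r) through a term with `J`, which is zero by
`even_step`, and through γ m (L(ε m) + L(ε (m - 1))). -/
theorem reflection_zero (hJ : ∀ x ∈ S.inv, L (S.J * x) = L (x * S.J))
    (h0 : ∀ m, L (S.ε m) + L (S.ε (m - 1)) = 0) (m : ZMod n) : L (S.ε m * S.r) = 0 := by
  have h1 := hL.raise _ (S.Jp_pow_mem 0 (m - 1))
  rw [mul_assoc, mul_assoc S.z, Jp_pow_ε_r_mul_z, Jp_pow_ε_r_mul_D, ← map_sub] at h1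
  simp only [pow_zero, one_mul, sub_add_cancel] at h1
  have e1 : S.D * -(S.zb * (S.ε m * S.r)) - S.z * -(S.Db * (S.ε m * S.r)) =
      (S.J + S.J) * (S.ε m * S.r) - S.ρ 0 * (S.ε m * S.r) - (2 : ℂ) • (S.ε m * S.r) := by
    rw [two_smul]
    linear_combination (norm := noncomm_ring) -(S.D_zb * (S.ε m * S.r)) -
      S.J_double * (S.ε m * S.r)
  have e2 : L ((S.J + S.J) * (S.ε m * S.r)) = 0 := by
    have := even_step (S := S) (L := L) 0 m 0 hJ
    simp only [zero_add, pow_one, mul_zero, pow_zero, one_mul] at this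
    rw [add_mul, map_add, this, add_zero]
  have e3 : L (S.ρ 1 * (S.ε (m - 1) * S.r)) = S.γ m * L (S.ε (m - 1)) := by
    have h2 := hL.r_comm _ (S.r_mul_mem (S.ε_mem (m - 1)))
    rw [r_mul_r_mul, S.r_mul_ε, mul_assoc, S.r_mul_r, mul_one] at h2
    rw [← mul_assoc, S.ρ_ε, smul_mul_assoc, mul_assoc, S.r_mul_r, mul_one, map_smul, sub_add_cancel, ← h2,
      smul_eq_mul]
  rw [e1, map_sub, map_sub, e2, ρ_zero_mul_ε_mul_r, map_smul, map_smul, e3, smul_eq_mul, smul_eq_mul] at h1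
  have h2 : (2 : ℂ) * L (S.ε m * S.r) = 0 := by
    linear_combination -h1 - S.γ m * h0 m
  exact (mul_eq_zero.1 h2).resolve_left two_ne_zero

omit hL in
theorem Jp_ε_of_lt {l : ℕ} (h : ∀ i < l, ∀ m, L (S.Jp ^ i * (S.ε m * S.r)) = 0) {i : ℕ} (hi : i ≤ l)
    (m : ZMod n) : L (S.Jp ^ i * S.ε m) = L (S.Jm ^ i * S.ε m) := by
  rcases Nat.even_or_odd' i with ⟨j, rfl | rfl⟩
  · rw [Jp_even]
  · rw [Jp_odd, add_mul, map_add, mul_assoc (S.Jp ^ (2 * j)), ρ_zero_ε, mul_smul_comm, map_smul,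
      h (2 * j) (by omega), smul_zero, add_zero]

/-- With Jp = J + ρ 0 / 2, terms carrying an outer `J` are zero by `even_step`. In the others `ρ 0`
consumes degree and leaves values already known to vanish. Degree zero is `reflection_zero`. -/
theorem reflection_step (hJ : ∀ x ∈ S.inv, L (S.J * x) = L (x * S.J)) {l : ℕ}
    (h1 : ∀ i < l, ∀ m, L (S.Jm ^ i * S.ε m) = 0)
    (h2 : ∀ i < l, ∀ m, L (S.Jp ^ i * (S.ε m * S.r)) = 0)
    (h0 : l = 0 → ∀ m, L (S.ε m) + L (S.ε (m - 1)) = 0) (m : ZMod n) :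
    L (S.Jp ^ l * (S.ε m * S.r)) = 0 := by
  have hp : S.Jp = S.J + (1 / 2 : ℂ) • S.ρ 0 := rfl
  rcases Nat.even_or_odd' l with ⟨j, rfl | rfl⟩
  · cases j with
    | zero =>
      rw [mul_zero, pow_zero, one_mul]
      exact hL.reflection_zero hJ (h0 rfl) m
    | succ j =>
      have e : S.Jp ^ (2 * (j + 1)) * (S.ε m * S.r) = S.J ^ (1 + 1) * (S.Jp ^ (2 * j) * (S.ε m * S.r)) +
          (1 / 4 : ℂ) • (S.Jp ^ (2 * j) * (S.ρ 0 * (S.ρ 0 * (S.ε m * S.r)))) := by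
        -- The cross terms cancel because `ρ 0` anticommutes with `J`.
        have e1 : S.Jp * S.Jp = S.J * S.J + (1 / 4 : ℂ) • (S.ρ 0 * S.ρ 0) := by
          have := S.ρ_J 0
          rw [hp, add_mul, mul_add, mul_add, smul_mul_assoc, this, mul_smul_comm, smul_mul_assoc,
            mul_smul_comm, smul_smul]
          module
        have e2 : S.J * S.J * S.Jp ^ (2 * j) = S.Jp ^ (2 * j) * (S.J * S.J) := by
          rw [mul_assoc, J_comm_even, ← mul_assoc, J_comm_even, mul_assoc]
        rw [mul_add, mul_one, pow_add, pow_two S.Jp, e1, mul_add, add_mul, ← e2, pow_two,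
          mul_smul_comm, smul_mul_assoc]
        simp only [mul_assoc]
      rw [e, map_add, even_step j m 1 hJ, ρ_zero_mul_ε_mul_r, mul_smul_comm, mul_smul_comm, ρ_zero_ε,
        mul_smul_comm]
      simp [h2 (2 * j) (by omega)]
  · have e : S.Jp ^ (2 * j + 1) * (S.ε m * S.r) = S.J ^ (0 + 1) * (S.Jp ^ (2 * j) * (S.ε m * S.r)) +
        (1 / 2 : ℂ) • (S.Jp ^ (2 * j) * (S.ρ 0 * (S.ε m * S.r))) := by
      rw [zero_add, pow_one, pow_succ, ← mul_assoc S.J, J_comm_even]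
      conv_lhs => rw [mul_assoc, hp, add_mul, mul_add, smul_mul_assoc, mul_smul_comm, ← hp, ← mul_assoc]
    rw [e, map_add, even_step j m 0 hJ, ρ_zero_mul_ε_mul_r, mul_smul_comm, Jp_even]
    simp [h1 (2 * j) (by omega)]

theorem lower_pow (l : ℕ) (m : ZMod n) : L (S.Jm ^ (l + 1) * S.ε m) - L (S.Jm ^ l * S.ε m) +
    L ((S.Jp + 1) ^ (l + 1) * S.ε (m - 1)) = 0 := by
  have h := hL.lower _ (S.Jm_pow_mem l m)
  rw [mul_assoc S.Db, mul_assoc S.zb, Jm_pow_ε_mul_z, Jm_pow_ε_mul_D, ← map_sub, sub_mul, one_mul,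
    ← mul_assoc S.Jm, ← pow_succ', map_sub] at h
  set w := (S.Jp + 1) ^ l * S.ε (m - 1) with hw
  have e : S.Db * (S.z * w) - S.zb * (S.D * w) = (S.Jp + 1) * w + (S.Jp + 1) * w := by
    linear_combination (norm := noncomm_ring) S.Db_z * w - S.Jp_double' * w
  rw [e, map_add, hw, ← mul_assoc, ← pow_succ'] at h
  linear_combination h / 2

/-- Induction on the degree l: everything of lower degree vanishes, and the rotation values of
degree l alternate in m. The values of degree l + 1 supply an alternating antidifference of them, so
they vanish by `eq_zero_of_alternating`, and alternation passes to degree l + 1. -/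
theorem eq_zero_of_rotations (hJ : ∀ x ∈ S.inv, L (S.J * x) = L (x * S.J))
    (h0 : ∀ m, L (S.ε m) + L (S.ε (m - 1)) = 0) {x : A} (hx : x ∈ S.inv) : L x = 0 := by
  have key : ∀ l : ℕ, ((∀ i < l, ∀ m, L (S.Jm ^ i * S.ε m) = 0) ∧
      ∀ i < l, ∀ m, L (S.Jp ^ i * (S.ε m * S.r)) = 0) ∧
      ∀ m, L (S.Jm ^ l * S.ε m) + L (S.Jm ^ l * S.ε (m - 1)) = 0 := by
    intro l
    induction l with
    | zero => exact ⟨⟨by simp, by simp⟩, by simpa using h0⟩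
    | succ l ih =>
      obtain ⟨⟨h1, h2⟩, h3⟩ := ih
      have hR := hL.reflection_step hJ h1 h2 (fun hl m => by subst hl; simpa using h3 m)
      have h2' : ∀ i < l + 1, ∀ m, L (S.Jp ^ i * (S.ε m * S.r)) = 0 := fun i hi m => by
        rcases (Nat.lt_succ_iff.1 hi).eq_or_lt with rfl | hi
        · exact hR m
        · exact h2 i hi m
      -- In the expansion of (Jp + 1)^(l+1) only degrees l + 1 and l survive. The factor l + 2 is 1
      -- from the middle term of `lower_pow` plus l + 1 from the binomial coefficient, after
      -- alternation turns index m - 1 into m.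
      have hw : ∀ m, L (S.Jm ^ (l + 1) * S.ε m) + L (S.Jm ^ (l + 1) * S.ε (m - 1)) =
          ((l : ℂ) + 2) * L (S.Jm ^ l * S.ε m) := by
        intro m
        have h4 := hL.lower_pow l m
        have h5 : L ((S.Jp + 1) ^ (l + 1) * S.ε (m - 1)) = L (S.Jm ^ (l + 1) * S.ε (m - 1)) +
            ((l : ℂ) + 1) * L (S.Jm ^ l * S.ε (m - 1)) := by
          rw [(Commute.one_right S.Jp).add_pow, Finset.sum_mul, map_sum, Finset.sum_range_succ,
            Finset.sum_range_succ, Finset.sum_eq_zero]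
          · rw [← Jp_ε_of_lt h2' le_rfl, ← Jp_ε_of_lt h2' l.le_succ]
            simp only [one_pow, mul_one, Nat.choose_self, Nat.cast_one, Nat.choose_succ_self_right]
            have : S.Jp ^ l * ((l + 1 : ℕ) : A) * S.ε (m - 1) =
                ((l : ℂ) + 1) • (S.Jp ^ l * S.ε (m - 1)) := by
              rw [← Nat.cast_comm, mul_assoc, ← nsmul_eq_mul, ← Nat.cast_smul_eq_nsmul ℂ]
              push_cast
              rfl
            rw [this, map_smul, smul_eq_mul]
            ring
          · intro i hi
            have hi := Finset.mem_range.1 hi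
            rw [one_pow, mul_one, ← Nat.cast_comm, mul_assoc, ← nsmul_eq_mul, map_nsmul,
              Jp_ε_of_lt h2 hi.le, h1 i hi, smul_zero]
        linear_combination h4 - h5 - ((l : ℂ) + 1) * h3 m
      have hl2 : (l : ℂ) + 2 ≠ 0 := by exact_mod_cast (by omega : l + 2 ≠ 0)
      have hu : ∀ m, L (S.Jm ^ l * S.ε m) = 0 := eq_zero_of_alternating hl2 h3 hw
      refine ⟨⟨fun i hi m => ?_, h2'⟩, fun m => by rw [hw, hu, mul_zero]⟩
      rcases (Nat.lt_succ_iff.1 hi).eq_or_lt with rfl | hi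
      · exact hu m
      · exact h1 i hi m
  exact S.inv_le (P := LinearMap.ker L) (fun l m => (key (l + 1)).1.1 l l.lt_succ_self m)
    (fun l m => (key (l + 1)).1.2 l l.lt_succ_self m) hx

end IsSupertrace

end DihedralOscillator

/-! ### Commutation rules for divided differences, reflections and derivatives. -/

namespace Calogero

section Points

/-- The divided difference of `f` along the unit vector `v`, as in `divDiffFun`. -/
def dividedDiff (v : ℂ) (f : ℂ → ℂ) (z : ℂ) : ℂ :=
  if z * starRingEnd ℂ v + starRingEnd ℂ z * v = 0 then fderiv ℝ f z v
  else (f z - f (-(starRingEnd ℂ z * v ^ 2))) / (z * starRingEnd ℂ v + starRingEnd ℂ z * v)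

theorem dividedDiff_neg (v : ℂ) (f : ℂ → ℂ) (z : ℂ) : dividedDiff (-v) f z = -dividedDiff v f z := by
  have h : z * -starRingEnd ℂ v + starRingEnd ℂ z * -v =
      -(z * starRingEnd ℂ v + starRingEnd ℂ z * v) := by ring
  simp only [dividedDiff, map_neg, h, neg_eq_zero, neg_sq, div_neg]
  split_ifs <;> rfl

/-- A root and its negative give the same product, so it depends only on the square of the root.
This permits indexing by `ZMod n` instead of by 2n roots. -/
theorem mul_dividedDiff_congr {v w : ℂ} (h : v ^ 2 = w ^ 2) (f : ℂ → ℂ) (z : ℂ) :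
    v * dividedDiff v f z = w * dividedDiff w f z := by
  rcases sq_eq_sq_iff_eq_or_eq_neg.1 h with rfl | rfl
  · rfl
  · rw [dividedDiff_neg, neg_mul_neg]

theorem fderiv_comp_reflection {f : ℂ → ℂ} (hf : Differentiable ℝ f) (a z w : ℂ) :
    fderiv ℝ (fun z => f (-(starRingEnd ℂ z * a))) z w =
      fderiv ℝ f (-(starRingEnd ℂ z * a)) (-(starRingEnd ℂ w * a)) := by
  have h1 : HasFDerivAt (fun z : ℂ => -(starRingEnd ℂ z * a))
      (-((ContinuousLinearMap.mul ℝ ℂ).flip a ∘L Complex.conjCLE.toContinuousLinearMap)) z :=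
    ContinuousLinearMap.hasFDerivAt
      (-((ContinuousLinearMap.mul ℝ ℂ).flip a ∘L Complex.conjCLE.toContinuousLinearMap))
  have h2 := (hf _).hasFDerivAt.comp z h1
  have h3 : fderiv ℝ (fun z => f (-(starRingEnd ℂ z * a))) z = _ := h2.fderiv
  rw [h3]
  simp [mul_comm]

/-- The reflection given by `a` maps the root `v` to `-(a * conj v)`; this root is used without its
sign, which appears in front. -/
theorem dividedDiff_reflection {f : ℂ → ℂ} (hf : Differentiable ℝ f) {v a : ℂ}
    (ha : a * starRingEnd ℂ a = 1) (z : ℂ) :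
    dividedDiff v f (-(starRingEnd ℂ z * a)) =
      -dividedDiff (a * starRingEnd ℂ v) (fun z => f (-(starRingEnd ℂ z * a))) z := by
  have h : -(starRingEnd ℂ z * a) * starRingEnd ℂ v + starRingEnd ℂ (-(starRingEnd ℂ z * a)) * v =
      -(z * starRingEnd ℂ (a * starRingEnd ℂ v) + starRingEnd ℂ z * (a * starRingEnd ℂ v)) := by
    simp only [map_neg, map_mul, Complex.conj_conj]; ring
  have h1 : -(starRingEnd ℂ (-(starRingEnd ℂ z * a)) * v ^ 2) =
      -(starRingEnd ℂ (-(starRingEnd ℂ z * (a * starRingEnd ℂ v) ^ 2)) * a) := by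
    simp only [map_neg, map_mul, map_pow, Complex.conj_conj]
    linear_combination -(z * v ^ 2 * starRingEnd ℂ a) * ha
  have h2 : -(starRingEnd ℂ (a * starRingEnd ℂ v) * a) = -v := by
    simp only [map_mul, Complex.conj_conj]
    linear_combination -v * ha
  simp only [dividedDiff, h, neg_eq_zero, h1, fderiv_comp_reflection hf, h2]
  split_ifs
  · simp
  · rw [div_neg]

theorem dividedDiff_mul_id {f : ℂ → ℂ} (hf : Differentiable ℝ f) {v : ℂ}
    (hv : v * starRingEnd ℂ v = 1) (z : ℂ) :
    dividedDiff v (fun z => z * f z) z = z * dividedDiff v f z + v * f (-(starRingEnd ℂ z * v ^ 2)) := by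
  simp only [dividedDiff]
  split_ifs with h
  · have h1 := (hasFDerivAt_id (𝕜 := ℝ) z).mul (hf z).hasFDerivAt
    have h2 : fderiv ℝ (fun z => z * f z) z = _ := h1.fderiv
    -- On the mirror the reflected point is the point itself, so the twisted Leibniz rule becomes
    -- the ordinary one.
    have h3 : -(starRingEnd ℂ z * v ^ 2) = z := by linear_combination -v * h + z * hv
    rw [h2, h3]
    simp
    ring
  · field_simp
    linear_combination (-f (-(starRingEnd ℂ z * v ^ 2)) * z) * hv

theorem dividedDiff_mul_conj {f : ℂ → ℂ} (hf : Differentiable ℝ f) {v : ℂ}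
    (hv : v * starRingEnd ℂ v = 1) (z : ℂ) :
    dividedDiff v (fun z => starRingEnd ℂ z * f z) z =
      starRingEnd ℂ z * dividedDiff v f z + starRingEnd ℂ v * f (-(starRingEnd ℂ z * v ^ 2)) := by
  simp only [dividedDiff]
  split_ifs with h
  · have h1 := (Complex.conjCLE.toContinuousLinearMap.hasFDerivAt (x := z)).mul (hf z).hasFDerivAt
    have h2 : fderiv ℝ (fun z => starRingEnd ℂ z * f z) z = _ := h1.fderiv
    have h3 : -(starRingEnd ℂ z * v ^ 2) = z := by linear_combination -v * h + z * hv
    rw [h2, h3]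
    simp
    ring
  · simp only [map_neg, map_mul, map_pow, Complex.conj_conj]
    field_simp
    linear_combination (-starRingEnd ℂ z * f (-(starRingEnd ℂ z * v ^ 2))) * hv

end Points

variable {n : ℕ} [NeZero n]

theorem root_sq (k : ℕ) : root n k ^ 2 = ZMod.stdAddChar (k : ZMod n) := by
  have := ZMod.stdAddChar_coe (N := n) (k : ℤ)
  push_cast at this
  rw [this, root, ← Complex.exp_nat_mul]
  congr 1
  push_cast
  ring

theorem conj_stdAddChar (c : ZMod n) :
    starRingEnd ℂ (ZMod.stdAddChar c) = ZMod.stdAddChar (-c) := by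
  rw [AddChar.map_neg_eq_conj]

theorem stdAddChar_mul_neg (c : ZMod n) :
    (ZMod.stdAddChar c : ℂ) * ZMod.stdAddChar (-c) = 1 := by
  rw [← AddChar.map_add_eq_mul, add_neg_cancel, AddChar.map_zero_eq_one]

/-- The operators of the reflections, indexed by `ZMod n`. -/
def reflCyc (c : ZMod n) : Module.End ℂ FunSpace where
  toFun f := ⟨fun z => f (-(starRingEnd ℂ z * ZMod.stdAddChar c)),
    f.temperate.comp ((temperate_conj.fun_mul (.const _)).fun_neg)⟩
  map_add' _ _ := rfl
  map_smul' _ _ := rfl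

/-- The operators of the rotations, indexed by `ZMod n`. -/
def rotCyc (c : ZMod n) : Module.End ℂ FunSpace where
  toFun f := ⟨fun z => f (z * ZMod.stdAddChar (-c)),
    f.temperate.comp (Function.HasTemperateGrowth.id'.fun_mul (.const _))⟩
  map_add' _ _ := rfl
  map_smul' _ _ := rfl

/-- The operators `v_k (z v_k^* + z^* v_k)⁻¹ (1 - R_k)`, indexed by `ZMod n`. -/
def diffCyc (c : ZMod n) : Module.End ℂ FunSpace := root n c.val • divDiff n c.val

theorem reflCyc_apply (c : ZMod n) (f : FunSpace) (z : ℂ) :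
    reflCyc c f z = f (-(starRingEnd ℂ z * ZMod.stdAddChar c)) := rfl

theorem rotCyc_apply (c : ZMod n) (f : FunSpace) (z : ℂ) :
    rotCyc c f z = f (z * ZMod.stdAddChar (-c)) := rfl

theorem reflOp_eq (k : ℕ) : reflOp n k = reflCyc (k : ZMod n) := by
  ext f z
  change f (reflect n k z) = _
  rw [reflect, root_sq, reflCyc_apply]

theorem diffCyc_apply {c : ZMod n} {v : ℂ} (hv : v ^ 2 = ZMod.stdAddChar c) (f : FunSpace) (z : ℂ) :
    diffCyc c f z = v * dividedDiff v f z := by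
  change root n c.val * dividedDiff (root n c.val) f z = _
  refine mul_dividedDiff_congr ?_ f z
  rw [root_sq, ZMod.natCast_zmod_val, hv]

theorem root_smul_divDiff (k : ℕ) : root n k • divDiff n k = diffCyc (k : ZMod n) := by
  ext f z
  rw [diffCyc_apply (root_sq k)]
  rfl

theorem conj_root_smul_divDiff (k : ℕ) : starRingEnd ℂ (root n k) • divDiff n k =
    ZMod.stdAddChar (-(k : ZMod n)) • diffCyc (k : ZMod n) := by
  rw [← root_smul_divDiff, smul_smul, ← conj_stdAddChar, ← root_sq, map_pow]
  congr 1
  linear_combination -(starRingEnd ℂ (root n k)) * root_mul_conj n k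

theorem root_val_sq (c : ZMod n) : root n c.val ^ 2 = ZMod.stdAddChar c := by
  rw [root_sq, ZMod.natCast_zmod_val]

theorem rotCyc_mul_reflCyc (a c : ZMod n) : rotCyc a * reflCyc c = reflCyc (a + c) := by
  ext f z
  change f (-(starRingEnd ℂ (z * ZMod.stdAddChar (-a)) * ZMod.stdAddChar c)) = _
  rw [reflCyc_apply, map_mul, conj_stdAddChar, neg_neg, mul_assoc, ← AddChar.map_add_eq_mul]

theorem reflCyc_mul_rotCyc (a c : ZMod n) : reflCyc c * rotCyc a = reflCyc (c - a) := by
  ext f z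
  change f (-(starRingEnd ℂ z * ZMod.stdAddChar c) * ZMod.stdAddChar (-a)) = _
  rw [reflCyc_apply, neg_mul, mul_assoc, ← AddChar.map_add_eq_mul, sub_eq_add_neg]

theorem reflCyc_mul_reflCyc (a c : ZMod n) : reflCyc a * reflCyc c = rotCyc (a - c) := by
  ext f z
  change f (-(starRingEnd ℂ (-(starRingEnd ℂ z * ZMod.stdAddChar a)) * ZMod.stdAddChar c)) = _
  rw [rotCyc_apply, map_neg, map_mul, conj_stdAddChar, Complex.conj_conj, neg_mul, neg_neg, mul_assoc,
    ← AddChar.map_add_eq_mul, neg_sub, neg_add_eq_sub]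

theorem rotCyc_mul_rotCyc (a c : ZMod n) : rotCyc a * rotCyc c = rotCyc (a + c) := by
  ext f z
  change f (z * ZMod.stdAddChar (-a) * ZMod.stdAddChar (-c)) = _
  rw [rotCyc_apply, mul_assoc, ← AddChar.map_add_eq_mul, neg_add]

theorem rotCyc_zero : rotCyc (0 : ZMod n) = 1 := by
  ext f z
  simp [rotCyc_apply]

theorem reflCyc_mul_mulZ (a : ZMod n) : reflCyc a * mulZ =
    -(ZMod.stdAddChar a • (mulZbar * reflCyc a)) := by
  ext f z
  change -(starRingEnd ℂ z * ZMod.stdAddChar a) * f _ =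
    -((ZMod.stdAddChar a : ℂ) * (starRingEnd ℂ z * f _))
  ring

theorem reflCyc_mul_mulZbar (a : ZMod n) : reflCyc a * mulZbar =
    -(ZMod.stdAddChar (-a) • (mulZ * reflCyc a)) := by
  ext f z
  change starRingEnd ℂ (-(starRingEnd ℂ z * ZMod.stdAddChar a)) * f _ =
    -((ZMod.stdAddChar (-a) : ℂ) * (z * f _))
  rw [map_neg, map_mul, conj_stdAddChar, Complex.conj_conj]
  ring

theorem reflCyc_mul_diffCyc (a c : ZMod n) : reflCyc a * diffCyc c =
    -(ZMod.stdAddChar (c - a) • (diffCyc (2 * a - c) * reflCyc a)) := by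
  ext f z
  have hv := root_val_sq c
  set v := root n c.val with hv'
  have hv1 : v * starRingEnd ℂ v = 1 := root_mul_conj n c.val
  have hl : (ZMod.stdAddChar a * starRingEnd ℂ v) ^ 2 = ZMod.stdAddChar (2 * a - c) := by
    rw [mul_pow, ← map_pow (starRingEnd ℂ), hv, conj_stdAddChar, pow_two, ← AddChar.map_add_eq_mul,
      ← AddChar.map_add_eq_mul]
    congr 1
    ring
  change diffCyc c f (-(starRingEnd ℂ z * ZMod.stdAddChar a)) =
    -((ZMod.stdAddChar (c - a) : ℂ) * diffCyc (2 * a - c) (reflCyc a f) z)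
  rw [diffCyc_apply hv, diffCyc_apply hl, dividedDiff_reflection f.differentiable
    (by rw [conj_stdAddChar, stdAddChar_mul_neg]), sub_eq_add_neg, AddChar.map_add_eq_mul, ← hv]
  have e : (fun z => f (-(starRingEnd ℂ z * ZMod.stdAddChar a))) = ⇑(reflCyc a f) := rfl
  rw [e]
  set X := dividedDiff (ZMod.stdAddChar a * starRingEnd ℂ v) (reflCyc a f) z
  linear_combination (v * X * (v * starRingEnd ℂ v)) * (stdAddChar_mul_neg a) + v * X * hv1

theorem diffCyc_mul_mulZ (c : ZMod n) : diffCyc c * mulZ =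
    mulZ * diffCyc c + ZMod.stdAddChar c • reflCyc c := by
  ext f z
  change diffCyc c (mulZ f) z = z * diffCyc c f z + ZMod.stdAddChar c * reflCyc c f z
  rw [diffCyc_apply (root_val_sq c), diffCyc_apply (root_val_sq c), reflCyc_apply, ← root_val_sq]
  have := dividedDiff_mul_id f.differentiable (root_mul_conj n c.val) z
  change dividedDiff (root n c.val) (mulZ f) z = _ at this
  rw [this]
  ring

theorem diffCyc_mul_mulZbar (c : ZMod n) : diffCyc c * mulZbar =
    mulZbar * diffCyc c + reflCyc c := by
  ext f z
  change diffCyc c (mulZbar f) z = starRingEnd ℂ z * diffCyc c f z + reflCyc c f z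
  rw [diffCyc_apply (root_val_sq c), diffCyc_apply (root_val_sq c), reflCyc_apply, ← root_val_sq]
  have := dividedDiff_mul_conj f.differentiable (root_mul_conj n c.val) z
  change dividedDiff (root n c.val) (mulZbar f) z = _ at this
  rw [this]
  linear_combination f (-(starRingEnd ℂ z * root n c.val ^ 2)) * root_mul_conj n c.val

theorem dirDeriv_mul_mulZ (w : ℂ) : dirDeriv w * mulZ = mulZ * dirDeriv w + w • 1 := by
  ext f z
  have h1 := (hasFDerivAt_id (𝕜 := ℝ) z).mul (f.differentiable z).hasFDerivAt
  have h2 : fderiv ℝ (mulZ f) z = _ := h1.fderiv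
  change fderiv ℝ (mulZ f) z w = z * fderiv ℝ f z w + w * f z
  rw [h2]
  simp [mul_comm]

theorem dirDeriv_mul_mulZbar (w : ℂ) :
    dirDeriv w * mulZbar = mulZbar * dirDeriv w + starRingEnd ℂ w • 1 := by
  ext f z
  have h1 := (Complex.conjCLE.toContinuousLinearMap.hasFDerivAt (x := z)).mul
    (f.differentiable z).hasFDerivAt
  have h2 : fderiv ℝ (mulZbar f) z = _ := h1.fderiv
  change fderiv ℝ (mulZbar f) z w = starRingEnd ℂ z * fderiv ℝ f z w + starRingEnd ℂ w * f z
  rw [h2]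
  simp [mul_comm]

theorem twoDz_mul_mulZ : twoDz * mulZ = mulZ * twoDz + 2 := by
  have h : (2 : Module.End ℂ FunSpace) = (2 : ℂ) • 1 := by rw [two_smul, one_add_one_eq_two]
  have hI : Complex.I * Complex.I = -1 := Complex.I_mul_I
  simp only [twoDz, sub_mul, mul_sub, smul_mul_assoc, mul_smul_comm, dirDeriv_mul_mulZ, smul_add,
    smul_smul, hI, h]
  module

theorem twoDz_mul_mulZbar : twoDz * mulZbar = mulZbar * twoDz := by
  simp only [twoDz, sub_mul, mul_sub, smul_mul_assoc, mul_smul_comm, dirDeriv_mul_mulZbar, smul_add,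
    smul_smul, Complex.conj_I, map_one, mul_neg, Complex.I_mul_I]
  module

theorem twoDzbar_mul_mulZ : twoDzbar * mulZ = mulZ * twoDzbar := by
  simp only [twoDzbar, add_mul, mul_add, smul_mul_assoc, mul_smul_comm, dirDeriv_mul_mulZ, smul_add,
    smul_smul, Complex.I_mul_I]
  module

theorem twoDzbar_mul_mulZbar : twoDzbar * mulZbar = mulZbar * twoDzbar + 2 := by
  have h : (2 : Module.End ℂ FunSpace) = (2 : ℂ) • 1 := by rw [two_smul, one_add_one_eq_two]
  simp only [twoDzbar, add_mul, mul_add, smul_mul_assoc, mul_smul_comm, dirDeriv_mul_mulZbar, smul_add,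
    smul_smul, Complex.conj_I, map_one, mul_neg, Complex.I_mul_I, h]
  module

theorem fderiv_eq_twoDz (f : FunSpace) (z w : ℂ) :
    fderiv ℝ f z w = w / 2 * twoDz f z + starRingEnd ℂ w / 2 * twoDzbar f z := by
  have h1 : twoDz f z = fderiv ℝ f z 1 - Complex.I * fderiv ℝ f z Complex.I := rfl
  have h2 : twoDzbar f z = fderiv ℝ f z 1 + Complex.I * fderiv ℝ f z Complex.I := rfl
  obtain ⟨x, y, rfl⟩ : ∃ x y : ℝ, w = x + y * Complex.I := ⟨w.re, w.im, (Complex.re_add_im w).symm⟩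
  have h3 : (x + y * Complex.I : ℂ) = x • (1 : ℂ) + y • Complex.I := by simp
  conv_lhs => rw [h3]
  rw [h1, h2, map_add, map_smul, map_smul, Complex.real_smul, Complex.real_smul]
  simp only [map_add, map_mul, Complex.conj_ofReal, Complex.conj_I]
  linear_combination (y * fderiv ℝ f z Complex.I : ℂ) * Complex.I_mul_I

theorem twoDz_reflCyc_apply (a : ZMod n) (f : FunSpace) (z w : ℂ) :
    fderiv ℝ (reflCyc a f) z w = -(starRingEnd ℂ w / 2 * ZMod.stdAddChar a) *
      (reflCyc a (twoDz f)) z - w / 2 * ZMod.stdAddChar (-a) * (reflCyc a (twoDzbar f)) z := by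
  have h := fderiv_comp_reflection f.differentiable (ZMod.stdAddChar a) z w
  change fderiv ℝ (reflCyc a f) z w = _ at h
  rw [h, fderiv_eq_twoDz, map_neg, map_mul, conj_stdAddChar, Complex.conj_conj]
  simp only [reflCyc_apply]
  ring

theorem reflCyc_mul_twoDz (a : ZMod n) : reflCyc a * twoDz =
    -(ZMod.stdAddChar (-a) • (twoDzbar * reflCyc a)) := by
  ext f z
  change reflCyc a (twoDz f) z = -(ZMod.stdAddChar (-a) *
    (fderiv ℝ (reflCyc a f) z 1 + Complex.I * fderiv ℝ (reflCyc a f) z Complex.I))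
  rw [twoDz_reflCyc_apply, twoDz_reflCyc_apply, map_one, Complex.conj_I]
  have h := stdAddChar_mul_neg a
  generalize (reflCyc a (twoDzbar f)) z = Y
  generalize (reflCyc a (twoDz f)) z = X
  linear_combination -X * h + ((ZMod.stdAddChar (-a) * X * ZMod.stdAddChar a / 2 : ℂ) -
    ZMod.stdAddChar (-a) * ZMod.stdAddChar (-a) * Y / 2) * Complex.I_mul_I

theorem reflCyc_mul_twoDzbar (a : ZMod n) : reflCyc a * twoDzbar =
    -(ZMod.stdAddChar a • (twoDz * reflCyc a)) := by
  ext f z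
  change reflCyc a (twoDzbar f) z = -(ZMod.stdAddChar a *
    (fderiv ℝ (reflCyc a f) z 1 - Complex.I * fderiv ℝ (reflCyc a f) z Complex.I))
  rw [twoDz_reflCyc_apply, twoDz_reflCyc_apply, map_one, Complex.conj_I]
  have h := stdAddChar_mul_neg a
  generalize (reflCyc a (twoDzbar f)) z = Y
  generalize (reflCyc a (twoDz f)) z = X
  linear_combination -Y * h + ((ZMod.stdAddChar (-a) * Y * ZMod.stdAddChar a / 2 : ℂ) -
    ZMod.stdAddChar a * ZMod.stdAddChar a * X / 2) * Complex.I_mul_I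

end Calogero

/-! ### The Dunkl operators and their commutativity. -/

namespace Calogero

variable {n : ℕ} [NeZero n]

theorem sum_range_eq_sum_zmod {M : Type*} [AddCommMonoid M] (F : ZMod n → M) :
    ∑ k ∈ Finset.range n, F (k : ZMod n) = ∑ k, F k := by
  refine Finset.sum_nbij' (fun k => (k : ZMod n)) ZMod.val (by simp) ?_ ?_ (by simp) (by simp)
  · intro k _
    exact Finset.mem_range.2 (ZMod.val_lt k)
  · intro k hk
    exact ZMod.val_cast_of_lt (Finset.mem_range.1 hk)

/-- The total coupling constant of the reflection with index `c`. -/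
def weight (ν₀ ν₁ : ℂ) (c : ZMod n) : ℂ :=
  ∑ k : ZMod n, ((if 2 * k = c then ν₀ else 0) + if 2 * k + 1 = c then ν₁ else 0)

variable (ν₀ ν₁ : ℂ)

theorem sum_weight_smul {M : Type*} [AddCommGroup M] [Module ℂ M] (F : ZMod n → M) :
    ∑ c, weight ν₀ ν₁ c • F c =
      ν₀ • ∑ k ∈ Finset.range n, F ((2 * k : ℕ) : ZMod n) +
        ν₁ • ∑ k ∈ Finset.range n, F ((2 * k + 1 : ℕ) : ZMod n) := by
  push_cast
  rw [sum_range_eq_sum_zmod fun k => F (2 * k), sum_range_eq_sum_zmod fun k => F (2 * k + 1)]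
  simp only [weight, Finset.sum_smul]
  rw [Finset.sum_comm, Finset.smul_sum, Finset.smul_sum, ← Finset.sum_add_distrib]
  refine Finset.sum_congr rfl fun k _ => ?_
  simp only [add_smul, ite_smul, zero_smul, Finset.sum_add_distrib, Finset.sum_ite_eq,
    Finset.mem_univ, if_true]

/-- Reflections whose indices differ by an even amount are conjugate, and the total coupling is a
class function. -/
theorem weight_add_two_mul (c j : ZMod n) :
    weight ν₀ ν₁ (c + 2 * j) = weight ν₀ ν₁ c := by
  refine (Fintype.sum_equiv (Equiv.addRight j) _ _ fun k => ?_).symm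
  have h1 : 2 * (k + j) = c + 2 * j ↔ 2 * k = c := by rw [mul_add, add_left_inj]
  have h2 : 2 * (k + j) + 1 = c + 2 * j ↔ 2 * k + 1 = c := by
    rw [mul_add, add_right_comm, add_left_inj]
  simp only [Equiv.coe_addRight, h1, h2]

theorem weight_reflect (a c : ZMod n) : weight ν₀ ν₁ (2 * a - c) = weight ν₀ ν₁ c := by
  rw [← weight_add_two_mul ν₀ ν₁ c (a - c)]
  congr 1
  ring

theorem dunklZ_eq : dunklZ n ν₀ ν₁ = twoDzbar + ∑ c : ZMod n, weight ν₀ ν₁ c • diffCyc c := by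
  rw [sum_weight_smul ν₀ ν₁ (diffCyc (n := n)), dunklZ, add_assoc]
  simp only [root_smul_divDiff]

theorem dunklZbar_eq : dunklZbar n ν₀ ν₁ =
    twoDz + ∑ c : ZMod n, weight ν₀ ν₁ c • ((ZMod.stdAddChar (-c) : ℂ) • diffCyc c) := by
  rw [sum_weight_smul ν₀ ν₁ fun c : ZMod n => (ZMod.stdAddChar (-c) : ℂ) • diffCyc c, dunklZbar,
    add_assoc]
  simp only [conj_root_smul_divDiff]

/-- Weighted sums of reflections. -/
def reflSum (a : ZMod n) : Module.End ℂ FunSpace :=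
  ∑ c, weight ν₀ ν₁ c • ((ZMod.stdAddChar (c * a) : ℂ) • reflCyc c)

theorem dunklZ_mul_mulZ : dunklZ n ν₀ ν₁ * mulZ = mulZ * dunklZ n ν₀ ν₁ + reflSum ν₀ ν₁ (1 : ZMod n) := by
  simp only [dunklZ_eq, reflSum, add_mul, mul_add, Finset.sum_mul, Finset.mul_sum, smul_mul_assoc,
    mul_smul_comm, diffCyc_mul_mulZ, twoDzbar_mul_mulZ, smul_add, Finset.sum_add_distrib, mul_one,
    add_assoc]

theorem dunklZ_mul_mulZbar : dunklZ n ν₀ ν₁ * mulZbar =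
    mulZbar * dunklZ n ν₀ ν₁ + 2 + reflSum ν₀ ν₁ (0 : ZMod n) := by
  simp only [dunklZ_eq, reflSum, add_mul, mul_add, Finset.sum_mul, Finset.mul_sum, smul_mul_assoc,
    mul_smul_comm, diffCyc_mul_mulZbar, twoDzbar_mul_mulZbar, smul_add, Finset.sum_add_distrib,
    mul_zero, AddChar.map_zero_eq_one, one_smul]
  abel

theorem dunklZbar_mul_mulZ : dunklZbar n ν₀ ν₁ * mulZ =
    mulZ * dunklZbar n ν₀ ν₁ + 2 + reflSum ν₀ ν₁ (0 : ZMod n) := by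
  have h : ∀ c : ZMod n, (ZMod.stdAddChar (-c) * ZMod.stdAddChar c : ℂ) = 1 := fun c => by
    rw [mul_comm, stdAddChar_mul_neg]
  simp only [dunklZbar_eq, reflSum, add_mul, mul_add, Finset.sum_mul, Finset.mul_sum, smul_mul_assoc,
    mul_smul_comm, diffCyc_mul_mulZ, twoDz_mul_mulZ, smul_add, Finset.sum_add_distrib,
    mul_zero, AddChar.map_zero_eq_one, one_smul, smul_smul (ZMod.stdAddChar (-_) : ℂ) (ZMod.stdAddChar _), h]
  abel

theorem dunklZbar_mul_mulZbar : dunklZbar n ν₀ ν₁ * mulZbar =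
    mulZbar * dunklZbar n ν₀ ν₁ + reflSum ν₀ ν₁ (-1 : ZMod n) := by
  simp only [dunklZbar_eq, reflSum, add_mul, mul_add, Finset.sum_mul, Finset.mul_sum, smul_mul_assoc,
    mul_smul_comm, diffCyc_mul_mulZbar, twoDz_mul_mulZbar, smul_add, Finset.sum_add_distrib,
    mul_neg, mul_one, add_assoc]

theorem sum_reflect {M : Type*} [AddCommMonoid M] (a : ZMod n) (F : ZMod n → M) :
    ∑ c, F (2 * a - c) = ∑ c, F c :=
  Fintype.sum_equiv (Equiv.subLeft (2 * a)) _ _ fun _ => rfl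

theorem reflCyc_mul_dunklZ (a : ZMod n) : reflCyc a * dunklZ n ν₀ ν₁ =
    -((ZMod.stdAddChar a : ℂ) • (dunklZbar n ν₀ ν₁ * reflCyc a)) := by
  simp only [dunklZ_eq, dunklZbar_eq, mul_add, add_mul, Finset.sum_mul, Finset.mul_sum, smul_mul_assoc,
    mul_smul_comm, reflCyc_mul_twoDzbar, reflCyc_mul_diffCyc, smul_add, neg_add, smul_neg,
    Finset.sum_neg_distrib, Finset.smul_sum]
  rw [← sum_reflect a fun c => (ZMod.stdAddChar a : ℂ) • weight ν₀ ν₁ c • (ZMod.stdAddChar (-c) : ℂ) •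
    (diffCyc c * reflCyc a)]
  congr 2
  refine Finset.sum_congr rfl fun c _ => ?_
  rw [weight_reflect, smul_comm (ZMod.stdAddChar a : ℂ), smul_smul (ZMod.stdAddChar a : ℂ),
    ← AddChar.map_add_eq_mul]
  congr 3
  ring

theorem reflCyc_mul_dunklZbar (a : ZMod n) : reflCyc a * dunklZbar n ν₀ ν₁ =
    -((ZMod.stdAddChar (-a) : ℂ) • (dunklZ n ν₀ ν₁ * reflCyc a)) := by
  simp only [dunklZ_eq, dunklZbar_eq, mul_add, add_mul, Finset.sum_mul, Finset.mul_sum, smul_mul_assoc,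
    mul_smul_comm, reflCyc_mul_twoDz, reflCyc_mul_diffCyc, smul_add, neg_add, smul_neg,
    Finset.sum_neg_distrib, Finset.smul_sum]
  rw [← sum_reflect a fun c => (ZMod.stdAddChar (-a) : ℂ) • weight ν₀ ν₁ c • (diffCyc c * reflCyc a)]
  congr 2
  refine Finset.sum_congr rfl fun c _ => ?_
  rw [weight_reflect, smul_comm (ZMod.stdAddChar (-a) : ℂ), smul_smul (ZMod.stdAddChar (-c) : ℂ),
    ← AddChar.map_add_eq_mul]
  congr 3
  ring

theorem rotCyc_mul_of_reflCyc {X Y : Module.End ℂ FunSpace}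
    (h1 : ∀ a : ZMod n, reflCyc a * X = -((ZMod.stdAddChar a : ℂ) • (Y * reflCyc a)))
    (h2 : ∀ a : ZMod n, reflCyc a * Y = -((ZMod.stdAddChar (-a) : ℂ) • (X * reflCyc a))) (a : ZMod n) :
    rotCyc a * X = (ZMod.stdAddChar (-a) : ℂ) • (X * rotCyc a) ∧
      rotCyc a * Y = (ZMod.stdAddChar a : ℂ) • (Y * rotCyc a) := by
  have h : rotCyc a = reflCyc a * reflCyc (0 : ZMod n) := by rw [reflCyc_mul_reflCyc, sub_zero]
  constructor
  · rw [h, mul_assoc, h1, AddChar.map_zero_eq_one, one_smul, mul_neg, ← mul_assoc, h2, neg_mul, neg_neg,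
      smul_mul_assoc, mul_assoc]
  · rw [h, mul_assoc, h2, neg_zero, AddChar.map_zero_eq_one, one_smul, mul_neg, ← mul_assoc, h1, neg_mul,
      neg_neg, smul_mul_assoc, mul_assoc]

theorem reflSum_mul_dunklZ (a : ZMod n) : reflSum ν₀ ν₁ a * dunklZ n ν₀ ν₁ =
    -(dunklZbar n ν₀ ν₁ * reflSum ν₀ ν₁ (a + 1)) := by
  simp only [reflSum, Finset.sum_mul, Finset.mul_sum, smul_mul_assoc, mul_smul_comm, reflCyc_mul_dunklZ,
    smul_neg, Finset.sum_neg_distrib, smul_smul (ZMod.stdAddChar _ : ℂ) (ZMod.stdAddChar _),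
    ← AddChar.map_add_eq_mul, mul_add, mul_one]

theorem reflSum_mul_dunklZbar (a : ZMod n) : reflSum ν₀ ν₁ a * dunklZbar n ν₀ ν₁ =
    -(dunklZ n ν₀ ν₁ * reflSum ν₀ ν₁ (a - 1)) := by
  simp only [reflSum, Finset.sum_mul, Finset.mul_sum, smul_mul_assoc, mul_smul_comm, reflCyc_mul_dunklZbar,
    smul_neg, Finset.sum_neg_distrib, smul_smul (ZMod.stdAddChar _ : ℂ) (ZMod.stdAddChar _),
    ← AddChar.map_add_eq_mul, mul_one, sub_eq_add_neg, mul_add, mul_neg]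

/-- The constant function `1`. -/
def oneFun : FunSpace := ⟨fun _ => 1, Function.HasTemperateGrowth.const 1⟩

theorem dirDeriv_oneFun (w : ℂ) : dirDeriv w oneFun = 0 := by
  ext z
  change fderiv ℝ (fun _ : ℂ => (1 : ℂ)) z w = 0
  simp

theorem diffCyc_oneFun (c : ZMod n) : diffCyc c oneFun = 0 := by
  ext z
  rw [diffCyc_apply (root_val_sq c)]
  have h1 : fderiv ℝ oneFun z (root n c.val) = 0 := by
    change fderiv ℝ (fun _ : ℂ => (1 : ℂ)) z _ = 0
    simp
  have h2 : ∀ y, oneFun y = 1 := fun _ => rfl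
  simp only [dividedDiff, h1, h2, sub_self, zero_div, ite_self, mul_zero]
  rfl

theorem dunklZ_oneFun : dunklZ n ν₀ ν₁ oneFun = 0 := by
  simp [dunklZ_eq, twoDzbar, dirDeriv_oneFun, diffCyc_oneFun]

theorem dunklZbar_oneFun : dunklZbar n ν₀ ν₁ oneFun = 0 := by
  simp [dunklZbar_eq, twoDz, dirDeriv_oneFun, diffCyc_oneFun]

theorem temperate_segment (u : ℂ) (f : FunSpace) :
    (fun p : ℝ × ℂ => f (u + (p.1 : ℂ) * (p.2 - u))).HasTemperateGrowth := by
  have hsnd : (fun p : ℝ × ℂ => p.2).HasTemperateGrowth :=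
    (ContinuousLinearMap.snd ℝ ℝ ℂ).hasTemperateGrowth
  have hfst : (fun p : ℝ × ℂ => (p.1 : ℂ)).HasTemperateGrowth :=
    Complex.ofRealCLM.hasTemperateGrowth.comp (ContinuousLinearMap.fst ℝ ℝ ℂ).hasTemperateGrowth
  exact f.temperate.comp ((Function.HasTemperateGrowth.const u).fun_add
    (hfst.fun_mul (hsnd.fun_sub (.const u))))

/-- Averages of a function over the segments issuing from a point. -/
def segmentAverage (u : ℂ) (f : FunSpace) : FunSpace :=
  ⟨fun z => ∫ t in (0 : ℝ)..1, f (u + (t : ℂ) * (z - u)), temperate_average (temperate_segment u f)⟩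

/-- Hadamard's lemma: integrate the derivative along the segment from `u`. The quotients stay in the
function space because averages over segments preserve polynomial growth. -/
theorem eq_hadamard (u : ℂ) (f : FunSpace) : f = f u • oneFun +
    (mulZ - u • 1) (segmentAverage u ((1 / 2 : ℂ) • twoDz f)) +
    (mulZbar - starRingEnd ℂ u • 1) (segmentAverage u ((1 / 2 : ℂ) • twoDzbar f)) := by
  ext z
  have key : ∀ t : ℝ, HasDerivAt (fun t : ℝ => f (u + (t : ℂ) * (z - u)))
      ((z - u) * ((1 / 2 : ℂ) • twoDz f) (u + (t : ℂ) * (z - u)) +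
        (starRingEnd ℂ z - starRingEnd ℂ u) * ((1 / 2 : ℂ) • twoDzbar f) (u + (t : ℂ) * (z - u))) t := by
    intro t
    have h1 : HasDerivAt (fun t : ℝ => u + (t : ℂ) * (z - u)) (z - u) t := by
      have := ((hasDerivAt_id t).ofReal_comp.mul_const (z - u)).const_add u
      simpa using this
    have h2 := (f.differentiable _).hasFDerivAt.comp_hasDerivAt t h1
    convert! h2 using 1
    rw [fderiv_eq_twoDz, map_sub]
    simp only [FunSpace.coe_smul, Pi.smul_apply, smul_eq_mul]
    ring
  have hc : ∀ g : FunSpace, Continuous fun t : ℝ => g (u + (t : ℂ) * (z - u)) := fun g =>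
    g.temperate.1.continuous.comp (by fun_prop)
  have hi : ∀ (c : ℂ) (g : FunSpace), IntervalIntegrable (fun t : ℝ => c * g (u + (t : ℂ) * (z - u)))
      MeasureTheory.volume 0 1 := fun c g => (continuous_const.mul (hc g)).intervalIntegrable _ _
  have hI := intervalIntegral.integral_eq_sub_of_hasDerivAt (a := (0 : ℝ)) (b := 1)
    (fun t _ => key t) ((hi _ _).add (hi _ _))
  rw [intervalIntegral.integral_add (hi _ _) (hi _ _), intervalIntegral.integral_const_mul,
    intervalIntegral.integral_const_mul] at hI
  simp only [Complex.ofReal_one, one_mul, Complex.ofReal_zero, zero_mul, add_zero,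
    add_sub_cancel] at hI
  change f z = f u * 1 + (z * segmentAverage u ((1 / 2 : ℂ) • twoDz f) z -
      u * segmentAverage u ((1 / 2 : ℂ) • twoDz f) z) +
    (starRingEnd ℂ z * segmentAverage u ((1 / 2 : ℂ) • twoDzbar f) z -
      starRingEnd ℂ u * segmentAverage u ((1 / 2 : ℂ) • twoDzbar f) z)
  have e : ∀ g : FunSpace, segmentAverage u g z = ∫ t in (0 : ℝ)..1, g (u + (t : ℂ) * (z - u)) :=
    fun _ => rfl
  rw [e, e]
  linear_combination -hI

/-- Apply `K` to the Hadamard expansion at `u` and evaluate at `u`: the constant is killed, and `K`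
passes the factors that vanish there. -/
theorem eq_zero_of_commute {K : Module.End ℂ FunSpace} (h1 : K * mulZ = mulZ * K)
    (h2 : K * mulZbar = mulZbar * K) (h0 : K oneFun = 0) : K = 0 := by
  ext f u
  have e1 : ∀ g, K ((mulZ - u • 1) g) = (mulZ - u • 1) (K g) := fun g => by
    have := LinearMap.congr_fun h1 g
    simp only [Module.End.mul_apply] at this
    simp [this]
  have e2 : ∀ g, K ((mulZbar - starRingEnd ℂ u • 1) g) = (mulZbar - starRingEnd ℂ u • 1) (K g) :=
    fun g => by
      have := LinearMap.congr_fun h2 g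
      simp only [Module.End.mul_apply] at this
      simp [this]
  conv_lhs => rw [eq_hadamard u f]
  rw [map_add, map_add, e1, e2, map_smul, h0, smul_zero, zero_add]
  generalize K (segmentAverage u ((1 / 2 : ℂ) • twoDz f)) = g1
  generalize K (segmentAverage u ((1 / 2 : ℂ) • twoDzbar f)) = g2
  change (u * g1 u - u * g1 u) + (starRingEnd ℂ u * g2 u - starRingEnd ℂ u * g2 u) = 0
  ring

/-- The commutator is not expanded. The relations with the coordinates show that it commutes with
both multiplications, the reflection sums cancelling in pairs, and it kills constants. -/
theorem dunkl_comm : dunklZ n ν₀ ν₁ * dunklZbar n ν₀ ν₁ = dunklZbar n ν₀ ν₁ * dunklZ n ν₀ ν₁ := by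
  refine sub_eq_zero.1 (eq_zero_of_commute ?_ ?_ ?_)
  · have a1 := dunklZ_mul_mulZ (n := n) ν₀ ν₁
    have a2 := dunklZbar_mul_mulZ (n := n) ν₀ ν₁
    have b1 := reflSum_mul_dunklZ (n := n) ν₀ ν₁ 0
    have b2 := reflSum_mul_dunklZbar (n := n) ν₀ ν₁ 1
    rw [zero_add] at b1
    rw [sub_self] at b2
    linear_combination (norm := noncomm_ring) dunklZ n ν₀ ν₁ * a2 - dunklZbar n ν₀ ν₁ * a1 +
      a1 * dunklZbar n ν₀ ν₁ - a2 * dunklZ n ν₀ ν₁ - b1 + b2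
  · have a1 := dunklZ_mul_mulZbar (n := n) ν₀ ν₁
    have a2 := dunklZbar_mul_mulZbar (n := n) ν₀ ν₁
    have b1 := reflSum_mul_dunklZ (n := n) ν₀ ν₁ (-1)
    have b2 := reflSum_mul_dunklZbar (n := n) ν₀ ν₁ 0
    rw [neg_add_cancel] at b1
    rw [zero_sub] at b2
    linear_combination (norm := noncomm_ring) dunklZ n ν₀ ν₁ * a2 - dunklZbar n ν₀ ν₁ * a1 +
      a1 * dunklZbar n ν₀ ν₁ - a2 * dunklZ n ν₀ ν₁ - b1 + b2
  · simp [dunklZ_oneFun, dunklZbar_oneFun]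

end Calogero

/-! ### Transport of the structure along homomorphisms. -/

namespace DihedralOscillator

variable {n : ℕ} [NeZero n] {A B : Type*} [Ring A] [Algebra ℂ A] [Ring B] [Algebra ℂ B]

/-- Pull the structure back along an injective homomorphism whose range contains all generators. -/
def comap (S : DihedralOscillator n B) (φ : A →ₐ[ℂ] B) (hφ : Function.Injective φ)
    (z zb D Db r : A) (ε : ZMod n → A) (hz : φ z = S.z) (hzb : φ zb = S.zb) (hD : φ D = S.D)
    (hDb : φ Db = S.Db) (hr : φ r = S.r) (hε : ∀ m, φ (ε m) = S.ε m) : DihedralOscillator n A where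
  z := z
  zb := zb
  D := D
  Db := Db
  r := r
  ε := ε
  γ := S.γ
  γ_eq_zero := S.γ_eq_zero
  r_mul_r := hφ (by simp only [map_mul, map_one, hr, S.r_mul_r])
  ε_mul_ε i j := hφ (by rw [apply_ite φ]; simp only [map_mul, map_zero, hε, S.ε_mul_ε])
  sum_ε := hφ (by simp only [map_sum, map_one, hε, S.sum_ε])
  r_mul_ε m := hφ (by simp only [map_mul, hr, hε, S.r_mul_ε])
  ε_mul_z m := hφ (by simp only [map_mul, hz, hε, S.ε_mul_z])
  ε_mul_zb m := hφ (by simp only [map_mul, hzb, hε, S.ε_mul_zb])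
  ε_mul_D m := hφ (by simp only [map_mul, hD, hε, S.ε_mul_D])
  ε_mul_Db m := hφ (by simp only [map_mul, hDb, hε, S.ε_mul_Db])
  r_mul_z := hφ (by simp only [map_mul, map_neg, hr, hz, hzb, S.r_mul_z])
  r_mul_zb := hφ (by simp only [map_mul, map_neg, hr, hz, hzb, S.r_mul_zb])
  r_mul_D := hφ (by simp only [map_mul, map_neg, hr, hD, hDb, S.r_mul_D])
  r_mul_Db := hφ (by simp only [map_mul, map_neg, hr, hD, hDb, S.r_mul_Db])
  z_mul_zb := hφ (by simp only [map_mul, hz, hzb, S.z_mul_zb])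
  D_mul_Db := hφ (by simp only [map_mul, hD, hDb, S.D_mul_Db])
  D_mul_z := hφ (by simp only [map_mul, map_add, map_sum, map_smul, hD, hz, hε, hr, S.D_mul_z])
  D_mul_zb := hφ (by
    simp only [map_mul, map_add, map_sum, map_smul, map_ofNat, hD, hzb, hε, hr, S.D_mul_zb])
  Db_mul_z := hφ (by
    simp only [map_mul, map_add, map_sum, map_smul, map_ofNat, hDb, hz, hε, hr, S.Db_mul_z])
  Db_mul_zb := hφ (by simp only [map_mul, map_add, map_sum, map_smul, hDb, hzb, hε, hr, S.Db_mul_zb])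

theorem linearIndependent_invFamily_of_map {S : DihedralOscillator n A} {T : DihedralOscillator n B}
    (φ : A →ₐ[ℂ] B) (hz : φ S.z = T.z) (hzb : φ S.zb = T.zb) (hD : φ S.D = T.D)
    (hDb : φ S.Db = T.Db) (hr : φ S.r = T.r) (hε : ∀ m, φ (S.ε m) = T.ε m) (hγ : S.γ = T.γ)
    (h : LinearIndependent ℂ T.invFamily) : LinearIndependent ℂ S.invFamily := by
  have hρ : φ (S.ρ 0) = T.ρ 0 := by simp only [ρ, map_sum, map_smul, map_mul, hε, hr, hγ]
  have hJ : φ S.J = T.J := by simp only [J, map_sub, map_smul, map_mul, hz, hzb, hD, hDb]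
  have e : ⇑φ.toLinearMap ∘ S.invFamily = T.invFamily := by
    funext i
    rcases i with i | i <;>
      simp [invFamily, Jp, Jm, hJ, hρ, hε, hr]
  exact LinearIndependent.of_comp φ.toLinearMap (by rw [e]; exact h)

end DihedralOscillator

/-! ### Spectral idempotents and the oscillator structure of the observables. -/

namespace Calogero

variable {n : ℕ} [NeZero n]

theorem sum_stdAddChar_mul (a : ZMod n) :
    ∑ k : ZMod n, (ZMod.stdAddChar (a * k) : ℂ) = if a = 0 then (n : ℂ) else 0 := by
  have h := AddChar.sum_mulShift (R' := ℂ) a (ZMod.isPrimitive_stdAddChar n)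
  rw [ZMod.card] at h
  simp only [mul_comm a]
  rw [h]
  split_ifs <;> simp

theorem natCast_ne_zero_complex : (n : ℂ) ≠ 0 := Nat.cast_ne_zero.2 (NeZero.ne n)

/-- The spectral idempotents of the rotations. -/
def spectral (m : ZMod n) : Module.End ℂ FunSpace :=
  (1 / n : ℂ) • ∑ k : ZMod n, (ZMod.stdAddChar (m * k) : ℂ) • rotCyc k

theorem spectral_mul_rotCyc (m k : ZMod n) :
    spectral m * rotCyc k = (ZMod.stdAddChar (-(m * k)) : ℂ) • spectral m := by
  rw [spectral, smul_mul_assoc, Finset.sum_mul, smul_comm (ZMod.stdAddChar _ : ℂ)]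
  congr 1
  rw [Finset.smul_sum]
  refine Fintype.sum_equiv (Equiv.addRight k) _ _ fun j => ?_
  rw [smul_mul_assoc, rotCyc_mul_rotCyc, Equiv.coe_addRight, smul_smul, ← AddChar.map_add_eq_mul]
  congr 2
  ring

theorem spectral_mul_spectral (i j : ZMod n) :
    spectral i * spectral j = if i = j then spectral i else 0 := by
  have h : spectral i * spectral j =
      ((1 / n : ℂ) * ∑ k, (ZMod.stdAddChar ((j - i) * k) : ℂ)) • spectral i := by
    conv_lhs => rw [spectral.eq_1 j, mul_smul_comm, Finset.mul_sum]
    rw [mul_smul, Finset.sum_smul]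
    congr 1
    refine Finset.sum_congr rfl fun k _ => ?_
    rw [mul_smul_comm, spectral_mul_rotCyc, smul_smul, ← AddChar.map_add_eq_mul]
    congr 2
    ring
  rw [h, sum_stdAddChar_mul]
  by_cases hij : i = j
  · rw [if_pos hij, if_pos (sub_eq_zero.2 hij.symm), one_div,
      inv_mul_cancel₀ natCast_ne_zero_complex, one_smul]
  · rw [if_neg hij, if_neg fun h => hij (sub_eq_zero.1 h).symm, mul_zero, zero_smul]

theorem sum_spectral : ∑ m : ZMod n, spectral m = 1 := by
  simp only [spectral]
  rw [← Finset.smul_sum, Finset.sum_comm]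
  simp only [← Finset.sum_smul, mul_comm _ (_ : ZMod n), sum_stdAddChar_mul, ite_smul, zero_smul,
    Finset.sum_ite_eq', Finset.mem_univ, if_true, smul_smul, one_div]
  rw [inv_mul_cancel₀ natCast_ne_zero_complex,
    one_smul, rotCyc_zero]

theorem rotCyc_eq_sum (k : ZMod n) :
    rotCyc k = ∑ m : ZMod n, (ZMod.stdAddChar (-(m * k)) : ℂ) • spectral m := by
  rw [← one_mul (rotCyc k), ← sum_spectral (n := n), Finset.sum_mul]
  simp only [spectral_mul_rotCyc]

theorem reflCyc_zero_mul_spectral (m : ZMod n) :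
    reflCyc (0 : ZMod n) * spectral m = spectral (-m) * reflCyc (0 : ZMod n) := by
  rw [spectral, spectral, mul_smul_comm, smul_mul_assoc, Finset.mul_sum, Finset.sum_mul]
  congr 1
  refine Fintype.sum_equiv (Equiv.neg _) _ _ fun k => ?_
  rw [mul_smul_comm, smul_mul_assoc, reflCyc_mul_rotCyc, Equiv.neg_apply, rotCyc_mul_reflCyc, neg_mul_neg,
    zero_sub, add_zero]

theorem spectral_mul_of_rotCyc_mul {X : Module.End ℂ FunSpace} {e : ZMod n}
    (h : ∀ k : ZMod n, rotCyc k * X = (ZMod.stdAddChar (e * k) : ℂ) • (X * rotCyc k)) (m : ZMod n) :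
    spectral m * X = X * spectral (m + e) := by
  rw [spectral, spectral, mul_smul_comm, smul_mul_assoc, Finset.mul_sum, Finset.sum_mul]
  congr 1
  refine Finset.sum_congr rfl fun k _ => ?_
  rw [mul_smul_comm, smul_mul_assoc, h, smul_smul, ← AddChar.map_add_eq_mul, add_mul]

variable (ν₀ ν₁ : ℂ)

/-- The Fourier transform of the coupling constants. -/
def coupling (m : ZMod n) : ℂ := ∑ c, weight ν₀ ν₁ c * ZMod.stdAddChar (-(c * m))

/-- The weights are invariant under translation by 2, so their Fourier transform is multiplied by
the character at -2m, which is 1 only if 2m = 0. -/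
theorem coupling_eq_zero (m : ZMod n) (hm : -m ≠ m) : coupling ν₀ ν₁ m = 0 := by
  have h : coupling ν₀ ν₁ m = ZMod.stdAddChar (-(2 * m)) * coupling ν₀ ν₁ m := by
    conv_lhs => rw [coupling]
    rw [coupling, Finset.mul_sum]
    refine (Fintype.sum_equiv (Equiv.addRight 2) _ _ fun c => ?_).symm
    have := weight_add_two_mul ν₀ ν₁ c 1
    rw [mul_one] at this
    rw [Equiv.coe_addRight, this, mul_left_comm, ← AddChar.map_add_eq_mul]
    congr 2
    ring
  have h2 : (ZMod.stdAddChar (-(2 * m)) : ℂ) ≠ 1 := by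
    intro h1
    rw [← AddChar.map_zero_eq_one (ZMod.stdAddChar (N := n))] at h1
    have h3 := ZMod.injective_stdAddChar h1
    refine hm ?_
    linear_combination h3
  by_contra h0
  exact h2 (mul_right_cancel₀ h0 (by rw [← h, one_mul]))

/-- The reflection with index c is the rotation by c times a fixed reflection; expanding the
rotations in idempotents is a Fourier transform of the weights. -/
theorem reflSum_eq (a : ZMod n) :
    reflSum ν₀ ν₁ a = ∑ m : ZMod n, coupling ν₀ ν₁ (m - a) • (spectral m * reflCyc (0 : ZMod n)) := by
  have h : ∀ c : ZMod n, reflCyc c = ∑ m : ZMod n, (ZMod.stdAddChar (-(m * c)) : ℂ) • (spectral m * reflCyc (0 : ZMod n)) := by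
    intro c
    have := rotCyc_mul_reflCyc c 0
    rw [add_zero] at this
    rw [← this, rotCyc_eq_sum, Finset.sum_mul]
    simp only [smul_mul_assoc]
  simp only [reflSum, coupling, Finset.sum_smul]
  rw [Finset.sum_comm]
  refine Finset.sum_congr rfl fun c _ => ?_
  rw [h, Finset.smul_sum, Finset.smul_sum]
  refine Finset.sum_congr rfl fun m _ => ?_
  rw [smul_smul, smul_smul, mul_assoc, ← AddChar.map_add_eq_mul]
  congr 3
  ring

/-- The Dunkl operators and the dihedral group satisfy the relations of the deformed oscillator. -/
def dunklOscillator (n : ℕ) [NeZero n] (ν₀ ν₁ : ℂ) :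
    DihedralOscillator n (Module.End ℂ FunSpace) where
  z := mulZ
  zb := mulZbar
  D := dunklZ n ν₀ ν₁
  Db := dunklZbar n ν₀ ν₁
  r := reflCyc (0 : ZMod n)
  ε := spectral
  γ := coupling ν₀ ν₁
  γ_eq_zero := coupling_eq_zero ν₀ ν₁
  r_mul_r := by rw [reflCyc_mul_reflCyc, sub_zero, rotCyc_zero]
  ε_mul_ε := spectral_mul_spectral
  sum_ε := sum_spectral
  r_mul_ε := reflCyc_zero_mul_spectral
  ε_mul_z m := by
    rw [sub_eq_add_neg]
    refine spectral_mul_of_rotCyc_mul (fun k => ?_) m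
    rw [neg_one_mul, (rotCyc_mul_of_reflCyc reflCyc_mul_mulZ reflCyc_mul_mulZbar k).1]
  ε_mul_zb := spectral_mul_of_rotCyc_mul fun k => by
    rw [one_mul, (rotCyc_mul_of_reflCyc reflCyc_mul_mulZ reflCyc_mul_mulZbar k).2]
  ε_mul_D m := by
    rw [sub_eq_add_neg]
    refine spectral_mul_of_rotCyc_mul (fun k => ?_) m
    rw [neg_one_mul, (rotCyc_mul_of_reflCyc (reflCyc_mul_dunklZ ν₀ ν₁) (reflCyc_mul_dunklZbar ν₀ ν₁) k).1]
  ε_mul_Db := spectral_mul_of_rotCyc_mul fun k => by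
    rw [one_mul, (rotCyc_mul_of_reflCyc (reflCyc_mul_dunklZ ν₀ ν₁) (reflCyc_mul_dunklZbar ν₀ ν₁) k).2]
  r_mul_z := by rw [reflCyc_mul_mulZ, AddChar.map_zero_eq_one, one_smul]
  r_mul_zb := by rw [reflCyc_mul_mulZbar, neg_zero, AddChar.map_zero_eq_one, one_smul]
  r_mul_D := by rw [reflCyc_mul_dunklZ, AddChar.map_zero_eq_one, one_smul]
  r_mul_Db := by rw [reflCyc_mul_dunklZbar, neg_zero, AddChar.map_zero_eq_one, one_smul]
  z_mul_zb := by
    ext f z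
    exact mul_left_comm _ _ _
  D_mul_Db := dunkl_comm ν₀ ν₁
  D_mul_z := by rw [dunklZ_mul_mulZ, reflSum_eq]
  D_mul_zb := by rw [dunklZ_mul_mulZbar, reflSum_eq]; simp only [sub_zero]
  Db_mul_z := by rw [dunklZbar_mul_mulZ, reflSum_eq]; simp only [sub_zero]
  Db_mul_zb := by rw [dunklZbar_mul_mulZbar, reflSum_eq]; simp only [sub_neg_eq_add]

section Observables

variable {ν₀ ν₁}

omit [NeZero n] in
theorem op_mem (g : Gen n) : g.op ν₀ ν₁ ∈ Observables n ν₀ ν₁ := Algebra.subset_adjoin ⟨g, rfl⟩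

omit [NeZero n] in
theorem mulZ_eq : mulZ = opA n ν₀ ν₁ 0 + opA n ν₀ ν₁ 1 := by
  simp only [opA, Fin.coe_ofNat_eq_mod]
  norm_num
  module

omit [NeZero n] in
theorem dunklZ_eq_opA : dunklZ n ν₀ ν₁ = opA n ν₀ ν₁ 0 - opA n ν₀ ν₁ 1 := by
  simp only [opA, Fin.coe_ofNat_eq_mod]
  norm_num
  module

omit [NeZero n] in
theorem mulZbar_eq : mulZbar = opB n ν₀ ν₁ 0 + opB n ν₀ ν₁ 1 := by
  simp only [opB, Fin.coe_ofNat_eq_mod]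
  norm_num
  module

omit [NeZero n] in
theorem dunklZbar_eq_opB : dunklZbar n ν₀ ν₁ = opB n ν₀ ν₁ 0 - opB n ν₀ ν₁ 1 := by
  simp only [opB, Fin.coe_ofNat_eq_mod]
  norm_num
  module

theorem reflCyc_mem (c : ZMod n) : reflCyc c ∈ Observables n ν₀ ν₁ := by
  have := op_mem (ν₀ := ν₀) (ν₁ := ν₁) (Gen.R (⟨c.val, ZMod.val_lt c⟩ : Fin n))
  rw [Gen.op, reflOp_eq] at this
  simpa using this

theorem rotCyc_mem (c : ZMod n) : rotCyc c ∈ Observables n ν₀ ν₁ := by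
  rw [← sub_zero c, ← reflCyc_mul_reflCyc]
  exact mul_mem (reflCyc_mem c) (reflCyc_mem 0)

theorem spectral_mem (m : ZMod n) : spectral m ∈ Observables n ν₀ ν₁ :=
  Subalgebra.smul_mem _ (sum_mem fun k _ => Subalgebra.smul_mem _ (rotCyc_mem k) _) _

variable (n ν₀ ν₁)

/-- The oscillator structure of the algebra of observables. -/
def oscillator : DihedralOscillator n (Observables n ν₀ ν₁) :=
  (dunklOscillator n ν₀ ν₁).comap (Observables n ν₀ ν₁).val Subtype.val_injective
    ⟨mulZ, by rw [mulZ_eq (n := n) (ν₀ := ν₀) (ν₁ := ν₁)]; exact add_mem (op_mem (Gen.a 0)) (op_mem (Gen.a 1))⟩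
    ⟨mulZbar, by rw [mulZbar_eq (n := n) (ν₀ := ν₀) (ν₁ := ν₁)]; exact add_mem (op_mem (Gen.b 0)) (op_mem (Gen.b 1))⟩
    ⟨dunklZ n ν₀ ν₁, by rw [dunklZ_eq_opA]; exact sub_mem (op_mem (Gen.a 0)) (op_mem (Gen.a 1))⟩
    ⟨dunklZbar n ν₀ ν₁, by rw [dunklZbar_eq_opB]; exact sub_mem (op_mem (Gen.b 0)) (op_mem (Gen.b 1))⟩
    ⟨reflCyc (0 : ZMod n), reflCyc_mem 0⟩
    (fun m : ZMod n => ⟨spectral m, spectral_mem m⟩) rfl rfl rfl rfl rfl (fun _ => rfl)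

end Observables

end Calogero

/-- Triangularity: in a linear relation, the functional of a term of maximal degree isolates its
coefficient. -/
theorem linearIndependent_of_functionals {ι V : Type*} [AddCommGroup V] [Module ℂ V] {v : ι → V}
    (deg : ι → ℕ) (h : ∀ i, ∃ Λ : V →ₗ[ℂ] ℂ, Λ (v i) ≠ 0 ∧ ∀ j, j ≠ i → deg j ≤ deg i → Λ (v j) = 0) :
    LinearIndependent ℂ v := by
  classical
  rw [linearIndependent_iff']
  intro s g hg
  by_contra! hne
  obtain ⟨i₀, hi₀, hg₀⟩ := hne
  obtain ⟨i, hi, hmax⟩ := Finset.exists_max_image (s.filter fun i => g i ≠ 0) deg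
    ⟨i₀, Finset.mem_filter.2 ⟨hi₀, hg₀⟩⟩
  obtain ⟨his, hgi⟩ := Finset.mem_filter.1 hi
  obtain ⟨Λ, h1, h2⟩ := h i
  have h3 := congrArg Λ hg
  rw [map_sum, map_zero, Finset.sum_eq_single i] at h3
  · rw [map_smul, smul_eq_mul] at h3
    exact (mul_ne_zero hgi h1) h3
  · intro j hj hji
    by_cases hgj : g j = 0
    · rw [hgj, zero_smul, map_zero]
    · rw [map_smul, h2 j hji (hmax j (Finset.mem_filter.2 ⟨hj, hgj⟩)), smul_zero]
  · exact fun h' => absurd his h'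

/-- Commutation with `X` differentiates powers of `W`, with `G` as the derivative of `W`; after l
steps the leading coefficient is the nonzero product (k + 1) ⋯ (k + l). -/
theorem exists_pow_mul_pow {A : Type*} [Ring A] [Algebra ℂ A] {X W G : A} (h : X * W = W * X + G)
    (hG : G * W = W * G) (l : ℕ) : ∀ k : ℕ, ∃ c : ℂ, c ≠ 0 ∧ ∃ a : A,
      X ^ l * W ^ (l + k) = W ^ k * (c • G ^ l + W * a) := by
  have hk : ∀ k : ℕ, X * W ^ (k + 1) = W ^ (k + 1) * X + ((k : ℂ) + 1) • (W ^ k * G) := by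
    intro k
    induction k with
    | zero => simp [h]
    | succ k ih =>
      have hc : W ^ k * G * W = W ^ (k + 1) * G := by rw [mul_assoc, hG, pow_succ, mul_assoc]
      rw [pow_succ W (k + 1), ← mul_assoc, ih, add_mul, mul_assoc (W ^ (k + 1)), h, mul_add,
        smul_mul_assoc, hc, mul_assoc]
      push_cast
      module
  induction l with
  | zero => exact fun k => ⟨1, one_ne_zero, 0, by simp⟩
  | succ l ih =>
    intro k
    obtain ⟨c, hc, a, ha⟩ := ih (k + 1)
    refine ⟨((k : ℂ) + 1) * c, mul_ne_zero (Nat.cast_add_one_ne_zero k) hc,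
      X * (c • G ^ l + W * a) + ((k : ℂ) + 1) • (G * a), ?_⟩
    have hG2 : G * (W * a) = W * (G * a) := by rw [← mul_assoc, hG, mul_assoc]
    rw [show l + 1 + k = l + (k + 1) by ring, pow_succ' X, mul_assoc, ha, ← mul_assoc, hk, add_mul,
      pow_succ W, smul_mul_assoc, mul_assoc, mul_assoc, mul_assoc, mul_add G, hG2, mul_smul_comm, ← pow_succ']
    rw [← mul_smul_comm, ← mul_add]
    congr 1
    simp only [mul_add, mul_smul_comm, smul_add, smul_smul]
    abel

/-! ### Commutators with the basic invariant of degree n. -/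

namespace DihedralOscillator

variable {n : ℕ} [NeZero n] {A : Type*} [Ring A] [Algebra ℂ A] (S : DihedralOscillator n A)

theorem D_mul_z_pow (j : ℕ) : S.D * S.z ^ j = S.z ^ j * S.D +
    ∑ i ∈ Finset.range j, S.z ^ i * ((-S.zb) ^ (j - 1 - i) * S.ρ ((j - 1 - i : ℕ) + 1)) := by
  induction j with
  | zero => simp
  | succ j ih =>
    rw [pow_succ, ← mul_assoc, ih, add_mul, mul_assoc, D_z, Finset.sum_range_succ, mul_add, ← mul_assoc,
      add_assoc, add_comm (S.z ^ j * S.ρ 1), Finset.sum_mul]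
    congr 2
    · refine Finset.sum_congr rfl fun i hi => ?_
      have hi := Finset.mem_range.1 hi
      rw [show j + 1 - 1 - i = j - 1 - i + 1 by omega, pow_succ, mul_assoc, mul_assoc, ρ_mul_z,
        mul_assoc _ (-S.zb)]
      push_cast
      rw [neg_mul]
    · simp

theorem D_mul_neg_zb_pow (j : ℕ) : S.D * (-S.zb) ^ j = (-S.zb) ^ j * S.D -
    ∑ i ∈ Finset.range j, ((2 : ℂ) • (-S.zb) ^ (j - 1) +
      (-S.zb) ^ i * (S.z ^ (j - 1 - i) * S.ρ (-(j - 1 - i : ℕ)))) := by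
  induction j with
  | zero => simp
  | succ j ih =>
    have h1 : S.D * (-S.zb) = (-S.zb) * S.D - ((2 : ℂ) • 1 + S.ρ 0) := by
      rw [mul_neg, D_zb, two_smul, one_add_one_eq_two, neg_mul]
      abel
    rw [pow_succ, ← mul_assoc, ih, sub_mul, mul_assoc, h1, Finset.sum_range_succ, mul_sub, ← mul_assoc,
      sub_sub, Finset.sum_mul, add_comm]
    congr 2
    · refine Finset.sum_congr rfl fun i hi => ?_
      have hi := Finset.mem_range.1 hi
      rw [show j + 1 - 1 - i = j - 1 - i + 1 by omega, pow_succ S.z, add_mul, mul_assoc, mul_assoc,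
        smul_mul_assoc, ← pow_succ, show j - 1 + 1 = j + 1 - 1 by omega, mul_neg (S.ρ _), ρ_mul_zb, neg_neg,
        mul_assoc _ S.z]
      push_cast
      rw [neg_add, sub_eq_add_neg]
    · simp [mul_add]

/-- The basic invariant of degree `n`. -/
def invariant : A := S.z ^ n + (-S.zb) ^ n

theorem z_comm_neg_zb : Commute S.z (-S.zb) := by
  rw [commute_iff_eq, mul_neg, neg_mul, S.z_mul_zb]

/-- The reflection terms coming from z^n and from (-zb)^n are the same after reversing the
summation, since i + 1 = -(n - 1 - i) in `ZMod n`. They cancel, and `D` acts on the invariant as an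
ordinary derivative. -/
theorem D_mul_invariant : S.D * S.invariant =
    S.invariant * S.D - (2 * n : ℂ) • (-S.zb) ^ (n - 1) := by
  have h : ∑ i ∈ Finset.range n, S.z ^ i * ((-S.zb) ^ (n - 1 - i) * S.ρ ((n - 1 - i : ℕ) + 1)) =
      ∑ i ∈ Finset.range n, (-S.zb) ^ i * (S.z ^ (n - 1 - i) * S.ρ (-(n - 1 - i : ℕ))) := by
    rw [← Finset.sum_range_reflect]
    refine Finset.sum_congr rfl fun i hi => ?_
    have hi := Finset.mem_range.1 hi
    have e : ((i : ℕ) + 1 : ZMod n) = -(n - 1 - i : ℕ) := by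
      rw [eq_neg_iff_add_eq_zero, add_assoc, ← Nat.cast_one, ← Nat.cast_add, ← Nat.cast_add,
        show i + (1 + (n - 1 - i)) = n by omega, ZMod.natCast_self]
    rw [show n - 1 - (n - 1 - i) = i by omega, e, ← mul_assoc, ← mul_assoc,
      (S.z_comm_neg_zb.pow_pow _ _).eq]
  rw [invariant, mul_add, add_mul, D_mul_z_pow, D_mul_neg_zb_pow, h, Finset.sum_add_distrib,
    Finset.sum_const, Finset.card_range, ← Nat.cast_smul_eq_nsmul ℂ, smul_smul, mul_comm (n : ℂ)]
  abel

theorem r_mul_z_pow (j : ℕ) : S.r * S.z ^ j = (-S.zb) ^ j * S.r := by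
  induction j with
  | zero => simp
  | succ j ih => rw [pow_succ, ← mul_assoc, ih, mul_assoc, S.r_mul_z, pow_succ, mul_assoc, neg_mul]

theorem r_mul_neg_zb_pow (j : ℕ) : S.r * (-S.zb) ^ j = S.z ^ j * S.r := by
  induction j with
  | zero => simp
  | succ j ih =>
    rw [pow_succ, ← mul_assoc, ih, mul_assoc, mul_neg, S.r_mul_zb, pow_succ, mul_assoc, neg_neg]

theorem r_mul_invariant : S.r * S.invariant = S.invariant * S.r := by
  rw [invariant, mul_add, add_mul, r_mul_z_pow, r_mul_neg_zb_pow, add_comm]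

theorem Db_mul_invariant : S.Db * S.invariant =
    S.invariant * S.Db + (2 * n : ℂ) • S.z ^ (n - 1) := by
  have h := congrArg (fun x => S.r * x * S.r) S.D_mul_invariant
  have h1 : S.r * (S.D * S.invariant) * S.r = -(S.Db * S.invariant) := by
    rw [← mul_assoc, S.r_mul_D, neg_mul, neg_mul, mul_assoc S.Db, r_mul_invariant, mul_assoc, mul_assoc,
      S.r_mul_r, mul_one]
  have h2 : S.r * (S.invariant * S.D) * S.r = -(S.invariant * S.Db) := by
    rw [← mul_assoc, r_mul_invariant, mul_assoc S.invariant, S.r_mul_D, mul_neg, neg_mul, mul_assoc,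
      mul_assoc, S.r_mul_r, mul_one]
  simp only [mul_sub, sub_mul, h1, h2, mul_smul_comm, smul_mul_assoc, r_mul_neg_zb_pow] at h
  rw [mul_assoc (S.z ^ _), S.r_mul_r, mul_one] at h
  rw [← neg_inj, h]
  abel

theorem ε_mul_neg_zb_pow (m : ZMod n) (j : ℕ) :
    S.ε m * (-S.zb) ^ j = (-S.zb) ^ j * S.ε (m + j) := by
  induction j with
  | zero => simp
  | succ j ih =>
    rw [pow_succ, ← mul_assoc, ih, mul_assoc, mul_neg, S.ε_mul_zb, mul_assoc, Nat.cast_succ, add_assoc,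
      neg_mul]

theorem ε_mul_invariant (m : ZMod n) : S.ε m * S.invariant = S.invariant * S.ε m := by
  rw [invariant, mul_add, add_mul, ε_z_pow, ε_mul_neg_zb_pow, ZMod.natCast_self, sub_zero, add_zero]

theorem ρ_mul_invariant (a : ZMod n) : S.ρ a * S.invariant = S.invariant * S.ρ a := by
  rw [ρ, Finset.sum_mul, Finset.mul_sum]
  refine Finset.sum_congr rfl fun m _ => ?_
  rw [smul_mul_assoc, mul_smul_comm, mul_assoc, r_mul_invariant, ← mul_assoc, ε_mul_invariant, mul_assoc]

/-- The commutator of the angular momentum with the basic invariant. -/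
def angular : A := (n : ℂ) • (S.z ^ n - (-S.zb) ^ n)

theorem z_mul_invariant : S.z * S.invariant = S.invariant * S.z :=
  (((Commute.refl S.z).pow_right n).add_right (S.z_comm_neg_zb.pow_right n)).eq

theorem zb_mul_invariant : S.zb * S.invariant = S.invariant * S.zb := by
  have h : Commute S.zb S.z := S.z_mul_zb.symm
  exact ((h.pow_right n).add_right (((Commute.refl S.zb).neg_right).pow_right n)).eq

theorem J_mul_invariant : S.J * S.invariant = S.invariant * S.J + S.angular := by
  obtain ⟨k, hk⟩ : ∃ k, n = k + 1 := ⟨n - 1, (Nat.succ_pred_eq_of_ne_zero (NeZero.ne n)).symm⟩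
  have h1 : S.z * S.z ^ (n - 1) = S.z ^ n := by rw [← pow_succ', Nat.sub_add_cancel (NeZero.one_le)]
  have h2 : S.zb * (-S.zb) ^ (n - 1) = -(-S.zb) ^ n := by
    rw [← neg_neg (S.zb * _), ← neg_mul, ← pow_succ', Nat.sub_add_cancel (NeZero.one_le)]
  rw [J, smul_mul_assoc, sub_mul, mul_assoc, mul_assoc, Db_mul_invariant, D_mul_invariant, mul_add, mul_sub,
    ← mul_assoc, ← mul_assoc, z_mul_invariant, zb_mul_invariant, mul_smul_comm, mul_smul_comm,
    mul_smul_comm, h1, h2, angular, mul_assoc, mul_assoc, mul_sub]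
  module

theorem Jp_mul_invariant : S.Jp * S.invariant = S.invariant * S.Jp + S.angular := by
  rw [Jp, add_mul, mul_add, smul_mul_assoc, mul_smul_comm, ρ_mul_invariant, J_mul_invariant]
  abel

theorem Jm_mul_invariant : S.Jm * S.invariant = S.invariant * S.Jm + S.angular := by
  rw [Jm, sub_mul, mul_sub, smul_mul_assoc, mul_smul_comm, ρ_mul_invariant, J_mul_invariant]
  abel

theorem angular_mul_invariant : S.angular * S.invariant = S.invariant * S.angular := by
  have h1 : Commute S.z S.invariant := S.z_mul_invariant
  have h2 : Commute S.zb S.invariant := S.zb_mul_invariant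
  exact ((h1.pow_left n).sub_left (h2.neg_left.pow_left n)).smul_left _

end DihedralOscillator

/-! ### Linear independence of the invariant monomials. -/

namespace Calogero

variable {n : ℕ} [NeZero n]

/-- Evaluation at a point of the plane. -/
def evalAt (x : ℂ) : FunSpace →ₗ[ℂ] ℂ where
  toFun f := f x
  map_add' _ _ := rfl
  map_smul' _ _ := rfl

theorem evalAt_mulZ_pow (x : ℂ) (j : ℕ) (f : FunSpace) :
    evalAt x ((mulZ ^ j) f) = x ^ j * evalAt x f := by
  induction j generalizing f with
  | zero => simp
  | succ j ih =>
    rw [pow_succ, Module.End.mul_apply, ih, pow_succ, mul_assoc]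
    rfl

theorem evalAt_neg_mulZbar_pow (x : ℂ) (j : ℕ) (f : FunSpace) :
    evalAt x (((-mulZbar) ^ j) f) = (-starRingEnd ℂ x) ^ j * evalAt x f := by
  induction j generalizing f with
  | zero => simp
  | succ j ih =>
    rw [pow_succ, Module.End.mul_apply, ih, pow_succ, mul_assoc, neg_mul]
    rfl

/-- The monomial-like function `z ^ a (z ^ n - q)`, as an element of the function space. -/
def testFun (n a : ℕ) (q : ℂ) : FunSpace := (mulZ ^ a) ((mulZ ^ n - q • 1) oneFun)

omit [NeZero n] in
theorem evalAt_testFun (a : ℕ) (q x : ℂ) : evalAt x (testFun n a q) = x ^ a * (x ^ n - q) := by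
  rw [testFun, evalAt_mulZ_pow, LinearMap.sub_apply, map_sub, evalAt_mulZ_pow, LinearMap.smul_apply,
    map_smul, Module.End.one_apply]
  change x ^ a * (x ^ n * 1 - q * 1) = _
  rw [mul_one, mul_one]

theorem evalAt_spectral (m : ZMod n) (f : FunSpace) (x : ℂ) : evalAt x (spectral m f) =
    1 / n * ∑ k, ZMod.stdAddChar (m * k) * evalAt (x * ZMod.stdAddChar (-k)) f := by
  rw [spectral, LinearMap.smul_apply, map_smul, LinearMap.sum_apply, map_sum]
  rfl

theorem stdAddChar_pow_self (k : ZMod n) : (ZMod.stdAddChar k : ℂ) ^ n = 1 := by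
  rw [← AddChar.map_nsmul_eq_pow, nsmul_eq_mul, ZMod.natCast_self, zero_mul, AddChar.map_zero_eq_one]

/-- The factor z^n - q is rotation invariant, so the function is an eigenvector of the rotations and
`spectral m` fixes it. -/
theorem evalAt_spectral_testFun (m : ZMod n) (q x : ℂ) :
    evalAt x (spectral m (testFun n m.val q)) = x ^ m.val * (x ^ n - q) := by
  have h : ∀ k : ZMod n, (ZMod.stdAddChar (m * k) * evalAt (x * ZMod.stdAddChar (-k)) (testFun n m.val q) : ℂ)
      = x ^ m.val * (x ^ n - q) := by
    intro k
    rw [evalAt_testFun, mul_pow, mul_pow, stdAddChar_pow_self, ← AddChar.map_nsmul_eq_pow, nsmul_eq_mul,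
      ZMod.natCast_zmod_val, mul_neg]
    linear_combination (x ^ m.val * (x ^ n - q)) * stdAddChar_mul_neg (m * k)
  rw [evalAt_spectral, Finset.sum_congr rfl fun k _ => h k, Finset.sum_const, Finset.card_univ, ZMod.card,
    nsmul_eq_mul, ← mul_assoc, one_div, inv_mul_cancel₀ natCast_ne_zero_complex, one_mul]

theorem evalAt_reflCyc_zero (f : FunSpace) (x : ℂ) :
    evalAt x (reflCyc (0 : ZMod n) f) = evalAt (-starRingEnd ℂ x) f := by
  change f (-(starRingEnd ℂ x * ZMod.stdAddChar (0 : ZMod n))) = _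
  rw [AddChar.map_zero_eq_one, mul_one]
  rfl

theorem evalAt_spectral_reflCyc_testFun (m : ZMod n) (q x : ℂ) :
    evalAt x (spectral (-m) (reflCyc (0 : ZMod n) (testFun n m.val q))) =
      (-starRingEnd ℂ x) ^ m.val * ((-starRingEnd ℂ x) ^ n - q) := by
  have h := LinearMap.congr_fun (reflCyc_zero_mul_spectral m) (testFun n m.val q)
  simp only [Module.End.mul_apply] at h
  rw [← h, evalAt_reflCyc_zero, evalAt_spectral_testFun]

/-- A point in general position with respect to the dihedral group. -/
theorem exists_generic_point (n : ℕ) [NeZero n] : ∃ x : ℂ, x ^ n ≠ (-starRingEnd ℂ x) ^ n := by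
  -- Here x^n = exp(iπ/4) while (-x*)^n = ± exp(-iπ/4); equality would make i equal to ± 1.
  refine ⟨Complex.exp (Real.pi * Complex.I / (4 * n)), fun h => ?_⟩
  have hn : (n : ℂ) ≠ 0 := natCast_ne_zero_complex
  rw [neg_pow, ← Complex.exp_conj, ← Complex.exp_nat_mul, ← Complex.exp_nat_mul] at h
  have e1 : (n : ℂ) * (Real.pi * Complex.I / (4 * n)) = Real.pi / 4 * Complex.I := by
    field_simp
  have e2 : (n : ℂ) * starRingEnd ℂ (Real.pi * Complex.I / (4 * n)) = -(Real.pi / 4 * Complex.I) := by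
    simp only [map_div₀, map_mul, Complex.conj_ofReal, Complex.conj_I, Complex.conj_natCast, map_ofNat]
    field_simp
  rw [e1, e2] at h
  have h2 : Complex.exp (Real.pi / 4 * Complex.I) * Complex.exp (Real.pi / 4 * Complex.I) = Complex.I := by
    rw [← Complex.exp_add, show (Real.pi / 4 * Complex.I + Real.pi / 4 * Complex.I : ℂ) =
      Real.pi / 2 * Complex.I by ring, Complex.exp_pi_div_two_mul_I]
  have h3 : Complex.exp (-(Real.pi / 4 * Complex.I)) * Complex.exp (Real.pi / 4 * Complex.I) = 1 := by
    rw [← Complex.exp_add, neg_add_cancel, Complex.exp_zero]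
  have h4 : Complex.I = (-1) ^ n := by
    linear_combination -h2 + Complex.exp (Real.pi / 4 * Complex.I) * h + (-1) ^ n * h3
  rcases neg_one_pow_eq_or ℂ n with h5 | h5 <;> rw [h5] at h4 <;>
    · have := congrArg Complex.im h4
      simp at this

variable (n) (ν₀ ν₁ : ℂ)

theorem evalAt_invariant (x : ℂ) (f : FunSpace) :
    evalAt x ((dunklOscillator n ν₀ ν₁).invariant f) = (x ^ n + (-starRingEnd ℂ x) ^ n) * evalAt x f := by
  change evalAt x ((mulZ ^ n + (-mulZbar) ^ n) f) = _
  rw [LinearMap.add_apply, map_add, evalAt_mulZ_pow, evalAt_neg_mulZbar_pow, add_mul]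

theorem evalAt_angular_pow (x : ℂ) (l : ℕ) (f : FunSpace) :
    evalAt x (((dunklOscillator n ν₀ ν₁).angular ^ l) f) =
      (n * (x ^ n - (-starRingEnd ℂ x) ^ n)) ^ l * evalAt x f := by
  induction l generalizing f with
  | zero => simp
  | succ l ih =>
    rw [pow_succ, Module.End.mul_apply, ih, pow_succ, mul_assoc]
    congr 1
    change evalAt x (((n : ℂ) • (mulZ ^ n - (-mulZbar) ^ n)) f) = _
    rw [LinearMap.smul_apply, map_smul, LinearMap.sub_apply, map_sub, evalAt_mulZ_pow,
      evalAt_neg_mulZbar_pow, smul_eq_mul]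
    ring

/-- The basic invariant, normalized to vanish at `x`. -/
def vanishing (x : ℂ) : Module.End ℂ FunSpace :=
  (dunklOscillator n ν₀ ν₁).invariant - (x ^ n + (-starRingEnd ℂ x) ^ n) • 1

theorem evalAt_vanishing (x : ℂ) (f : FunSpace) : evalAt x (vanishing n ν₀ ν₁ x f) = 0 := by
  rw [vanishing, LinearMap.sub_apply, map_sub, evalAt_invariant, LinearMap.smul_apply, map_smul,
    Module.End.one_apply, smul_eq_mul, sub_self]

theorem vanishing_comm {x : ℂ} {T : Module.End ℂ FunSpace}
    (h : T * (dunklOscillator n ν₀ ν₁).invariant = (dunklOscillator n ν₀ ν₁).invariant * T) :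
    T * vanishing n ν₀ ν₁ x = vanishing n ν₀ ν₁ x * T := by
  rw [vanishing, mul_sub, sub_mul, h, mul_smul_comm, smul_mul_assoc, mul_one, one_mul]

/-- Each commutator with `X` removes at most one factor vanishing at `x`. Fewer than N of them leave
such a factor; exactly N leave a multiple of the N-th power of `angular`, which is nonzero at a
generic point. -/
theorem evalAt_pow_mul_vanishing {x : ℂ} (hx : x ^ n ≠ (-starRingEnd ℂ x) ^ n)
    {X : Module.End ℂ FunSpace} (hX : X * (dunklOscillator n ν₀ ν₁).invariant =
      (dunklOscillator n ν₀ ν₁).invariant * X + (dunklOscillator n ν₀ ν₁).angular) (N : ℕ) :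
    (∃ c : ℂ, c ≠ 0 ∧ ∀ f, evalAt x ((X ^ N * vanishing n ν₀ ν₁ x ^ N) f) = c * evalAt x f) ∧
      ∀ l < N, ∀ f, evalAt x ((X ^ l * vanishing n ν₀ ν₁ x ^ N) f) = 0 := by
  have h1 : X * vanishing n ν₀ ν₁ x = vanishing n ν₀ ν₁ x * X + (dunklOscillator n ν₀ ν₁).angular := by
    rw [vanishing, mul_sub, sub_mul, hX, mul_smul_comm, smul_mul_assoc, mul_one, one_mul]
    abel
  have h2 := exists_pow_mul_pow h1
    (vanishing_comm n ν₀ ν₁ (x := x) (dunklOscillator n ν₀ ν₁).angular_mul_invariant)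
  constructor
  · obtain ⟨c, hc, a, ha⟩ := h2 N 0
    refine ⟨c * (n * (x ^ n - (-starRingEnd ℂ x) ^ n)) ^ N,
      mul_ne_zero hc (pow_ne_zero _ (mul_ne_zero natCast_ne_zero_complex (sub_ne_zero.2 hx))), fun f => ?_⟩
    rw [add_zero, pow_zero, one_mul] at ha
    rw [ha, LinearMap.add_apply, map_add, Module.End.mul_apply, evalAt_vanishing, add_zero,
      LinearMap.smul_apply, map_smul, evalAt_angular_pow, smul_eq_mul, mul_assoc]
  · intro l hl f
    obtain ⟨k, rfl⟩ := Nat.exists_eq_add_of_lt hl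
    obtain ⟨c, -, a, ha⟩ := h2 l (k + 1)
    rw [add_assoc, ha, pow_succ', mul_assoc, Module.End.mul_apply, evalAt_vanishing]

/-- The functionals T ↦ (T W^N g)(x) do not see degrees below N. In degree N a test function `g` of
the right rotation type selects the index, and its parameter `q`, equal to (-x*)^n or to x^n,
annihilates the reflection or the rotation respectively. -/
theorem linearIndependent_dunkl : LinearIndependent ℂ (dunklOscillator n ν₀ ν₁).invFamily := by
  set S := dunklOscillator n ν₀ ν₁ with hS
  obtain ⟨x, hx⟩ := exists_generic_point n
  have hx0 : x ≠ 0 := by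
    rintro rfl
    exact hx (by simp)
  have hx1 : -starRingEnd ℂ x ≠ 0 := by simpa using hx0
  set q := (-starRingEnd ℂ x) ^ n
  set W := vanishing n ν₀ ν₁ x
  have hε : ∀ N m, S.ε m * W ^ N = W ^ N * S.ε m := fun N m =>
    ((show Commute (S.ε m) W from vanishing_comm n ν₀ ν₁ (S.ε_mul_invariant m)).pow_right N).eq
  have hr : ∀ N, S.r * W ^ N = W ^ N * S.r := fun N =>
    ((show Commute S.r W from vanishing_comm n ν₀ ν₁ S.r_mul_invariant).pow_right N).eq
  have hm : ∀ N f, (∀ l < N, ∀ m, evalAt x ((S.Jm ^ l * S.ε m * W ^ N) f) = 0) ∧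
      ∀ l < N, ∀ m, evalAt x ((S.Jp ^ l * (S.ε m * S.r) * W ^ N) f) = 0 := by
    refine fun N f => ⟨fun l hl m => ?_, fun l hl m => ?_⟩
    · rw [mul_assoc, hε, ← mul_assoc, Module.End.mul_apply]
      exact (evalAt_pow_mul_vanishing n ν₀ ν₁ hx S.Jm_mul_invariant N).2 l hl _
    · rw [mul_assoc, mul_assoc, hr, ← mul_assoc (S.ε m), hε, mul_assoc, ← mul_assoc, Module.End.mul_apply]
      exact (evalAt_pow_mul_vanishing n ν₀ ν₁ hx S.Jp_mul_invariant N).2 l hl _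
  have hp : ∀ N, ∃ c d : ℂ, c ≠ 0 ∧ d ≠ 0 ∧
      (∀ m f, evalAt x ((S.Jm ^ N * S.ε m * W ^ N) f) = c * evalAt x (S.ε m f)) ∧
      ∀ m f, evalAt x ((S.Jp ^ N * (S.ε m * S.r) * W ^ N) f) = d * evalAt x ((S.ε m * S.r) f) := by
    intro N
    obtain ⟨c, hc, h1⟩ := (evalAt_pow_mul_vanishing n ν₀ ν₁ hx S.Jm_mul_invariant N).1
    obtain ⟨d, hd, h2⟩ := (evalAt_pow_mul_vanishing n ν₀ ν₁ hx S.Jp_mul_invariant N).1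
    refine ⟨c, d, hc, hd, fun m f => ?_, fun m f => ?_⟩
    · rw [mul_assoc, hε, ← mul_assoc, Module.End.mul_apply, h1]
    · rw [mul_assoc, mul_assoc, hr, ← mul_assoc (S.ε m), hε, mul_assoc, ← mul_assoc, Module.End.mul_apply,
        h2]
  have he : ∀ m j f, S.ε m (S.ε j f) = if m = j then S.ε m f else 0 := by
    intro m j f
    rw [← Module.End.mul_apply, S.ε_mul_ε]
    split_ifs <;> rfl
  have her : ∀ m j f, (S.ε m * S.r) (S.ε j f) = if m = -j then S.ε (-j) (S.r f) else 0 := by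
    intro m j f
    rw [← Module.End.mul_apply, mul_assoc, S.r_mul_ε, ← mul_assoc, S.ε_mul_ε]
    split_ifs with h
    · rw [h]; rfl
    · rw [zero_mul]; rfl
  have htest : ∀ m q, evalAt x (S.ε m (testFun n m.val q)) = x ^ m.val * (x ^ n - q) :=
    fun m q => evalAt_spectral_testFun m q x
  have htest' : ∀ m q, evalAt x (S.ε (-m) (S.r (testFun n m.val q))) =
      (-starRingEnd ℂ x) ^ m.val * ((-starRingEnd ℂ x) ^ n - q) :=
    fun m q => evalAt_spectral_reflCyc_testFun m q x
  refine linearIndependent_of_functionals (Sum.elim Prod.fst Prod.fst) ?_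
  have hΛ : ∀ g : FunSpace, ∃ Λ : Module.End ℂ FunSpace →ₗ[ℂ] ℂ, ∀ T, Λ T = evalAt x (T g) :=
    fun g => ⟨evalAt x ∘ₗ LinearMap.applyₗ g, fun T => rfl⟩
  rintro (⟨N, m⟩ | ⟨N, m⟩)
  · obtain ⟨c, d, hc, hd, h1, h2⟩ := hp N
    obtain ⟨Λ, hΛ⟩ := hΛ ((W ^ N) (S.ε m (testFun n m.val q)))
    refine ⟨Λ, ?_, ?_⟩
    · change Λ (S.Jm ^ N * S.ε m) ≠ 0
      rw [hΛ, ← Module.End.mul_apply, h1, he, if_pos rfl, htest]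
      exact mul_ne_zero hc (mul_ne_zero (pow_ne_zero _ hx0) (sub_ne_zero.2 hx))
    · rintro (⟨l, j⟩ | ⟨l, j⟩) hne hl
      · change Λ (S.Jm ^ l * S.ε j) = 0
        rw [hΛ, ← Module.End.mul_apply]
        rcases (show l ≤ N from hl).eq_or_lt with rfl | hl
        · rw [h1, he, if_neg (by rintro rfl; exact hne rfl), map_zero, mul_zero]
        · exact (hm N _).1 l hl j
      · change Λ (S.Jp ^ l * (S.ε j * S.r)) = 0
        rw [hΛ, ← Module.End.mul_apply]
        rcases (show l ≤ N from hl).eq_or_lt with rfl | hl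
        · rw [h2, her]
          split_ifs
          · rw [htest', sub_self, mul_zero, mul_zero]
          · rw [map_zero, mul_zero]
        · exact (hm N _).2 l hl j
  · obtain ⟨c, d, hc, hd, h1, h2⟩ := hp N
    -- The index is -m because the reflection carries the idempotent of -m to that of m.
    obtain ⟨Λ, hΛ⟩ := hΛ ((W ^ N) (S.ε (-m) (testFun n (-m).val (x ^ n))))
    refine ⟨Λ, ?_, ?_⟩
    · change Λ (S.Jp ^ N * (S.ε m * S.r)) ≠ 0
      rw [hΛ, ← Module.End.mul_apply, h2, her, if_pos (neg_neg m).symm, htest']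
      exact mul_ne_zero hd (mul_ne_zero (pow_ne_zero _ hx1) (sub_ne_zero.2 hx.symm))
    · rintro (⟨l, j⟩ | ⟨l, j⟩) hne hl
      · change Λ (S.Jm ^ l * S.ε j) = 0
        rw [hΛ, ← Module.End.mul_apply]
        rcases (show l ≤ N from hl).eq_or_lt with rfl | hl
        · rw [h1, he]
          split_ifs with h
          · rw [h, htest, sub_self, mul_zero, mul_zero]
          · rw [map_zero, mul_zero]
        · exact (hm N _).1 l hl j
      · change Λ (S.Jp ^ l * (S.ε j * S.r)) = 0
        rw [hΛ, ← Module.End.mul_apply]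
        rcases (show l ≤ N from hl).eq_or_lt with rfl | hl
        · rw [h2, her, if_neg (by rw [neg_neg]; rintro rfl; exact hne rfl), map_zero, mul_zero]
        · exact (hm N _).2 l hl j

theorem linearIndependent_invFamily : LinearIndependent ℂ (oscillator n ν₀ ν₁).invFamily :=
  DihedralOscillator.linearIndependent_invFamily_of_map (Observables n ν₀ ν₁).val rfl rfl rfl rfl rfl
    (fun _ => rfl) rfl (linearIndependent_dunkl n ν₀ ν₁)

end Calogero

/-! ### Supertraces of the algebra of observables. -/

namespace DihedralOscillator

open Polynomial in
-- The shift law at `X` and at 1, together with the jump at 1, eliminates all moments but those of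
-- `ε`. Thus `κ` is recovered from the values on rotations, and its Fourier modes later detect
-- independence.
theorem HasMoments.two_mul_κ {n : ℕ} [NeZero n] {A : Type*} [Ring A] [Algebra ℂ A]
    {S : DihedralOscillator n A} {M : DihedralMoments n S.γ} {L : A →ₗ[ℂ] ℂ} (hL : S.HasMoments M L)
    (m : ZMod n) : 2 * M.κ m = L (S.ε (m + 1)) + 2 * L (S.ε m) + L (S.ε (m - 1)) := by
  have hu : ∀ m, L (S.ε m) = M.tm m X := fun m => by simpa using hL.Jm_ε 0 m
  have h1 : ∀ m, M.tp m X = M.tm m X := fun m => by simpa using M.jump m X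
  have h2 : ∀ m, M.tm m X = -M.tm (m - 1) X - M.tp (m - 1) 1 := fun m => by
    have := M.shift m X
    rw [taylor_X, C_1, map_add, h1] at this
    rw [this]
    ring
  have h3 : ∀ m, M.tm m 1 = -M.tp (m - 1) 1 := fun m => by simpa using M.shift m 1
  have h4 : M.tp m 1 = M.tm m 1 - M.κ m * (1 + 1) := by simpa using M.jump m 1
  have h5 := h2 (m + 1)
  rw [add_sub_cancel_right] at h5
  rw [hu, hu, hu]
  linear_combination h4 + h3 m - h5 - h2 m

theorem D_mul_zb_mul_sub {n : ℕ} [NeZero n] {A : Type*} [Ring A] [Algebra ℂ A]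
    (S : DihedralOscillator n A) (x : A) :
    S.D * (S.zb * x) - S.z * (S.Db * x) = -((S.Jm - 1) * x + (S.Jm - 1) * x) := by
  linear_combination (norm := noncomm_ring) S.D_zb * x + S.Jm_double' * x

end DihedralOscillator

namespace Calogero

variable {n : ℕ} [NeZero n] {ν₀ ν₁ : ℂ}

/-- The generators as elements of the algebra of observables. -/
def genElem (ν₀ ν₁ : ℂ) (g : Gen n) : Observables n ν₀ ν₁ := ⟨g.op ν₀ ν₁, op_mem g⟩

omit [NeZero n] in
theorem coe_word (w : List (Gen n)) : ((w.map (genElem ν₀ ν₁)).prod : Module.End ℂ FunSpace) =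
    (w.map (Gen.op ν₀ ν₁)).prod := by
  rw [← Subalgebra.coe_val, map_list_prod, List.map_map]
  rfl

omit [NeZero n] in
theorem word_mem (w : List (Gen n)) :
    (w.map (genElem ν₀ ν₁)).prod ∈ parityPart n ν₀ ν₁ (w.map Gen.parity).sum :=
  Submodule.subset_span ⟨w, rfl, coe_word w⟩

omit [NeZero n] in
theorem genElem_mem (g : Gen n) : genElem ν₀ ν₁ g ∈ parityPart n ν₀ ν₁ g.parity := by
  simpa using word_mem (ν₀ := ν₀) (ν₁ := ν₁) [g]

omit [NeZero n] in
theorem parityPart_le {i : ZMod 2} {P : Submodule ℂ (Observables n ν₀ ν₁)}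
    (h : ∀ w : List (Gen n), (w.map Gen.parity).sum = i → (w.map (genElem ν₀ ν₁)).prod ∈ P) :
    parityPart n ν₀ ν₁ i ≤ P := by
  refine Submodule.span_le.2 ?_
  rintro T ⟨w, hw, hT⟩
  have e : T = (w.map (genElem ν₀ ν₁)).prod := Subtype.ext (by rw [hT, coe_word])
  rw [e]
  exact h w hw

omit [NeZero n] in
theorem mem_sup_parityPart (x : Observables n ν₀ ν₁) :
    x ∈ parityPart n ν₀ ν₁ 0 ⊔ parityPart n ν₀ ν₁ 1 := by
  rw [(isCompl_parityPart n ν₀ ν₁).sup_eq_top]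
  trivial

/-- The rotations as elements of the algebra of observables, indexed by `ZMod n`. -/
def rotElem (ν₀ ν₁ : ℂ) (c : ZMod n) : Observables n ν₀ ν₁ := ⟨rotCyc c, rotCyc_mem c⟩

theorem rotation_eq (j : Fin n) : rotation n ν₀ ν₁ j = rotElem ν₀ ν₁ ((j : ℕ) : ZMod n) := by
  refine Subtype.ext ?_
  change reflOp n j * reflOp n ((0 : Fin n) : ℕ) = rotCyc _
  rw [reflOp_eq, reflOp_eq, reflCyc_mul_reflCyc]
  simp

theorem rotElem_eq_rotation (c : ZMod n) :
    rotElem ν₀ ν₁ c = rotation n ν₀ ν₁ ⟨c.val, ZMod.val_lt c⟩ := by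
  rw [rotation_eq, ZMod.natCast_zmod_val]

theorem genElem_a (α : Fin 2) : genElem ν₀ ν₁ (Gen.a α) =
    (1 / 2 : ℂ) • ((oscillator n ν₀ ν₁).z + (-1 : ℂ) ^ (α : ℕ) • (oscillator n ν₀ ν₁).D) := rfl

theorem genElem_b (α : Fin 2) : genElem ν₀ ν₁ (Gen.b α) =
    (1 / 2 : ℂ) • ((oscillator n ν₀ ν₁).zb + (-1 : ℂ) ^ (α : ℕ) • (oscillator n ν₀ ν₁).Db) := rfl

theorem rotElem_eq_sum (c : ZMod n) : rotElem ν₀ ν₁ c =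
    ∑ m, (ZMod.stdAddChar (-(m * c)) : ℂ) • (oscillator n ν₀ ν₁).ε m := by
  refine Subtype.val_injective ?_
  rw [← Subalgebra.coe_val, map_sum]
  exact rotCyc_eq_sum c

theorem ε_eq_sum (m : ZMod n) : (oscillator n ν₀ ν₁).ε m =
    (1 / n : ℂ) • ∑ k : ZMod n, (ZMod.stdAddChar (m * k) : ℂ) • rotElem ν₀ ν₁ k := by
  refine Subtype.val_injective ?_
  rw [← Subalgebra.coe_val, map_smul, map_sum]
  rfl

theorem genElem_R (k : Fin n) : genElem ν₀ ν₁ (Gen.R k) =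
    (∑ m, (ZMod.stdAddChar (-(m * ((k : ℕ) : ZMod n))) : ℂ) • (oscillator n ν₀ ν₁).ε m) *
      (oscillator n ν₀ ν₁).r := by
  rw [← rotElem_eq_sum]
  refine Subtype.ext ?_
  change reflOp n k = rotCyc _ * reflCyc (0 : ZMod n)
  rw [reflOp_eq, rotCyc_mul_reflCyc, add_zero]

section Parity

variable (n ν₀ ν₁)

theorem z_mem : (oscillator n ν₀ ν₁).z ∈ parityPart n ν₀ ν₁ 1 := by
  have e : (oscillator n ν₀ ν₁).z = genElem ν₀ ν₁ (Gen.a 0) + genElem ν₀ ν₁ (Gen.a 1) := by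
    rw [genElem_a, genElem_a, Fin.val_zero, Fin.val_one]
    module
  rw [e]
  exact add_mem (genElem_mem (Gen.a 0)) (genElem_mem (Gen.a 1))

theorem D_mem : (oscillator n ν₀ ν₁).D ∈ parityPart n ν₀ ν₁ 1 := by
  have e : (oscillator n ν₀ ν₁).D = genElem ν₀ ν₁ (Gen.a 0) - genElem ν₀ ν₁ (Gen.a 1) := by
    rw [genElem_a, genElem_a, Fin.val_zero, Fin.val_one]
    module
  rw [e]
  exact sub_mem (genElem_mem (Gen.a 0)) (genElem_mem (Gen.a 1))

theorem zb_mem : (oscillator n ν₀ ν₁).zb ∈ parityPart n ν₀ ν₁ 1 := by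
  have e : (oscillator n ν₀ ν₁).zb = genElem ν₀ ν₁ (Gen.b 0) + genElem ν₀ ν₁ (Gen.b 1) := by
    rw [genElem_b, genElem_b, Fin.val_zero, Fin.val_one]
    module
  rw [e]
  exact add_mem (genElem_mem (Gen.b 0)) (genElem_mem (Gen.b 1))

theorem Db_mem : (oscillator n ν₀ ν₁).Db ∈ parityPart n ν₀ ν₁ 1 := by
  have e : (oscillator n ν₀ ν₁).Db = genElem ν₀ ν₁ (Gen.b 0) - genElem ν₀ ν₁ (Gen.b 1) := by
    rw [genElem_b, genElem_b, Fin.val_zero, Fin.val_one]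
    module
  rw [e]
  exact sub_mem (genElem_mem (Gen.b 0)) (genElem_mem (Gen.b 1))

theorem r_eq : (oscillator n ν₀ ν₁).r = genElem ν₀ ν₁ (Gen.R 0) := by
  refine Subtype.ext ?_
  change reflCyc (0 : ZMod n) = reflOp n ((0 : Fin n) : ℕ)
  rw [reflOp_eq]
  simp

theorem r_mem : (oscillator n ν₀ ν₁).r ∈ parityPart n ν₀ ν₁ 0 := by
  rw [r_eq]
  exact genElem_mem (Gen.R 0)

variable {n ν₀ ν₁} in
omit [NeZero n] in
theorem even_mul {i : ZMod 2} {x y : Observables n ν₀ ν₁} (hx : x ∈ parityPart n ν₀ ν₁ 0)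
    (hy : y ∈ parityPart n ν₀ ν₁ i) : x * y ∈ parityPart n ν₀ ν₁ i := by
  simpa using mul_mem_parityPart hx hy

variable {n ν₀ ν₁} in
omit [NeZero n] in
theorem mul_even {i : ZMod 2} {x y : Observables n ν₀ ν₁} (hx : x ∈ parityPart n ν₀ ν₁ i)
    (hy : y ∈ parityPart n ν₀ ν₁ 0) : x * y ∈ parityPart n ν₀ ν₁ i := by
  simpa using mul_mem_parityPart hx hy

variable {n ν₀ ν₁} in
omit [NeZero n] in
theorem odd_mul_odd {x y : Observables n ν₀ ν₁} (hx : x ∈ parityPart n ν₀ ν₁ 1)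
    (hy : y ∈ parityPart n ν₀ ν₁ 1) : x * y ∈ parityPart n ν₀ ν₁ 0 := by
  have := mul_mem_parityPart hx hy
  rwa [show (1 + 1 : ZMod 2) = 0 by decide] at this

theorem rotElem_mem (c : ZMod n) : rotElem ν₀ ν₁ c ∈ parityPart n ν₀ ν₁ 0 := by
  rw [rotElem_eq_rotation]
  exact even_mul (genElem_mem (Gen.R _)) (genElem_mem (Gen.R 0))

theorem ε_mem (m : ZMod n) : (oscillator n ν₀ ν₁).ε m ∈ parityPart n ν₀ ν₁ 0 := by
  rw [ε_eq_sum]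
  exact Submodule.smul_mem _ _ (Submodule.sum_mem _ fun k _ =>
    Submodule.smul_mem _ _ (rotElem_mem n ν₀ ν₁ k))

theorem J_mem : (oscillator n ν₀ ν₁).J ∈ parityPart n ν₀ ν₁ 0 :=
  Submodule.smul_mem _ _ (sub_mem (odd_mul_odd (z_mem n ν₀ ν₁) (Db_mem n ν₀ ν₁))
    (odd_mul_odd (zb_mem n ν₀ ν₁) (D_mem n ν₀ ν₁)))

theorem ρ_mem (a : ZMod n) : (oscillator n ν₀ ν₁).ρ a ∈ parityPart n ν₀ ν₁ 0 :=
  Submodule.sum_mem _ fun m _ => Submodule.smul_mem _ _ (even_mul (ε_mem n ν₀ ν₁ m) (r_mem n ν₀ ν₁))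

variable {n ν₀ ν₁} in
omit [NeZero n] in
theorem pow_mul_mem_even {x y : Observables n ν₀ ν₁} (hx : x ∈ parityPart n ν₀ ν₁ 0)
    (hy : y ∈ parityPart n ν₀ ν₁ 0) (l : ℕ) : x ^ l * y ∈ parityPart n ν₀ ν₁ 0 := by
  induction l with
  | zero => simpa using hy
  | succ l ih => rw [pow_succ', mul_assoc]; exact even_mul hx ih

theorem inv_le_parityPart : (oscillator n ν₀ ν₁).inv ≤ parityPart n ν₀ ν₁ 0 := by
  refine (oscillator n ν₀ ν₁).inv_le (fun l m => pow_mul_mem_even ?_ (ε_mem n ν₀ ν₁ m) l)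
    (fun l m => pow_mul_mem_even ?_ (even_mul (ε_mem n ν₀ ν₁ m) (r_mem n ν₀ ν₁)) l)
  · exact sub_mem (J_mem n ν₀ ν₁) (Submodule.smul_mem _ _ (ρ_mem n ν₀ ν₁ 0))
  · exact add_mem (J_mem n ν₀ ν₁) (Submodule.smul_mem _ _ (ρ_mem n ν₀ ν₁ 0))

end Parity

section FromSupertrace

variable {str : Module.Dual ℂ (Observables n ν₀ ν₁)} (hs : str ∈ supertraces n ν₀ ν₁)

include hs

omit [NeZero n] in
theorem even_comm {T : Observables n ν₀ ν₁} (hT : T ∈ parityPart n ν₀ ν₁ 0) (x : Observables n ν₀ ν₁) :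
    str (T * x) = str (x * T) := by
  obtain ⟨y, hy, w, hw, rfl⟩ := Submodule.mem_sup.1 (mem_sup_parityPart x)
  have h0 := hs 0 0 T hT y hy
  have h1 := hs 0 1 T hT w hw
  simp only [ZMod.val_zero, zero_mul, pow_zero, one_mul] at h0 h1
  rw [mul_add, add_mul, map_add, map_add, h0, h1]

omit [NeZero n] in
theorem odd_anticomm {T x : Observables n ν₀ ν₁} (hT : T ∈ parityPart n ν₀ ν₁ 1)
    (hx : x ∈ parityPart n ν₀ ν₁ 1) : str (T * x) = -str (x * T) := by
  have h := hs 1 1 T hT x hx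
  rwa [ZMod.val_one, mul_one, pow_one, neg_one_mul] at h

/-- Commutators with even elements have supertrace zero, which disposes of `nontriv`. The relations
`raise` and `lower` come from carrying the odd elements `z` and `D` around with a sign. -/
theorem isSupertrace_of_mem : (oscillator n ν₀ ν₁).IsSupertrace str := by
  set S := oscillator n ν₀ ν₁ with hS
  have hz := z_mem n ν₀ ν₁
  have hzb := zb_mem n ν₀ ν₁
  have hD := D_mem n ν₀ ν₁
  have hDb := Db_mem n ν₀ ν₁
  have hcom : ∀ T ∈ parityPart n ν₀ ν₁ 0, ∀ x, str (DihedralOscillator.com T x) = 0 := fun T hT x => by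
    rw [DihedralOscillator.com_apply, map_sub, even_comm hs hT, sub_self]
  have hf : S.f ∈ parityPart n ν₀ ν₁ 0 := Submodule.smul_mem _ _ (odd_mul_odd hD hDb)
  have he : S.e ∈ parityPart n ν₀ ν₁ 0 := Submodule.smul_mem _ _ (odd_mul_odd hz hzb)
  have hX : ∀ X ∈ S.inv, X ∈ parityPart n ν₀ ν₁ 0 := fun X h => inv_le_parityPart n ν₀ ν₁ h
  refine ⟨fun x hx => ?_, fun X _ => even_comm hs (r_mem n ν₀ ν₁) X,
    fun m X _ => even_comm hs (ε_mem n ν₀ ν₁ m) X, fun X hX0 => ?_, fun X hX0 => ?_⟩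
  · have h : S.nontriv ≤ LinearMap.ker str := by
      refine iSup_le fun k => S.orbit_le fun i y hy => ?_
      rw [LinearMap.mem_ker]
      cases i with
      | zero =>
        -- A highest weight vector of nonzero weight is itself a multiple of a commutator with the
        -- even element that defines `N`; its descendants are commutators with `f`.
        have h1 := hcom _ (sub_mem (even_mul hf he) (even_mul he hf)) y
        have h2 : S.N y = _ := S.N_hw hy
        change str (S.N y) = 0 at h1
        rw [h2, map_smul, smul_eq_mul] at h1
        rw [pow_zero, Module.End.one_apply]
        exact (mul_eq_zero.1 h1).resolve_left (Nat.cast_ne_zero.2 k.succ_ne_zero)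
      | succ i =>
        rw [pow_succ', Module.End.mul_apply]
        exact hcom S.f hf _
    exact h hx
  · have h1 := odd_anticomm hs (mul_even hD (hX X hX0)) hz
    have h2 := odd_anticomm hs (mul_even hz (hX X hX0)) hD
    rw [h1, h2, ← mul_assoc, ← mul_assoc, S.D_z, add_mul, map_add]
    ring
  · have h1 := odd_anticomm hs (mul_even hDb (hX X hX0)) hz
    have h2 := odd_anticomm hs (mul_even hzb (hX X hX0)) hD
    have e2 := congrArg str (S.D_mul_zb_mul_sub X)
    rw [map_sub, map_neg, map_add] at e2
    rw [h1, h2]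
    linear_combination e2

end FromSupertrace

section ToSupertrace

theorem mul_part_gen (g : Gen n) {i : ZMod 2} {x : Observables n ν₀ ν₁}
    (hx : x ∈ (oscillator n ν₀ ν₁).part i) :
    genElem ν₀ ν₁ g * x ∈ (oscillator n ν₀ ν₁).part (g.parity + i) := by
  set S := oscillator n ν₀ ν₁ with hS
  cases g with
  | a α =>
    rw [genElem_a, smul_mul_assoc, add_mul, smul_mul_assoc, add_comm]
    exact Submodule.smul_mem _ _ (add_mem (S.mul_part (fun k x h => (S.mul_spin h).1) hx)
      (Submodule.smul_mem _ _ (S.mul_part (fun k x h => (S.mul_spin h).2) hx)))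
  | b α =>
    rw [genElem_b, smul_mul_assoc, add_mul, smul_mul_assoc, add_comm]
    exact Submodule.smul_mem _ _ (add_mem (S.mul_part (fun k x h => (S.mul_spin' h).1) hx)
      (Submodule.smul_mem _ _ (S.mul_part (fun k x h => (S.mul_spin' h).2) hx)))
  | R k =>
    rw [genElem_R, mul_assoc, Finset.sum_mul, Gen.parity, zero_add]
    refine Submodule.sum_mem _ fun m _ => ?_
    rw [smul_mul_assoc]
    exact Submodule.smul_mem _ _ (S.mul_part_of_spin (fun k x h => S.ε_mul_spin m h)
      (S.mul_part_of_spin (fun k x h => S.r_mul_spin h) hx))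

/-- A word is built from 1 by left multiplications; odd generators change the spin by one half,
group elements preserve it. This gives the complete reducibility needed for `inv_sup_nontriv`. -/
theorem parityPart_le_part (i : ZMod 2) :
    parityPart n ν₀ ν₁ i ≤ (oscillator n ν₀ ν₁).part i := by
  refine parityPart_le fun w hw => ?_
  subst hw
  induction w with
  | nil => exact (oscillator n ν₀ ν₁).one_mem_part
  | cons g w ih =>
    simp only [List.map_cons, List.prod_cons, List.sum_cons]
    exact mul_part_gen g ih

theorem inv_sup_nontriv : (oscillator n ν₀ ν₁).inv ⊔ (oscillator n ν₀ ν₁).nontriv = ⊤ := by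
  rw [eq_top_iff, ← (isCompl_parityPart n ν₀ ν₁).sup_eq_top]
  exact sup_le ((parityPart_le_part 0).trans ((oscillator n ν₀ ν₁).part_le_sup 0))
    ((parityPart_le_part 1).trans ((oscillator n ν₀ ν₁).part_le_sup 1))

variable {L : Observables n ν₀ ν₁ →ₗ[ℂ] ℂ} (hL : (oscillator n ν₀ ν₁).IsSupertrace L)

theorem neg_one_pow_natCast_val (k : ℕ) : (-1 : ℂ) ^ ((k : ZMod 2)).val = (-1) ^ k := by
  rw [ZMod.val_natCast, ← neg_one_pow_eq_pow_mod_two]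

include hL

omit hL in
theorem part_comm {i j : ZMod 2} {u x : Observables n ν₀ ν₁}
    (h : ∀ k, ∀ x ∈ (oscillator n ν₀ ν₁).spin k, L (u * x) = ((-1) ^ k) ^ i.val * L (x * u))
    (hx : x ∈ (oscillator n ν₀ ν₁).part j) : L (u * x) = (-1) ^ (i.val * j.val) * L (x * u) := by
  have h1 : (oscillator n ν₀ ν₁).part j ≤ LinearMap.ker (L ∘ₗ LinearMap.mulLeft ℂ u -
      ((-1) ^ (i.val * j.val) : ℂ) • (L ∘ₗ LinearMap.mulRight ℂ u)) := by
    refine (oscillator n ν₀ ν₁).part_le fun k hk x hx => ?_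
    rw [LinearMap.mem_ker, LinearMap.sub_apply, sub_eq_zero]
    change L (u * x) = (-1) ^ (i.val * j.val) * L (x * u)
    rw [h k x hx, ← hk, mul_comm i.val, pow_mul, neg_one_pow_natCast_val]
  exact sub_eq_zero.1 (h1 hx)

theorem gen_comm (g : Gen n) {j : ZMod 2} {x : Observables n ν₀ ν₁}
    (hx : x ∈ (oscillator n ν₀ ν₁).part j) : L (genElem ν₀ ν₁ g * x) =
      (-1) ^ (g.parity.val * j.val) * L (x * genElem ν₀ ν₁ g) := by
  set S := oscillator n ν₀ ν₁ with hS
  refine part_comm (fun k x hx => ?_) hx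
  cases g with
  | a α =>
    obtain ⟨h1, h2⟩ := hL.spin_comm hx
    rw [genElem_a, Gen.parity, ZMod.val_one, pow_one]
    simp only [smul_mul_assoc, mul_smul_comm, add_mul, mul_add, map_smul, map_add, smul_eq_mul, ← hS, h1, h2]
    ring
  | b α =>
    obtain ⟨h1, h2⟩ := hL.spin_comm' hx
    rw [genElem_b, Gen.parity, ZMod.val_one, pow_one]
    simp only [smul_mul_assoc, mul_smul_comm, add_mul, mul_add, map_smul, map_add, smul_eq_mul, ← hS, h1, h2]
    ring
  | R k =>
    rw [genElem_R, Gen.parity, ZMod.val_zero, pow_zero, one_mul]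
    simp only [Finset.sum_mul, Finset.mul_sum, smul_mul_assoc, mul_smul_comm, map_sum, map_smul]
    refine Finset.sum_congr rfl fun m _ => ?_
    congr 1
    rw [mul_assoc, hL.spin_ε m (S.r_mul_spin hx), mul_assoc, hL.spin_r (S.spin_mul_ε m hx), mul_assoc]

/-- The letters of a word are carried around cyclically one at a time. The signs accumulate to that
of the whole word by bilinearity of the parity pairing modulo 2, which is `h3`. -/
theorem mem_supertraces : L ∈ supertraces n ν₀ ν₁ := by
  have key : ∀ w : List (Gen n), ∀ j, ∀ x ∈ parityPart n ν₀ ν₁ j, L ((w.map (genElem ν₀ ν₁)).prod * x) =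
      (-1) ^ ((w.map Gen.parity).sum.val * j.val) * L (x * (w.map (genElem ν₀ ν₁)).prod) := by
    intro w
    induction w with
    | nil => simp
    | cons g w ih =>
      intro j x hx
      simp only [List.map_cons, List.prod_cons, List.sum_cons]
      have h1 := gen_comm hL g (parityPart_le_part _ (mul_mem_parityPart (word_mem w) hx))
      have h2 := ih _ _ (mul_mem_parityPart hx (genElem_mem g))
      have h3 : ∀ a b c : ZMod 2, (a.val * (b + c).val + b.val * (c + a).val) % 2 =
          ((a + b).val * c.val) % 2 := by decide
      rw [mul_assoc, h1, mul_assoc, h2, ← mul_assoc, ← pow_add, mul_assoc x, neg_one_pow_eq_pow_mod_two, h3,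
        ← neg_one_pow_eq_pow_mod_two]
  intro i j T hT x hx
  have h : parityPart n ν₀ ν₁ i ≤ LinearMap.ker (L ∘ₗ LinearMap.mulRight ℂ x -
      ((-1) ^ (i.val * j.val) : ℂ) • (L ∘ₗ LinearMap.mulLeft ℂ x)) := by
    refine parityPart_le fun w hw => ?_
    rw [LinearMap.mem_ker, LinearMap.sub_apply, sub_eq_zero]
    subst hw
    exact key w j x hx
  exact sub_eq_zero.1 (h hT)

end ToSupertrace

end Calogero

/-! ### The dimension of the space of supertraces. -/

namespace Calogero

variable {n : ℕ} [NeZero n] {ν₀ ν₁ : ℂ}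

theorem stdAddChar_ne_neg_one {k : ZMod n} {j : ℕ} (hk : k = j) (hj : 2 * j < n) :
    (ZMod.stdAddChar k : ℂ) ≠ -1 := by
  intro h
  have h1 : (ZMod.stdAddChar (k + k) : ℂ) = ZMod.stdAddChar (0 : ZMod n) := by
    rw [AddChar.map_add_eq_mul, h, AddChar.map_zero_eq_one]
    norm_num
  have h2 := ZMod.injective_stdAddChar h1
  rw [hk, ← Nat.cast_add, ZMod.natCast_eq_zero_iff] at h2
  have h3 : j = 0 := by
    have := Nat.eq_zero_of_dvd_of_lt h2 (by omega)
    omega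
  rw [hk, h3, Nat.cast_zero, AddChar.map_zero_eq_one] at h
  norm_num at h

theorem stdAddChar_half {k : ZMod n} (hk : 2 * k.val = n) : (ZMod.stdAddChar (-k) : ℂ) = -1 := by
  have h1 : (ZMod.stdAddChar (-k) : ℂ) * ZMod.stdAddChar (-k) = 1 := by
    rw [← AddChar.map_add_eq_mul, ← AddChar.map_zero_eq_one (ZMod.stdAddChar (N := n))]
    congr 1
    have h : ((2 * k.val : ℕ) : ZMod n) = 0 := by rw [hk, ZMod.natCast_self]
    push_cast at h
    rw [ZMod.natCast_zmod_val] at h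
    linear_combination -h
  refine (mul_self_eq_one_iff.1 h1).resolve_left fun h2 => ?_
  rw [← AddChar.map_zero_eq_one (ZMod.stdAddChar (N := n))] at h2
  have h3 := neg_eq_zero.1 (ZMod.injective_stdAddChar h2)
  rw [h3, ZMod.val_zero] at hk
  exact NeZero.ne n hk.symm

theorem eq_zero_of_rotations {str : Module.Dual ℂ (Observables n ν₀ ν₁)}
    (hs : str ∈ supertraces n ν₀ ν₁)
    (h : ∀ j : Fin n, 2 * (j : ℕ) ≠ n → str (rotation n ν₀ ν₁ j) = 0) : str = 0 := by
  set S := oscillator n ν₀ ν₁ with hS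
  have hstr := isSupertrace_of_mem hs
  have h0 : ∀ m, str (S.ε m) + str (S.ε (m - 1)) = 0 := by
    intro m
    rw [hS, ε_eq_sum, ε_eq_sum, map_smul, map_smul, ← smul_add, map_sum, map_sum, ← Finset.sum_add_distrib,
      Finset.sum_eq_zero, smul_zero]
    intro k _
    rw [map_smul, map_smul, smul_eq_mul, smul_eq_mul, sub_mul, one_mul, sub_eq_add_neg,
      AddChar.map_add_eq_mul]
    -- In the value on ε m + ε (m - 1) the rotation by k carries a factor 1 + χ(-k), with χ the
    -- standard additive character. It is zero at the half turn, so nothing need be known there.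
    by_cases hk : 2 * k.val = n
    · rw [stdAddChar_half hk]
      ring
    · rw [rotElem_eq_rotation, h _ hk]
      ring
  have h1 : S.inv ≤ LinearMap.ker str := fun x hx =>
    hstr.eq_zero_of_rotations (fun x _ => even_comm hs (J_mem n ν₀ ν₁) x) h0 hx
  have h2 : S.nontriv ≤ LinearMap.ker str := hstr.nontriv
  have h3 := sup_le h1 h2
  rw [hS, inv_sup_nontriv] at h3
  exact LinearMap.ext fun x => h3 trivial

theorem str_rotElem_neg {str : Module.Dual ℂ (Observables n ν₀ ν₁)} (hs : str ∈ supertraces n ν₀ ν₁)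
    (c : ZMod n) : str (rotElem ν₀ ν₁ (-c)) = str (rotElem ν₀ ν₁ c) := by
  set r := (oscillator n ν₀ ν₁).r with hr
  have e : rotElem ν₀ ν₁ (-c) = r * (rotElem ν₀ ν₁ c * r) := by
    refine Subtype.ext ?_
    change rotCyc (-c) = reflCyc (0 : ZMod n) * (rotCyc c * reflCyc (0 : ZMod n))
    rw [rotCyc_mul_reflCyc, reflCyc_mul_reflCyc, add_zero, zero_sub]
  rw [e, even_comm hs (r_mem n ν₀ ν₁), mul_assoc, (oscillator n ν₀ ν₁).r_mul_r, mul_one]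

/-- The values of a supertrace on the rotations by less than a half turn. -/
def rotValues (n : ℕ) [NeZero n] (ν₀ ν₁ : ℂ) :
    supertraces n ν₀ ν₁ →ₗ[ℂ] (Fin ((n + 1) / 2) → ℂ) :=
  LinearMap.pi fun j => (LinearMap.applyₗ (rotElem ν₀ ν₁ ((j : ℕ) : ZMod n))) ∘ₗ
    (supertraces n ν₀ ν₁).subtype

/-- The rotations by j and by n - j are conjugate under the reflection, so the values below the half
turn determine all others except the half turn itself. -/
theorem rotValues_injective : Function.Injective (rotValues n ν₀ ν₁) := by
  rw [← LinearMap.ker_eq_bot, LinearMap.ker_eq_bot']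
  rintro ⟨str, hs⟩ h
  have h1 : ∀ j : ℕ, 2 * j < n → str (rotElem ν₀ ν₁ (j : ZMod n)) = 0 := fun j hj =>
    congrFun h ⟨j, by omega⟩
  refine Subtype.ext (eq_zero_of_rotations hs fun j hj => ?_)
  rw [rotation_eq]
  rcases lt_or_gt_of_ne hj with hj | hj
  · exact h1 j hj
  · rw [← str_rotElem_neg hs]
    have e : -((j : ℕ) : ZMod n) = ((n - j : ℕ) : ZMod n) := by
      rw [Nat.cast_sub j.2.le, ZMod.natCast_self, zero_sub]
    rw [e]
    exact h1 _ (by omega)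

/-- Translating the summation index by one multiplies the sum by minus the character at j, which
differs from 1. -/
theorem sum_alternating_eq_zero {j : ZMod n} (hj : (ZMod.stdAddChar j : ℂ) ≠ -1) {c : ZMod n → ℂ}
    (hc : ∀ m, c (m + 1) = -c m) : ∑ m, ZMod.stdAddChar (m * j) * c m = 0 := by
  have h : ∑ m, ZMod.stdAddChar (m * j) * c m =
      -ZMod.stdAddChar j * ∑ m, ZMod.stdAddChar (m * j) * c m := by
    conv_lhs => rw [← DihedralOscillator.sum_shift _ (1 : ZMod n)]
    rw [Finset.mul_sum]
    refine Finset.sum_congr rfl fun m _ => ?_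
    rw [hc, add_mul, one_mul, AddChar.map_add_eq_mul]
    ring
  have h2 : (1 + ZMod.stdAddChar j) * ∑ m, ZMod.stdAddChar (m * j) * c m = 0 := by
    linear_combination h
  refine (mul_eq_zero.1 h2).resolve_left fun h3 => hj ?_
  linear_combination h3

/-- Take for `κ` the cosine mode j. It is even, and 2 j < n keeps the character at ± j away from -1,
so it is orthogonal to the alternating sequences. -/
theorem exists_supertrace (j : ℕ) (hj : 2 * j < n) : ∃ L ∈ supertraces n ν₀ ν₁, ∀ m : ZMod n,
    L ((oscillator n ν₀ ν₁).ε (m + 1)) + 2 * L ((oscillator n ν₀ ν₁).ε m) +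
      L ((oscillator n ν₀ ν₁).ε (m - 1)) = 2 * (ZMod.stdAddChar (m * (j : ZMod n)) + ZMod.stdAddChar (-(m * (j : ZMod n)))) := by
  have hj1 : (ZMod.stdAddChar (j : ZMod n) : ℂ) ≠ -1 := stdAddChar_ne_neg_one rfl hj
  have hj2 : (ZMod.stdAddChar (-(j : ZMod n)) : ℂ) ≠ -1 := fun h => by
    have := stdAddChar_mul_neg (j : ZMod n)
    rw [h, mul_neg_one, neg_eq_iff_eq_neg] at this
    exact hj1 this
  obtain ⟨M, hM⟩ := exists_dihedralMoments (γ := (oscillator n ν₀ ν₁).γ)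
    (κ := fun m : ZMod n => (ZMod.stdAddChar (m * (j : ZMod n)) + ZMod.stdAddChar (-(m * (j : ZMod n))) : ℂ))
    (fun m => by simp only [neg_mul, neg_neg, add_comm]) (oscillator n ν₀ ν₁).γ_neg (fun c hc => by
      simp only [add_mul, Finset.sum_add_distrib, ← mul_neg]
      rw [sum_alternating_eq_zero hj1 hc, sum_alternating_eq_zero hj2 hc, add_zero])
  obtain ⟨L, h1, h2⟩ := (oscillator n ν₀ ν₁).exists_isSupertrace (linearIndependent_invFamily n ν₀ ν₁) M
  refine ⟨L, mem_supertraces h1, fun m => ?_⟩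
  rw [← h2.two_mul_κ, hM]

theorem exists_linearIndependent_supertraces :
    ∃ v : Fin ((n + 1) / 2) → supertraces n ν₀ ν₁, LinearIndependent ℂ v := by
  have hlt : ∀ j : Fin ((n + 1) / 2), 2 * (j : ℕ) < n := fun j => by have := j.2; omega
  choose L hL hκ using fun j : Fin ((n + 1) / 2) => exists_supertrace (ν₀ := ν₀) (ν₁ := ν₁) (j : ℕ) (hlt j)
  refine ⟨fun j => ⟨L j, hL j⟩, linearIndependent_of_functionals (fun _ => 0) fun i => ?_⟩
  set S := oscillator n ν₀ ν₁ with hS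
  -- Extraction of the i-th Fourier coefficient of 2 κ, where `κ` is read off from the values on the
  -- idempotents.
  let Λ : Module.Dual ℂ (Observables n ν₀ ν₁) →ₗ[ℂ] ℂ := LinearMap.applyₗ
    (∑ m : ZMod n, (ZMod.stdAddChar (-(i : ZMod n) * m) : ℂ) •
      (S.ε (m + 1) + (2 : ℂ) • S.ε m + S.ε (m - 1)))
  have hΛ : ∀ j, Λ (L j) = 2 * ((if ((j : ℕ) : ZMod n) = (i : ℕ) then (n : ℂ) else 0) +
      if (((j : ℕ) + (i : ℕ) : ℕ) : ZMod n) = 0 then (n : ℂ) else 0) := by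
    intro j
    have h1 : Λ (L j) = ∑ m : ZMod n, 2 * (ZMod.stdAddChar ((j - i : ZMod n) * m) +
        ZMod.stdAddChar (-((j + i : ZMod n)) * m)) := by
      change L j (∑ m : ZMod n, _) = _
      rw [map_sum]
      refine Finset.sum_congr rfl fun m _ => ?_
      rw [map_smul, map_add, map_add, map_smul, smul_eq_mul, smul_eq_mul, hκ, mul_left_comm, mul_add,
        ← AddChar.map_add_eq_mul, ← AddChar.map_add_eq_mul]
      congr 3 <;> ring
    rw [h1, ← Finset.mul_sum, Finset.sum_add_distrib, sum_stdAddChar_mul, sum_stdAddChar_mul]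
    simp only [neg_eq_zero, sub_eq_zero, Nat.cast_add]
  have hn : (n : ℂ) ≠ 0 := natCast_ne_zero_complex
  refine ⟨Λ ∘ₗ (supertraces n ν₀ ν₁).subtype, ?_, fun j hji _ => ?_⟩
  · change Λ (L i) ≠ 0
    rw [hΛ, if_pos rfl]
    split_ifs
    · rw [← two_mul]
      exact mul_ne_zero two_ne_zero (mul_ne_zero two_ne_zero hn)
    · rw [add_zero]
      exact mul_ne_zero two_ne_zero hn
  · change Λ (L j) = 0
    have hi := hlt i
    have hj := hlt j
    have h1 : ((j : ℕ) : ZMod n) ≠ (i : ℕ) := by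
      rw [Ne, ZMod.natCast_eq_natCast_iff', Nat.mod_eq_of_lt (by omega), Nat.mod_eq_of_lt (by omega)]
      exact fun h => hji (Fin.ext h)
    -- Both indices are below n / 2, so i + j vanishes modulo n only if i = j = 0.
    have h2 : (((j : ℕ) + (i : ℕ) : ℕ) : ZMod n) ≠ 0 := by
      rw [Ne, ZMod.natCast_eq_zero_iff]
      intro h
      have := Nat.eq_zero_of_dvd_of_lt h (by omega)
      exact hji (Fin.ext (by omega))
    rw [hΛ, if_neg h1, if_neg h2, add_zero, mul_zero]

theorem rank_supertraces : Module.rank ℂ (supertraces n ν₀ ν₁) = ((n + 1) / 2 : ℕ) := by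
  refine le_antisymm ?_ ?_
  · have h := LinearMap.rank_le_of_injective (rotValues n ν₀ ν₁) rotValues_injective
    rwa [rank_fin_fun] at h
  · obtain ⟨v, hv⟩ := exists_linearIndependent_supertraces (n := n) (ν₀ := ν₀) (ν₁ := ν₁)
    simpa using hv.cardinal_le_rank

end Calogero

end

theorem theorem2 (n : ℕ) [NeZero n] (ν₀ ν₁ : ℂ) :
    Module.rank ℂ (Calogero.supertraces n ν₀ ν₁) = ((n + 1) / 2 : ℕ) ∧
    (∀ str ∈ Calogero.supertraces n ν₀ ν₁,
      (∀ j : Fin n, 2 * (j : ℕ) ≠ n → str (Calogero.rotation n ν₀ ν₁ j) = 0) → str = 0) :=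
  ⟨Calogero.rank_supertraces, fun _ hs h => Calogero.eq_zero_of_rotations hs h⟩
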